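/- Let $T>0$ and $\mu\in\mathbb R$. Let $V\in L^1(\mathbb R^3)$ be a real-valued radial function with $V\ge 0$, not almost everywhere zero, and let $\widehat V(p)=\int_{\mathbb R^3}e^{-ip\cdot x}V(x)\,dx$, which is real and radial. Assume that $\widehat V\ge 0$, $\widehat V\in C^1(\mathbb R^3)\cap L^1(\mathbb R^3)$, $\|\widehat V\|_\infty<\infty$, $\|\nabla\widehat V\|_2<\infty$ and $\|\nabla\widehat V\|_\infty<\infty$. Let $$\mathcal D=\{(\gamma,\alpha,\rho_0)\;:\;\gamma\in L^1(\mathbb R^3,(1+p^2)dp),\ \gamma(p)\ge 0,\ \alpha(p)^2\le\gamma(p)(1+\gamma(p)),\ \rho_0\ge 0\},$$ where $\gamma,\alpha:\mathbb R^3\to\mathbb R$ are measurable and the inequalities hold for almost every $p$. For $(\gamma,\alpha,\rho_0)\in\mathcal D$ put $\rho=\rho_0+(2\pi)^{-3}\int_{\mathbb R^3}\gamma(p)\,dp$, $\beta(p)=\sqrt{(\tfrac12+\gamma(p))^2-\alpha(p)^2}$, $$S(\gamma,\alpha)=(2\pi)^{-3}\int_{\mathbb R^3}\Big[\big(\beta(p)+\tfrac12\big)\ln\big(\beta(p)+\tfrac12\big)-\big(\beta(p)-\tfrac12\big)\ln\big(\beta(p)-\tfrac12\big)\Big]dp$$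 (with $0\ln 0=0$), and define the grand canonical Bogoliubov free energy functional $$\begin{aligned}\mathcal F(\gamma,\alpha,\rho_0)={}&(2\pi)^{-3}\int_{\mathbb R^3}p^2\gamma(p)\,dp-\mu\rho-TS(\gamma,\alpha)+\frac{\widehat V(0)}2\rho^2\\&+\frac12(2\pi)^{-6}\iint_{\mathbb R^3\times\mathbb R^3}\widehat V(p-q)\big(\alpha(p)\alpha(q)+\gamma(p)\gamma(q)\big)\,dp\,dq\\&+\rho_0(2\pi)^{-3}\int_{\mathbb R^3}\widehat V(p)\big(\gamma(p)+\alpha(p)\big)\,dp.\end{aligned}$$ Then $\mathcal F$ has a minimizer on $\mathcal D$: there is $(\gamma^*,\alpha^*,\rho_0^*)\in\mathcal D$ with $\mathcal F(\gamma^*,\alpha^*,\rho_0^*)\le\mathcal F(\gamma,\alpha,\rho_0)$ for all $(\gamma,\alpha,\rho_0)\in\mathcal D$. -/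

import Mathlib

open MeasureTheory

noncomputable section

namespace Bogoliubov

/-- Momentum (or position) space `ℝ³` with the Euclidean norm and Lebesgue measure. -/
abbrev E3 : Type := EuclideanSpace ℝ (Fin 3)

/-- `f` is radial: its value depends only on the Euclidean length of the argument. -/
def IsRadial (f : E3 → ℝ) : Prop := ∀ x y : E3, ‖x‖ = ‖y‖ → f x = f y

/-- The Fourier transform `∫ e^{-i p·x} V(x) dx`, complex valued. -/
def fourierC (V : E3 → ℝ) (p : E3) : ℂ :=
  ∫ x : E3, Complex.exp (-(Complex.I * ((inner ℝ p x : ℝ) : ℂ))) * (V x : ℂ)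

/-- The Fourier transform of a radial potential as a real function; for a radial `V` the complex
Fourier transform is real, so taking the real part loses nothing, see `fourierC_eq_Vhat`. -/
def Vhat (V : E3 → ℝ) (p : E3) : ℝ := (fourierC V p).re

theorem fourierC_eq_Vhat {V : E3 → ℝ} (hV : IsRadial V) (p : E3) :
    fourierC V p = (Vhat V p : ℂ) := by
  refine (Complex.conj_eq_iff_re.mp ?_).symm
  unfold fourierC
  rw [← integral_conj, ← integral_neg_eq_self]
  refine integral_congr_ae (Filter.Eventually.of_forall fun x => ?_)
  have h : V (-x) = V x := hV _ _ (norm_neg x)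
  simp [h, ← Complex.exp_conj]

/-- `β = √((1/2 + γ)² - α²)`. -/
def beta (g a : ℝ) : ℝ := Real.sqrt ((1 / 2 + g) ^ 2 - a ^ 2)

/-- The entropy density `s(β) = (β + 1/2) ln (β + 1/2) - (β - 1/2) ln (β - 1/2)`,
with `0 ln 0 = 0`. -/
def entropyDensity (b : ℝ) : ℝ :=
  (b + 1 / 2) * Real.log (b + 1 / 2) - (b - 1 / 2) * Real.log (b - 1 / 2)

/-- The entropy `S(γ, α) = (2π)⁻³ ∫ s(β(p)) dp`. -/
def entropy (γ α : E3 → ℝ) : ℝ :=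
  ((2 * Real.pi) ^ 3)⁻¹ * ∫ p : E3, entropyDensity (beta (γ p) (α p))

/-- `ρ_γ = (2π)⁻³ ∫ γ(p) dp`. -/
def rhoGamma (γ : E3 → ℝ) : ℝ := ((2 * Real.pi) ^ 3)⁻¹ * ∫ p : E3, γ p

/-- The grand canonical Bogoliubov free energy functional at temperature `T` and chemical
potential `μ`, as a function of `(γ, α, ρ₀)`. -/
def freeEnergy (V : E3 → ℝ) (T μ : ℝ) (x : (E3 → ℝ) × (E3 → ℝ) × ℝ) : ℝ :=
  let γ := x.1
  let α := x.2.1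
  let ρ₀ := x.2.2
  let ρ := ρ₀ + rhoGamma γ
  ((2 * Real.pi) ^ 3)⁻¹ * (∫ p : E3, ‖p‖ ^ 2 * γ p)
    - μ * ρ
    - T * entropy γ α
    + Vhat V 0 / 2 * ρ ^ 2
    + 1 / 2 * ((2 * Real.pi) ^ 6)⁻¹ *
        (∫ p : E3, ∫ q : E3, Vhat V (p - q) * (α p * α q + γ p * γ q))
    + ρ₀ * (((2 * Real.pi) ^ 3)⁻¹ * ∫ p : E3, Vhat V p * (γ p + α p))

/-- The domain `𝒟` of the functional: `γ ∈ L¹((1+p²)dp)`, `γ ≥ 0`, `α` a measurable real function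
with `α² ≤ γ(1+γ)`, and `ρ₀ ≥ 0`; as usual for elements of `L¹`, the pointwise conditions
are meant almost everywhere. -/
def domainD : Set ((E3 → ℝ) × (E3 → ℝ) × ℝ) :=
  {x | Integrable (fun p : E3 => (1 + ‖p‖ ^ 2) * x.1 p) ∧
    (∀ᵐ p : E3, 0 ≤ x.1 p) ∧
    AEStronglyMeasurable x.2.1 ∧
    (∀ᵐ p : E3, x.2.1 p ^ 2 ≤ x.1 p * (1 + x.1 p)) ∧
    0 ≤ x.2.2}

end Bogoliubov

end

open MeasureTheory

noncomputable section

namespace Bogoliubov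

open Filter Topology

/-! ### Scalar facts on the entropy density -/

/-! At fixed condensate density the functional is convex in `(γ, α)`: β is a geometric mean of two
affine functions, hence concave, the entropy density is concave and increasing, and V ≥ 0 makes V̂ a
positive definite kernel (`dbl_Vhat_nonneg`). The Gibbs bound `PtDom.sDens_le_weight` and V̂(0) > 0
give coercivity, so `ρ₀`, the mass of γ and the kinetic energy are bounded on sublevel sets. Mass
cannot escape to infinite momentum, but it may concentrate at a point, and an L¹ limit would lose
it.

Concentration at the origin is harmless. The mean fields are Lipschitz, so a lump of γ in a small
ball around 0 acts on the rest of the state like condensate. Turning it into condensate, after a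
possible change of sign of α, costs O(δ) for a ball of radius δ (`exists_condense_bound`).

Concentration away from the origin is excluded by radial symmetry. A penalty ε(‖γ‖² + ‖α‖²) makes
the problem strictly convex; its minimizer is unique, hence rotation invariant, and satisfies
pointwise optimality conditions. Let e and w be the coefficients of γ and α in the linearised
energy. For small ε, γ is at least of order 1/(e - |w|) where this gap is small (`ae_le_gamma`). If
the gap nearly vanished at some p₀ ≠ 0, radiality and Lipschitz continuity would bound it by a
multiple of the distance to the sphere through p₀, up to a small error. The inverse distance is not
integrable across a sphere: many dyadic shells would carry equal mass, against the bound on ∫γ. So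
the gap is bounded below on |p| ≥ δ uniformly in small ε (`exists_gap_bound`), and γ is bounded
there.

Penalised minimizers thus give a minimizing sequence at fixed `ρ₀`, bounded in L² away from 0. In a
weighted L² space, elements of almost minimal norm in nested convex sublevel sets converge strongly
(`exists_seq_tendsto_of_nested`), which yields almost everywhere convergence, and L¹ convergence off
every ball at 0. Condensing shrinking balls and applying semicontinuity (`energy_le_of_tendsto`)
reaches the infimum, possibly at a larger `ρ₀`. The starting `ρ₀` is a limit point of the condensate
densities of a minimizing sequence of the full problem; Lipschitz dependence on `ρ₀` shows that the
infimum is still approached at that value. -/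

theorem continuous_entropyDensity : Continuous entropyDensity := by
  have h := Real.continuous_mul_log
  exact (h.comp (continuous_id.add continuous_const)).sub
    (h.comp (continuous_id.sub continuous_const))

theorem hasDerivAt_entropyDensity {b : ℝ} (hb : 1 / 2 < b) :
    HasDerivAt entropyDensity (Real.log (b + 1 / 2) - Real.log (b - 1 / 2)) b := by
  have h1 : HasDerivAt (fun x : ℝ => x + 1 / 2) 1 b := (hasDerivAt_id b).add_const _
  have h2 : HasDerivAt (fun x : ℝ => x - 1 / 2) 1 b := (hasDerivAt_id b).sub_const _
  have h3 := (Real.hasDerivAt_mul_log (x := b + 1 / 2) (by linarith)).comp b h1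
  have h4 := (Real.hasDerivAt_mul_log (x := b - 1 / 2) (by linarith)).comp b h2
  have h5 : HasDerivAt entropyDensity
      ((Real.log (b + 1 / 2) + 1) * 1 - (Real.log (b - 1 / 2) + 1) * 1) b := h3.sub h4
  convert h5 using 1
  ring

/-- The derivative of the entropy density is log of x = (b + 1/2)/(b - 1/2), and log x ≥ 1 - 1/x =
1/(b + 1/2). This quantifies the entropy gained when β grows, which drives the lower bound on γ in
`ae_le_gamma`. -/
theorem monotoneOn_entropyDensity_sub_log :
    MonotoneOn (fun b => entropyDensity b - Real.log (b + 1 / 2)) (Set.Ici (1 / 2)) := by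
  apply monotoneOn_of_deriv_nonneg (convex_Ici _)
  · refine continuous_entropyDensity.continuousOn.sub ?_
    refine ContinuousOn.log (by fun_prop) ?_
    intro x hx
    have : (1 / 2 : ℝ) ≤ x := hx
    linarith
  · intro x hx
    rw [interior_Ici] at hx
    have hx' : (1 / 2 : ℝ) < x := hx
    refine ((hasDerivAt_entropyDensity hx').sub
      (((hasDerivAt_id x).add_const _).log (by simp; linarith))).differentiableAt.differentiableWithinAt
  · intro x hx
    rw [interior_Ici] at hx
    have hx' : (1 / 2 : ℝ) < x := hx
    have hd : HasDerivAt (fun b => entropyDensity b - Real.log (b + 1 / 2))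
        (Real.log (x + 1 / 2) - Real.log (x - 1 / 2) - 1 / (x + 1 / 2)) x :=
      (hasDerivAt_entropyDensity hx').sub
        (((hasDerivAt_id' x).add_const _).log (by linarith))
    rw [hd.deriv]
    have h := Real.one_sub_inv_le_log_of_pos (x := (x + 1 / 2) / (x - 1 / 2))
      (div_pos (by linarith) (by linarith))
    rw [Real.log_div (by linarith) (by linarith)] at h
    have e : 1 - ((x + 1 / 2) / (x - 1 / 2))⁻¹ = 1 / (x + 1 / 2) := by
      have : x + 1 / 2 ≠ 0 := by linarith
      rw [inv_div]; field_simp; ring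
    rw [e] at h
    linarith

theorem entropyDensity_half : entropyDensity (1 / 2) = 0 := by
  unfold entropyDensity; norm_num

theorem log_sub_log_le_entropyDensity_sub {a b : ℝ} (ha : 1 / 2 ≤ a) (hab : a ≤ b) :
    Real.log (b + 1 / 2) - Real.log (a + 1 / 2) ≤ entropyDensity b - entropyDensity a := by
  have := monotoneOn_entropyDensity_sub_log (Set.mem_Ici.2 ha) (Set.mem_Ici.2 (ha.trans hab)) hab
  simp only at this
  linarith

theorem entropyDensity_mono {a b : ℝ} (ha : 1 / 2 ≤ a) (hab : a ≤ b) :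
    entropyDensity a ≤ entropyDensity b := by
  have := log_sub_log_le_entropyDensity_sub ha hab
  have h2 := Real.log_le_log (x := a + 1 / 2) (y := b + 1 / 2) (by linarith) (by linarith)
  linarith

theorem entropyDensity_nonneg {b : ℝ} (hb : 1 / 2 ≤ b) : 0 ≤ entropyDensity b := by
  have := entropyDensity_mono le_rfl hb
  rwa [entropyDensity_half] at this

theorem concaveOn_entropyDensity : ConcaveOn ℝ (Set.Ici (1 / 2)) entropyDensity := by
  apply AntitoneOn.concaveOn_of_deriv (convex_Ici _) continuous_entropyDensity.continuousOn
  · intro x hx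
    rw [interior_Ici] at hx
    exact (hasDerivAt_entropyDensity hx).differentiableAt.differentiableWithinAt
  · intro x hx y hy hxy
    rw [interior_Ici] at hx hy
    have hx' : (1 / 2 : ℝ) < x := hx
    have hy' : (1 / 2 : ℝ) < y := hy
    rw [(hasDerivAt_entropyDensity hx).deriv, (hasDerivAt_entropyDensity hy).deriv,
      ← Real.log_div (by linarith) (by linarith), ← Real.log_div (by linarith) (by linarith)]
    apply Real.log_le_log (div_pos (by linarith) (by linarith))
    rw [div_le_div_iff₀ (by linarith) (by linarith)]
    nlinarith

/-- The variational (Gibbs) bound on the bosonic entropy density. -/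
theorem entropyDensity_le {b x : ℝ} (hb : 1 / 2 ≤ b) (hx : 0 < x) :
    entropyDensity b ≤ x * (b - 1 / 2) + 2 / x ^ 2 := by
  rcases hb.eq_or_lt with rfl | hb
  · rw [entropyDensity_half]; positivity
  obtain ⟨g, rfl⟩ : ∃ g, b = g + 1 / 2 := ⟨b - 1 / 2, by ring⟩
  have hg : 0 < g := by linarith
  -- `q` is the Bose factor. The two log inequalities compare with the Gibbs state at energy `x`;
  -- their sum, the first weighted by `g`, is s ≤ x g - log (1 - q).
  set q := Real.exp (-x) with hq
  have hq0 : 0 < q := Real.exp_pos _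
  have hq1 : q < 1 := by rw [hq, Real.exp_lt_one_iff]; linarith
  have hlq : Real.log q = -x := Real.log_exp _
  have h1 := Real.log_le_sub_one_of_pos (x := (1 + g) * q / g) (by positivity)
  have h2 := Real.log_le_sub_one_of_pos (x := (1 + g) * (1 - q))
    (mul_pos (by linarith) (by linarith))
  rw [Real.log_div (by positivity) hg.ne', Real.log_mul (by positivity) hq0.ne', hlq] at h1
  rw [Real.log_mul (by positivity) (by linarith)] at h2
  have h3 := Real.log_le_sub_one_of_pos (x := (1 - q)⁻¹) (inv_pos.2 (by linarith))
  rw [Real.log_inv] at h3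
  -- The left side is the Bose occupation 1/(eˣ - 1), and eˣ ≥ 1 + x + x²/2.
  have h4 : (1 - q)⁻¹ - 1 ≤ 2 / x ^ 2 := by
    have hexp := Real.quadratic_le_exp_of_nonneg hx.le
    have hqe : q * Real.exp x = 1 := by rw [hq, ← Real.exp_add]; simp
    have hpos : 0 < Real.exp x - 1 := by nlinarith [sq_nonneg x]
    have : (1 - q)⁻¹ - 1 = 1 / (Real.exp x - 1) := by
      have h0 : 1 - q ≠ 0 := by linarith
      rw [eq_div_iff hpos.ne']
      field_simp
      linear_combination hqe
    rw [this, div_le_div_iff₀ hpos (by positivity)]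
    nlinarith
  have h5 := mul_le_mul_of_nonneg_left h1 hg.le
  have h6 : g * ((1 + g) * q / g - 1) = (1 + g) * q - g := by field_simp
  rw [h6] at h5
  unfold entropyDensity
  have e1 : g + 1 / 2 + 1 / 2 = 1 + g := by ring
  have e2 : g + 1 / 2 - 1 / 2 = g := by ring
  rw [e1, e2]
  nlinarith

/-- The pointwise constraint satisfied by `(γ(p), α(p))`. -/
def PtDom (g a : ℝ) : Prop := 0 ≤ g ∧ a ^ 2 ≤ g * (1 + g)

/-- The entropy density as a function of `(γ, α)`. -/
def sDens (g a : ℝ) : ℝ := entropyDensity (beta g a)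

theorem continuous_sDens : Continuous fun z : ℝ × ℝ => sDens z.1 z.2 := by
  unfold sDens beta
  exact continuous_entropyDensity.comp (by fun_prop)

theorem sDens_neg (g a : ℝ) : sDens g (-a) = sDens g a := by
  unfold sDens beta; rw [neg_sq]

theorem beta_zero : beta 0 0 = 1 / 2 := by
  unfold beta
  rw [show ((1 / 2 + 0) ^ 2 - 0 ^ 2 : ℝ) = (1 / 2) ^ 2 by ring, Real.sqrt_sq (by norm_num)]

theorem sDens_zero : sDens 0 0 = 0 := by
  unfold sDens; rw [beta_zero, entropyDensity_half]

theorem PtDom.zero : PtDom 0 0 := ⟨le_rfl, by norm_num⟩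

/-! ### Geometry of the pointwise constraint. -/

namespace PtDom

variable {g a g' a' : ℝ}

theorem neg (h : PtDom g a) : PtDom g (-a) := ⟨h.1, by rw [neg_sq]; exact h.2⟩

theorem half_le_beta (h : PtDom g a) : 1 / 2 ≤ beta g a := by
  unfold beta
  apply Real.le_sqrt_of_sq_le
  have := h.2
  nlinarith

theorem beta_le (h : PtDom g a) : beta g a ≤ 1 / 2 + g := by
  unfold beta
  have := h.1
  rw [Real.sqrt_le_left (by linarith)]
  nlinarith [sq_nonneg a]

theorem beta_sq (h : PtDom g a) : beta g a ^ 2 = (1 / 2 + g) ^ 2 - a ^ 2 := by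
  unfold beta
  have := h.2
  rw [Real.sq_sqrt (by nlinarith)]

theorem abs_le_add_half (h : PtDom g a) : |a| ≤ g + 1 / 2 := by
  have := h.1
  have h2 := h.2
  apply abs_le_of_sq_le_sq (by nlinarith) (by linarith)

/-- Unlike the bound by g + 1/2, this majorant lies in L¹ + L² when g is integrable. -/
theorem abs_le_add_sqrt (h : PtDom g a) : |a| ≤ g + √g := by
  have h1 := h.1
  have h2 := h.2
  have := Real.sqrt_nonneg g
  have h3 := Real.sq_sqrt h1
  apply abs_le_of_sq_le_sq (by nlinarith) (by linarith)

theorem sDens_nonneg (h : PtDom g a) : 0 ≤ sDens g a := entropyDensity_nonneg h.half_le_beta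

theorem sDens_le (h : PtDom g a) {x : ℝ} (hx : 0 < x) : sDens g a ≤ x * g + 2 / x ^ 2 := by
  refine (entropyDensity_le h.half_le_beta hx).trans ?_
  have := h.beta_le
  nlinarith

/-- β is the geometric mean √(uv) of the affine functions u = 1/2 + g + a and v = 1/2 + g - a, and
the geometric mean is concave; `key` is the arithmetic-geometric inequality for the cross term. -/
theorem le_beta_mix (h : PtDom g a) (h' : PtDom g' a') {t : ℝ} (h0 : 0 ≤ t) (h1 : t ≤ 1) :
    (1 - t) * beta g a + t * beta g' a' ≤
      beta ((1 - t) * g + t * g') ((1 - t) * a + t * a') := by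
  have hb := h.beta_sq
  have hb' := h'.beta_sq
  have p1 := h.half_le_beta
  have p2 := h'.half_le_beta
  have q1 := abs_le.1 h.abs_le_add_half
  have q2 := abs_le.1 h'.abs_le_add_half
  generalize beta g a = b at *
  generalize beta g' a' = b' at *
  unfold beta
  apply Real.le_sqrt_of_sq_le
  obtain ⟨u, hu⟩ : ∃ u, u = 1 / 2 + g + a := ⟨_, rfl⟩
  obtain ⟨v, hv⟩ : ∃ v, v = 1 / 2 + g - a := ⟨_, rfl⟩
  obtain ⟨u', hu'⟩ : ∃ u, u = 1 / 2 + g' + a' := ⟨_, rfl⟩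
  obtain ⟨v', hv'⟩ : ∃ v, v = 1 / 2 + g' - a' := ⟨_, rfl⟩
  have e1 : b ^ 2 = u * v := by rw [hb, hu, hv]; ring
  have e2 : b' ^ 2 = u' * v' := by rw [hb', hu', hv']; ring
  have u0 : 0 ≤ u := by linarith [q1.1]
  have v0 : 0 ≤ v := by linarith [q1.2]
  have u0' : 0 ≤ u' := by linarith [q2.1]
  have v0' : 0 ≤ v' := by linarith [q2.2]
  have key : 2 * (b * b') ≤ u * v' + u' * v := by
    refine le_of_sq_le_sq ?_ (by positivity)
    have : (2 * (b * b')) ^ 2 = 4 * (u * v) * (u' * v') := by rw [← e1, ← e2]; ring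
    rw [this]
    nlinarith [sq_nonneg (u * v' - u' * v)]
  have hmix : (1 / 2 + ((1 - t) * g + t * g')) ^ 2 - ((1 - t) * a + t * a') ^ 2 =
      ((1 - t) * u + t * u') * ((1 - t) * v + t * v') := by rw [hu, hv, hu', hv']; ring
  rw [hmix]
  have := mul_le_mul_of_nonneg_left key (mul_nonneg h0 (sub_nonneg.2 h1))
  have e3 : ((1 - t) * b + t * b') ^ 2 =
      (1 - t) ^ 2 * (u * v) + t * (1 - t) * (2 * (b * b')) + t ^ 2 * (u' * v') := by
    rw [← e1, ← e2]; ring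
  rw [e3]
  linarith

/-- The constraint says β ≥ 1/2 with g ≥ 0, a superlevel set of a concave function. -/
theorem mix (h : PtDom g a) (h' : PtDom g' a') {t : ℝ} (h0 : 0 ≤ t) (h1 : t ≤ 1) :
    PtDom ((1 - t) * g + t * g') ((1 - t) * a + t * a') := by
  have hg : 0 ≤ (1 - t) * g + t * g' :=
    add_nonneg (mul_nonneg (sub_nonneg.2 h1) h.1) (mul_nonneg h0 h'.1)
  refine ⟨hg, ?_⟩
  have h2 := h.le_beta_mix h' h0 h1
  have p1 := h.half_le_beta
  have p2 := h'.half_le_beta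
  have h3 : 1 / 2 ≤ beta ((1 - t) * g + t * g') ((1 - t) * a + t * a') := by nlinarith
  unfold beta at h3
  rw [Real.le_sqrt' (by norm_num)] at h3
  nlinarith

theorem le_sDens_mix (h : PtDom g a) (h' : PtDom g' a') {t : ℝ} (h0 : 0 ≤ t) (h1 : t ≤ 1) :
    (1 - t) * sDens g a + t * sDens g' a' ≤
      sDens ((1 - t) * g + t * g') ((1 - t) * a + t * a') := by
  have hc := concaveOn_entropyDensity.2 (Set.mem_Ici.2 h.half_le_beta)
    (Set.mem_Ici.2 h'.half_le_beta) (sub_nonneg.2 h1) h0 (by ring)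
  simp only [smul_eq_mul] at hc
  refine hc.trans (entropyDensity_mono ?_ (h.le_beta_mix h' h0 h1))
  have p1 := h.half_le_beta
  have p2 := h'.half_le_beta
  nlinarith

/-- Raising `γ` along the direction that lowers `α` at least doubles `β`. -/
theorem raise (h : PtDom g a) {σ : ℝ} (hσ : σ = 1 ∨ σ = -1) :
    PtDom (4 * g + 3 / 2) (a - σ * (3 * g + 3 / 2)) ∧
      Real.log (3 / 2) ≤ sDens (4 * g + 3 / 2) (a - σ * (3 * g + 3 / 2)) - sDens g a := by
  have h1 := h.1
  have hb := h.beta_sq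
  have p1 := h.half_le_beta
  obtain ⟨q1, q2⟩ := abs_le.1 h.abs_le_add_half
  have hσ2 : σ ^ 2 = 1 := by rcases hσ with rfl | rfl <;> norm_num
  -- For σ = 1 the move keeps u = 1/2 + g + a and turns v = 1/2 + g - a into 4v + 3u, so β² = uv at
  -- least quadruples. For σ = -1 the roles of u and v are exchanged.
  have key : 4 * beta g a ^ 2 ≤
      (1 / 2 + (4 * g + 3 / 2)) ^ 2 - (a - σ * (3 * g + 3 / 2)) ^ 2 := by
    rw [hb]
    rcases hσ with rfl | rfl <;> nlinarith
  have hd : PtDom (4 * g + 3 / 2) (a - σ * (3 * g + 3 / 2)) := ⟨by linarith, by nlinarith⟩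
  refine ⟨hd, ?_⟩
  have hb2 : 2 * beta g a ≤ beta (4 * g + 3 / 2) (a - σ * (3 * g + 3 / 2)) := by
    refine le_of_sq_le_sq ?_ (by linarith [hd.half_le_beta])
    rw [hd.beta_sq]
    linarith
  have h3 := log_sub_log_le_entropyDensity_sub p1 (by linarith : beta g a ≤ _)
      (b := beta (4 * g + 3 / 2) (a - σ * (3 * g + 3 / 2)))
  refine le_trans ?_ h3
  rw [← Real.log_div (by linarith) (by linarith)]
  apply Real.log_le_log (by norm_num)
  -- With β at least doubled, (2b + 1/2)/(b + 1/2) ≥ 3/2 for b ≥ 1/2, with equality at b = 1/2.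
  rw [le_div_iff₀ (by linarith)]
  linarith

end PtDom

/-! ### Interaction kernels and the associated bilinear form -/

/-- The product Lebesgue measure on pairs of momenta. -/
abbrev vol2 : Measure (E3 × E3) := (volume : Measure E3).prod volume

/-- The bilinear form `∬ U(p - q) φ(p) ψ(q) dp dq`. -/
def dbl (U φ ψ : E3 → ℝ) : ℝ := ∫ z : E3 × E3, U (z.1 - z.2) * (φ z.1 * ψ z.2) ∂vol2

/-- The convolution `∫ U(p - q) φ(q) dq`. -/
def conv (U φ : E3 → ℝ) (p : E3) : ℝ := ∫ q : E3, U (p - q) * φ q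

/-- The properties of `V̂` on which the existence of minimizers depends. -/
structure IsPotential (U : E3 → ℝ) : Prop where
  nonneg : ∀ p, 0 ≤ U p
  continuous : Continuous U
  integrable : Integrable U
  bdd : ∃ C, ∀ p, U p ≤ C
  radial : IsRadial U
  pos_zero : 0 < U 0
  lip : ∃ L, 0 ≤ L ∧ ∀ p q, |U p - U q| ≤ L * ‖p - q‖
  lipL2 : ∃ M, 0 ≤ M ∧ ∀ h, Integrable (fun x => (U (x + h) - U x) ^ 2) ∧
    ∫ x, (U (x + h) - U x) ^ 2 ≤ M * ‖h‖ ^ 2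
  posdef : ∀ φ : E3 → ℝ, Integrable φ → 0 ≤ dbl U φ φ

/-- `φ` is dominated by `g + √g` with `g` integrable, i.e. `φ ∈ L¹ + L²` with explicit control. -/
structure Ctl (φ g : E3 → ℝ) : Prop where
  int : Integrable g
  nonneg : ∀ᵐ p, 0 ≤ g p
  meas : AEStronglyMeasurable φ
  bound : ∀ᵐ p, |φ p| ≤ g p + √(g p)

theorem integral_add_add_add {X : Type*} [MeasurableSpace X] {m : Measure X} {f₁ f₂ f₃ f₄ : X → ℝ}
    (h₁ : Integrable f₁ m) (h₂ : Integrable f₂ m) (h₃ : Integrable f₃ m) (h₄ : Integrable f₄ m) :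
    ∫ x, (f₁ x + f₂ x + f₃ x + f₄ x) ∂m =
      ∫ x, f₁ x ∂m + ∫ x, f₂ x ∂m + ∫ x, f₃ x ∂m + ∫ x, f₄ x ∂m := by
  rw [integral_add (f := fun x => f₁ x + f₂ x + f₃ x) ((h₁.add h₂).add h₃) h₄,
    integral_add (f := fun x => f₁ x + f₂ x) (h₁.add h₂) h₃, integral_add h₁ h₂]

theorem add_sqrt_le {x : ℝ} (hx : 0 ≤ x) : x + √x ≤ 3 / 2 * x + 1 / 2 := by
  have := Real.sq_sqrt hx
  nlinarith [sq_nonneg (√x - 1)]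

namespace Ctl

variable {φ ψ g h : E3 → ℝ}

theorem le_affine (hφ : Ctl φ g) : ∀ᵐ p, |φ p| ≤ 3 / 2 * g p + 1 / 2 := by
  filter_upwards [hφ.nonneg, hφ.bound] with p h1 h2 using h2.trans (add_sqrt_le h1)

theorem neg (hφ : Ctl φ g) : Ctl (fun p => -φ p) g :=
  ⟨hφ.int, hφ.nonneg, hφ.meas.neg, by simpa using hφ.bound⟩

/-- The factor 4 comes out of the root as 2, and √g + √h ≤ 2√(g + h). -/
theorem sub (hφ : Ctl φ g) (hψ : Ctl ψ h) :
    Ctl (fun p => φ p - ψ p) (fun p => 4 * (g p + h p)) := by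
  refine ⟨(hφ.int.add hψ.int).const_mul 4, ?_, hφ.meas.sub hψ.meas, ?_⟩
  · filter_upwards [hφ.nonneg, hψ.nonneg] with p h1 h2
    positivity
  · filter_upwards [hφ.nonneg, hψ.nonneg, hφ.bound, hψ.bound] with p h1 h2 h3 h4
    have e : √(4 * (g p + h p)) = 2 * √(g p + h p) := by
      rw [Real.sqrt_mul (by norm_num), show (4 : ℝ) = 2 ^ 2 by norm_num,
        Real.sqrt_sq (by norm_num)]
    have e1 := Real.sqrt_le_sqrt (show g p ≤ g p + h p by linarith)
    have e2 := Real.sqrt_le_sqrt (show h p ≤ g p + h p by linarith)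
    have := abs_sub (φ p) (ψ p)
    rw [e]
    linarith

end Ctl

/-! ### Integrability and positivity of the interaction form. -/

namespace IsPotential

variable {U : E3 → ℝ} (hU : IsPotential U)
include hU

theorem even (p : E3) : U (-p) = U p := hU.radial _ _ (norm_neg p)

theorem sub_comm (p q : E3) : U (p - q) = U (q - p) := hU.radial _ _ (norm_sub_rev p q)

theorem integrable_sub_left (p : E3) : Integrable fun q => U (p - q) :=
  hU.integrable.comp_sub_left p

omit hU in
theorem integral_sub_left (p : E3) : ∫ q, U (p - q) = ∫ q, U q :=
  integral_sub_left_eq_self U volume p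

theorem norm_le : ∃ C, 0 ≤ C ∧ ∀ p, ‖U p‖ ≤ C := by
  obtain ⟨C, hC⟩ := hU.bdd
  refine ⟨C, (hU.nonneg 0).trans (hC 0), fun p => ?_⟩
  rw [Real.norm_of_nonneg (hU.nonneg p)]
  exact hC p

theorem meas_sub_left (p : E3) : AEStronglyMeasurable (fun q => U (p - q)) :=
  (hU.continuous.comp (continuous_const.sub continuous_id)).aestronglyMeasurable

theorem meas_sub : AEStronglyMeasurable (fun z : E3 × E3 => U (z.1 - z.2)) vol2 :=
  (hU.continuous.comp (continuous_fst.sub continuous_snd)).aestronglyMeasurable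

theorem integrable_mul_L1 {g : E3 → ℝ} (hg : Integrable g) (p : E3) :
    Integrable fun q => U (p - q) * g q := by
  obtain ⟨C, -, hC⟩ := hU.norm_le
  exact hg.bdd_mul (hU.meas_sub_left p) (Eventually.of_forall fun q => hC _)

/-- Use |φ| ≤ 3g/2 + 1/2: boundedness of U handles the first term, integrability of U the constant.
-/
theorem integrable_conv {φ g : E3 → ℝ} (hφ : Ctl φ g) (p : E3) :
    Integrable fun q => U (p - q) * φ q := by
  have h1 : Integrable fun q => U (p - q) * (3 / 2 * g q) + U (p - q) * (1 / 2) :=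
    (hU.integrable_mul_L1 (hφ.int.const_mul _) p).add ((hU.integrable_sub_left p).mul_const _)
  refine h1.mono' ((hU.meas_sub_left p).mul hφ.meas) ?_
  filter_upwards [hφ.le_affine] with q hq
  rw [norm_mul, Real.norm_of_nonneg (hU.nonneg _), Real.norm_eq_abs, ← mul_add]
  exact mul_le_mul_of_nonneg_left hq (hU.nonneg _)

theorem integrable_mul {φ g : E3 → ℝ} (hφ : Ctl φ g) : Integrable fun q => U q * φ q := by
  refine (hU.integrable_conv hφ 0).congr (Eventually.of_forall fun q => ?_)
  simp only [zero_sub, hU.even]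

theorem conv_zero (φ : E3 → ℝ) : conv U φ 0 = ∫ q, U q * φ q := by
  unfold conv
  simp only [zero_sub, hU.even]

theorem integrable_snd {g : E3 → ℝ} (hg : Integrable g) :
    Integrable (fun z : E3 × E3 => U (z.1 - z.2) * g z.2) vol2 := by
  have := Integrable.convolution_integrand (ContinuousLinearMap.mul ℝ ℝ) hg hU.integrable
  refine this.congr (Eventually.of_forall fun z => ?_)
  simp [mul_comm]

theorem integrable_fst {g : E3 → ℝ} (hg : Integrable g) :
    Integrable (fun z : E3 × E3 => U (z.1 - z.2) * g z.1) vol2 := by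
  refine (hU.integrable_snd hg).swap.congr (Eventually.of_forall fun z => ?_)
  simp [hU.sub_comm z.1 z.2]

theorem integrable_both {g h : E3 → ℝ} (hg : Integrable g) (hh : Integrable h) :
    Integrable (fun z : E3 × E3 => U (z.1 - z.2) * (g z.1 * h z.2)) vol2 := by
  obtain ⟨C, -, hC⟩ := hU.norm_le
  exact (hg.mul_prod hh).bdd_mul hU.meas_sub (Eventually.of_forall fun q => hC _)

omit hU in
theorem _root_.Bogoliubov.ae_fst {P : E3 → Prop} (h : ∀ᵐ p, P p) :
    ∀ᵐ z : E3 × E3 ∂vol2, P z.1 :=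
  Measure.quasiMeasurePreserving_fst.ae h

omit hU in
theorem _root_.Bogoliubov.ae_snd {P : E3 → Prop} (h : ∀ᵐ p, P p) :
    ∀ᵐ z : E3 × E3 ∂vol2, P z.2 :=
  Measure.quasiMeasurePreserving_snd.ae h

omit hU in
-- Every term on the right is integrable against U(p - q): the product because U is bounded, the
-- single terms because U is integrable. The same majorant serves in the Fatou argument for the
-- pairing energy.
theorem _root_.Bogoliubov.abs_mul_le_of_le {a b g h : ℝ} (hg : 0 ≤ g) (hh : 0 ≤ h)
    (ha : |a| ≤ g + √g) (hb : |b| ≤ h + √h) : |a * b| ≤ 2 * (g * h) + g + h := by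
  rw [abs_mul]
  have h1 := mul_le_mul ha hb (abs_nonneg _) (by positivity)
  have s1 := Real.sq_sqrt hg
  have s2 := Real.sq_sqrt hh
  have t1 := Real.sqrt_nonneg g
  have t2 := Real.sqrt_nonneg h
  have u1 : g * √h ≤ g * ((1 + h) / 2) :=
    mul_le_mul_of_nonneg_left (by nlinarith [sq_nonneg (√h - 1)]) hg
  have u2 : h * √g ≤ h * ((1 + g) / 2) :=
    mul_le_mul_of_nonneg_left (by nlinarith [sq_nonneg (√g - 1)]) hh
  nlinarith [sq_nonneg (√g - √h)]

theorem integrable_dbl {φ ψ g h : E3 → ℝ} (hφ : Ctl φ g) (hψ : Ctl ψ h) :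
    Integrable (fun z : E3 × E3 => U (z.1 - z.2) * (φ z.1 * ψ z.2)) vol2 := by
  have h1 := ((hU.integrable_both hφ.int hψ.int).const_mul 2).add
    ((hU.integrable_fst hφ.int).add (hU.integrable_snd hψ.int))
  refine h1.mono' (hU.meas_sub.mul (hφ.meas.comp_fst.mul hψ.meas.comp_snd)) ?_
  filter_upwards [ae_fst hφ.nonneg, ae_snd hψ.nonneg, ae_fst hφ.bound, ae_snd hψ.bound]
    with z a1 a2 a3 a4
  rw [norm_mul, Real.norm_of_nonneg (hU.nonneg _), Real.norm_eq_abs]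
  have := mul_le_mul_of_nonneg_left (abs_mul_le_of_le a1 a2 a3 a4) (hU.nonneg (z.1 - z.2))
  simp only [Pi.add_apply]
  linarith

theorem dbl_eq_integral {φ ψ g h : E3 → ℝ} (hφ : Ctl φ g) (hψ : Ctl ψ h) :
    dbl U φ ψ = ∫ p, φ p * conv U ψ p := by
  unfold dbl conv
  rw [integral_prod _ (hU.integrable_dbl hφ hψ)]
  congr 1
  ext p
  rw [← integral_const_mul]
  congr 1
  ext q
  ring

theorem integrable_mul_conv {φ ψ g h : E3 → ℝ} (hφ : Ctl φ g) (hψ : Ctl ψ h) :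
    Integrable fun p => φ p * conv U ψ p := by
  refine (hU.integrable_dbl hφ hψ).integral_prod_left.congr (Eventually.of_forall fun p => ?_)
  simp only [conv]
  rw [← integral_const_mul]
  congr 1
  ext q
  ring

theorem dbl_comm (φ ψ : E3 → ℝ) : dbl U φ ψ = dbl U ψ φ := by
  unfold dbl
  rw [← integral_prod_swap]
  congr 1
  ext z
  simp only [Prod.fst_swap, Prod.snd_swap]
  rw [hU.sub_comm]
  ring

theorem dbl_quad_add {φ φ' g g' : E3 → ℝ} (hφ : Ctl φ g) (hφ' : Ctl φ' g') :
    dbl U (fun p => φ p + φ' p) (fun p => φ p + φ' p) =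
      dbl U φ φ + 2 * dbl U φ φ' + dbl U φ' φ' := by
  have i1 := hU.integrable_dbl hφ hφ
  have i2 := hU.integrable_dbl hφ hφ'
  have i3 := hU.integrable_dbl hφ' hφ
  have i4 := hU.integrable_dbl hφ' hφ'
  have e : dbl U φ φ + 2 * dbl U φ φ' + dbl U φ' φ' =
      dbl U φ φ + dbl U φ φ' + dbl U φ' φ + dbl U φ' φ' := by
    rw [hU.dbl_comm φ' φ]; ring
  rw [e]
  unfold dbl
  rw [← integral_add_add_add i1 i2 i3 i4]
  congr 1
  ext z
  ring

theorem dbl_quad_mix {φ φ' g g' : E3 → ℝ} (hφ : Ctl φ g) (hφ' : Ctl φ' g') (t : ℝ) :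
    dbl U (fun p => (1 - t) * φ p + t * φ' p) (fun p => (1 - t) * φ p + t * φ' p) =
      (1 - t) ^ 2 * dbl U φ φ + 2 * t * (1 - t) * dbl U φ φ' + t ^ 2 * dbl U φ' φ' := by
  have i1 := (hU.integrable_dbl hφ hφ).const_mul ((1 - t) ^ 2)
  have i2 := (hU.integrable_dbl hφ hφ').const_mul (t * (1 - t))
  have i3 := (hU.integrable_dbl hφ' hφ).const_mul (t * (1 - t))
  have i4 := (hU.integrable_dbl hφ' hφ').const_mul (t ^ 2)
  have e : (1 - t) ^ 2 * dbl U φ φ + 2 * t * (1 - t) * dbl U φ φ' + t ^ 2 * dbl U φ' φ' =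
      (1 - t) ^ 2 * dbl U φ φ + t * (1 - t) * dbl U φ φ' + t * (1 - t) * dbl U φ' φ
        + t ^ 2 * dbl U φ' φ' := by
    rw [hU.dbl_comm φ' φ]; ring
  rw [e]
  unfold dbl
  rw [← integral_const_mul, ← integral_const_mul, ← integral_const_mul, ← integral_const_mul,
    ← integral_add_add_add i1 i2 i3 i4]
  congr 1
  ext z
  ring

/-- Positivity is assumed only for integrable functions, while φ is merely in L¹ + L². On a ball φ
is integrable, and dominated convergence removes the cutoff. -/
theorem dbl_nonneg {φ g : E3 → ℝ} (hφ : Ctl φ g) : 0 ≤ dbl U φ φ := by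
  have hint := hU.integrable_dbl hφ hφ
  set A : ℕ → Set E3 := fun n => Metric.ball 0 n with hA
  have hAm : ∀ n, MeasurableSet (A n) := fun n => measurableSet_ball
  have hlim : Tendsto (fun n => dbl U ((A n).indicator φ) ((A n).indicator φ)) atTop
      (𝓝 (dbl U φ φ)) := by
    unfold dbl
    refine tendsto_integral_of_dominated_convergence
      (fun z => ‖U (z.1 - z.2) * (φ z.1 * φ z.2)‖) (fun n => ?_) hint.norm (fun n => ?_) ?_
    · exact hU.meas_sub.mul (((hφ.meas.indicator (hAm n)).comp_fst).mul
        ((hφ.meas.indicator (hAm n)).comp_snd))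
    · refine Eventually.of_forall fun z => ?_
      rw [norm_mul, norm_mul, norm_mul, norm_mul]
      gcongr <;> exact norm_indicator_le_norm_self _ _
    · refine Eventually.of_forall fun z => ?_
      refine tendsto_const_nhds.congr' ?_
      obtain ⟨N1, h1⟩ := exists_nat_gt ‖z.1‖
      obtain ⟨N2, h2⟩ := exists_nat_gt ‖z.2‖
      filter_upwards [eventually_ge_atTop N1, eventually_ge_atTop N2] with n h3 h4
      have m1 : z.1 ∈ A n := by
        simp only [hA, mem_ball_zero_iff]
        exact h1.trans_le (by exact_mod_cast h3)
      have m2 : z.2 ∈ A n := by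
        simp only [hA, mem_ball_zero_iff]
        exact h2.trans_le (by exact_mod_cast h4)
      rw [Set.indicator_of_mem m1, Set.indicator_of_mem m2]
  refine ge_of_tendsto' hlim fun n => hU.posdef _ ?_
  rw [integrable_indicator_iff (hAm n)]
  have hfin : volume (A n) < ⊤ := measure_ball_lt_top
  have h1 : IntegrableOn (fun p => 3 / 2 * g p + 1 / 2) (A n) :=
    ((hφ.int.const_mul _).integrableOn).add (integrableOn_const hfin.ne)
  exact h1.mono' hφ.meas.restrict (ae_restrict_of_ae hφ.le_affine)

/-- Expand the nonnegative form at φ - ψ. This makes the interaction convex. -/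
theorem dbl_le_add {φ ψ g h : E3 → ℝ} (hφ : Ctl φ g) (hψ : Ctl ψ h) :
    2 * dbl U φ ψ ≤ dbl U φ φ + dbl U ψ ψ := by
  have h1 := hU.dbl_nonneg (hφ.sub hψ)
  have h2 := hU.dbl_quad_mix hφ hψ (-1)
  have h3 := hU.dbl_quad_add hφ hψ.neg
  have e : dbl U φ (fun p => -ψ p) = - dbl U φ ψ := by
    unfold dbl; rw [← integral_neg]; congr 1; ext z; ring
  have e2 : dbl U (fun p => -ψ p) (fun p => -ψ p) = dbl U ψ ψ := by
    unfold dbl; congr 1; ext z; ring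
  rw [e, e2] at h3
  simp only [← sub_eq_add_neg] at h3
  rw [h3] at h1
  linarith

/-- Uniform bound on convolutions. -/
theorem abs_conv_le {C : ℝ} (hC : ∀ p, U p ≤ C) {φ g : E3 → ℝ} (hφ : Ctl φ g) (p : E3) :
    |conv U φ p| ≤ 3 / 2 * C * (∫ q, g q) + 1 / 2 * ∫ q, U q := by
  unfold conv
  rw [← Real.norm_eq_abs]
  have hint : Integrable fun q => 3 / 2 * C * g q + 1 / 2 * U (p - q) :=
    (hφ.int.const_mul _).add ((hU.integrable_sub_left p).const_mul _)
  refine (norm_integral_le_of_norm_le hint ?_).trans_eq ?_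
  · filter_upwards [hφ.nonneg, hφ.le_affine] with q h1 h2
    rw [norm_mul, Real.norm_of_nonneg (hU.nonneg _), Real.norm_eq_abs]
    have h3 := mul_le_mul_of_nonneg_left h2 (hU.nonneg (p - q))
    have h4 := mul_le_mul_of_nonneg_right (hC (p - q)) h1
    linarith
  · rw [integral_add (hφ.int.const_mul _) ((hU.integrable_sub_left p).const_mul _),
      integral_const_mul, integral_const_mul, integral_sub_left]

/-- Uniform Lipschitz bound on convolutions. -/
theorem exists_lipschitz_conv : ∃ Λ, 0 ≤ Λ ∧ ∀ (φ g : E3 → ℝ), Ctl φ g → ∀ p p',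
    |conv U φ p - conv U φ p'| ≤ Λ * (1 + ∫ q, g q) * ‖p - p'‖ := by
  obtain ⟨L, hL, hLip⟩ := hU.lip
  obtain ⟨M, hM, hLip2⟩ := hU.lipL2
  refine ⟨L + M + 1, by positivity, fun φ g hφ p p' => ?_⟩
  rcases eq_or_ne p p' with rfl | hne
  · simp
  set d := ‖p - p'‖ with hd
  have hd0 : 0 < d := norm_pos_iff.2 (sub_ne_zero.2 hne)
  have hg0 : 0 ≤ ∫ q, g q := integral_nonneg_of_ae hφ.nonneg
  obtain ⟨i1, i2⟩ := hLip2 (p - p')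
  have j1 : Integrable fun q => (U (p - q) - U (p' - q)) ^ 2 := by
    refine (i1.comp_sub_left p').congr (Eventually.of_forall fun q => ?_)
    simp only
    congr 3
    abel
  have j2 : ∫ q, (U (p - q) - U (p' - q)) ^ 2 ≤ M * d ^ 2 := by
    refine le_trans (le_of_eq ?_) i2
    rw [← integral_sub_left_eq_self _ volume p']
    congr 1
    ext q
    simp only [sub_sub_cancel]
    congr 3
    abel
  unfold conv
  rw [← integral_sub (hU.integrable_conv hφ p) (hU.integrable_conv hφ p'), ← Real.norm_eq_abs]
  have hint : Integrable fun q =>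
      (L * d + d / 2) * g q + (2 * d)⁻¹ * (U (p - q) - U (p' - q)) ^ 2 :=
    (hφ.int.const_mul _).add (j1.const_mul _)
  refine (norm_integral_le_of_norm_le hint ?_).trans ?_
  · filter_upwards [hφ.nonneg, hφ.bound] with q h1 h2
    rw [← sub_mul, norm_mul, Real.norm_eq_abs, Real.norm_eq_abs]
    have h3 : |U (p - q) - U (p' - q)| ≤ L * d := by
      refine (hLip _ _).trans_eq ?_
      rw [hd, sub_sub_sub_cancel_right]
    set D := U (p - q) - U (p' - q)
    have h4 := mul_le_mul_of_nonneg_left h2 (abs_nonneg D)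
    have h5 := mul_le_mul_of_nonneg_right h3 h1
    -- Young's inequality with weight d: since ∫D² ≤ M d², dividing by d still leaves a bound linear
    -- in d.
    have h6 : |D| * √(g q) ≤ d / 2 * g q + (2 * d)⁻¹ * D ^ 2 := by
      have s1 := Real.sq_sqrt h1
      have e : d / 2 * g q + (2 * d)⁻¹ * D ^ 2 - |D| * √(g q) =
          (2 * d)⁻¹ * (d * √(g q) - |D|) ^ 2 := by
        rw [← sq_abs D]
        field_simp
        nlinarith
      have : 0 ≤ (2 * d)⁻¹ * (d * √(g q) - |D|) ^ 2 := by positivity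
      linarith
    linarith
  · rw [integral_add (hφ.int.const_mul _) (j1.const_mul _), integral_const_mul, integral_const_mul]
    have h7 : (2 * d)⁻¹ * ∫ q, (U (p - q) - U (p' - q)) ^ 2 ≤ (2 * d)⁻¹ * (M * d ^ 2) :=
      mul_le_mul_of_nonneg_left j2 (by positivity)
    have h8 : (2 * d)⁻¹ * (M * d ^ 2) = M * d / 2 := by field_simp
    have h9 : 0 ≤ d * ∫ q, g q := by positivity
    have h10 : 0 ≤ M * d := by positivity
    have h11 : 0 ≤ L * d := by positivity
    have h12 : 0 ≤ M * (d * ∫ q, g q) := by positivity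
    nlinarith

end IsPotential

/-! ### Admissible states and the energy -/

/-- The normalisation constant `(2π)⁻³`. -/
def cst : ℝ := ((2 * Real.pi) ^ 3)⁻¹

theorem cst_pos : 0 < cst := by unfold cst; positivity

/-- Admissible pairs `(γ, α)`. -/
structure Adm (γ α : E3 → ℝ) : Prop where
  int : Integrable fun p : E3 => (1 + ‖p‖ ^ 2) * γ p
  dom : ∀ᵐ p, PtDom (γ p) (α p)
  meas : AEStronglyMeasurable α

theorem mem_domainD_iff {x : (E3 → ℝ) × (E3 → ℝ) × ℝ} :
    x ∈ domainD ↔ Adm x.1 x.2.1 ∧ 0 ≤ x.2.2 := by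
  constructor
  · rintro ⟨h1, h2, h3, h4, h5⟩
    exact ⟨⟨h1, by filter_upwards [h2, h4] with p a b using ⟨a, b⟩, h3⟩, h5⟩
  · rintro ⟨⟨h1, h2, h3⟩, h5⟩
    exact ⟨h1, h2.mono fun p h => h.1, h3, h2.mono fun p h => h.2, h5⟩

/-- An integrable weight on `ℝ³`. -/
def jap (p : E3) : ℝ := ((1 + ‖p‖ ^ 2) ^ 2)⁻¹

theorem integrable_jap : Integrable jap := by
  have h := integrable_rpow_neg_one_add_norm_sq (E := E3) (μ := volume) (r := 4)
    (by simp; norm_num)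
  refine h.congr (Eventually.of_forall fun p => ?_)
  have : (-4 / 2 : ℝ) = -(2 : ℕ) := by norm_num
  simp only [jap]
  rw [this, Real.rpow_neg (by positivity), Real.rpow_natCast]

theorem jap_nonneg (p : E3) : 0 ≤ jap p := by unfold jap; positivity

/-- Take the Gibbs bound with x = t(1 + p²). The entropy is then at most any chosen fraction of mass
plus kinetic energy, up to a fixed integrable function. -/
theorem PtDom.sDens_le_weight {g a : ℝ} (h : PtDom g a) {t : ℝ} (ht : 0 < t) (p : E3) :
    sDens g a ≤ t * ((1 + ‖p‖ ^ 2) * g) + 2 / t ^ 2 * jap p := by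
  have := h.sDens_le (x := t * (1 + ‖p‖ ^ 2)) (by positivity)
  refine this.trans_eq ?_
  unfold jap
  rw [mul_pow, mul_assoc]
  congr 1
  field_simp

namespace Adm

variable {γ α : E3 → ℝ}

theorem zero : Adm (fun _ => 0) (fun _ => 0) :=
  ⟨by simp, Eventually.of_forall fun _ => PtDom.zero, aestronglyMeasurable_const⟩

theorem nonneg (h : Adm γ α) : ∀ᵐ p, 0 ≤ γ p := h.dom.mono fun _ hp => hp.1

theorem meas_gamma (h : Adm γ α) : AEStronglyMeasurable γ := by
  have hc : Continuous fun p : E3 => (1 + ‖p‖ ^ 2)⁻¹ :=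
    Continuous.inv₀ (by fun_prop) fun p => by positivity
  refine (hc.aestronglyMeasurable.mul h.int.aestronglyMeasurable).congr
    (Eventually.of_forall fun p => ?_)
  have : (1 + ‖p‖ ^ 2) ≠ 0 := by positivity
  simp only [Pi.mul_apply]
  field_simp

theorem int_gamma (h : Adm γ α) : Integrable γ := by
  refine h.int.mono h.meas_gamma (Eventually.of_forall fun p => ?_)
  rw [norm_mul]
  refine le_mul_of_one_le_left (norm_nonneg _) ?_
  rw [Real.norm_of_nonneg (by positivity)]
  nlinarith [sq_nonneg ‖p‖]

theorem int_kin (h : Adm γ α) : Integrable fun p => ‖p‖ ^ 2 * γ p := by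
  refine (h.int.sub h.int_gamma).congr (Eventually.of_forall fun p => ?_)
  simp only [Pi.sub_apply]
  ring

theorem integral_weight (h : Adm γ α) :
    ∫ p, (1 + ‖p‖ ^ 2) * γ p = (∫ p, γ p) + ∫ p, ‖p‖ ^ 2 * γ p := by
  rw [← integral_add h.int_gamma h.int_kin]
  congr 1
  ext p
  ring

theorem of_int (h1 : Integrable γ) (h2 : Integrable fun p => ‖p‖ ^ 2 * γ p)
    (h3 : ∀ᵐ p, PtDom (γ p) (α p)) (h4 : AEStronglyMeasurable α) : Adm γ α := by
  refine ⟨(h1.add h2).congr (Eventually.of_forall fun p => ?_), h3, h4⟩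
  simp only [Pi.add_apply]
  ring

theorem ctl_gamma (h : Adm γ α) : Ctl γ γ := by
  refine ⟨h.int_gamma, h.nonneg, h.meas_gamma, ?_⟩
  filter_upwards [h.nonneg] with p hp
  rw [abs_of_nonneg hp]
  linarith [Real.sqrt_nonneg (γ p)]

theorem ctl_alpha (h : Adm γ α) : Ctl α γ :=
  ⟨h.int_gamma, h.nonneg, h.meas, h.dom.mono fun _ hp => hp.abs_le_add_sqrt⟩

theorem gamma_nonneg (h : Adm γ α) : 0 ≤ ∫ p, γ p := integral_nonneg_of_ae h.nonneg

theorem kin_nonneg (h : Adm γ α) : 0 ≤ ∫ p, ‖p‖ ^ 2 * γ p := by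
  apply integral_nonneg_of_ae
  filter_upwards [h.nonneg] with p hp
  exact mul_nonneg (by positivity) hp

theorem meas_sDens (h : Adm γ α) : AEStronglyMeasurable fun p => sDens (γ p) (α p) :=
  continuous_sDens.comp_aestronglyMeasurable (f := fun p => (γ p, α p)) (h.meas_gamma.prodMk h.meas)

theorem int_sDens (h : Adm γ α) : Integrable fun p => sDens (γ p) (α p) := by
  have h1 : Integrable fun p => 1 * ((1 + ‖p‖ ^ 2) * γ p) + 2 / 1 ^ 2 * jap p :=
    (h.int.const_mul _).add (integrable_jap.const_mul _)
  refine h1.mono' h.meas_sDens ?_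
  filter_upwards [h.dom] with p hp
  rw [Real.norm_of_nonneg hp.sDens_nonneg]
  exact hp.sDens_le_weight one_pos p

theorem neg (h : Adm γ α) : Adm γ (fun p => -α p) :=
  ⟨h.int, h.dom.mono fun _ hp => hp.neg, h.meas.neg⟩

theorem mix (h : Adm γ α) {γ' α' : E3 → ℝ} (h' : Adm γ' α') {t : ℝ} (h0 : 0 ≤ t) (h1 : t ≤ 1) :
    Adm (fun p => (1 - t) * γ p + t * γ' p) (fun p => (1 - t) * α p + t * α' p) := by
  refine ⟨((h.int.const_mul (1 - t)).add (h'.int.const_mul t)).congr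
    (Eventually.of_forall fun p => ?_), ?_, (h.meas.const_mul _).add (h'.meas.const_mul _)⟩
  · simp only [Pi.add_apply]
    ring
  · filter_upwards [h.dom, h'.dom] with p a b using a.mix b h0 h1

/-- The constraints are pointwise, so admissible states can be glued along measurable sets. This
permits truncation here and localised variations later. -/
theorem piecewise (h : Adm γ α) {γ' α' : E3 → ℝ} (h' : Adm γ' α') {A : Set E3}
    (hA : MeasurableSet A) [DecidablePred (· ∈ A)] : Adm (A.piecewise γ γ') (A.piecewise α α') := by
  refine ⟨?_, ?_, ?_⟩
  · refine (Integrable.piecewise hA h.int.integrableOn h'.int.integrableOn).congr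
      (Eventually.of_forall fun p => ?_)
    by_cases hp : p ∈ A <;> simp [hp]
  · filter_upwards [h.dom, h'.dom] with p a b
    by_cases hp : p ∈ A <;> simp [hp, a, b]
  · exact AEStronglyMeasurable.piecewise hA h.meas.restrict h'.meas.restrict

theorem indicator (h : Adm γ α) {A : Set E3} (hA : MeasurableSet A) :
    Adm (A.indicator γ) (A.indicator α) := by
  classical
  have := h.piecewise zero hA
  rwa [← Set.piecewise_eq_indicator, ← Set.piecewise_eq_indicator]

end Adm

/-- The free energy functional with `V̂` replaced by a general kernel `U`. -/
def energy (U : E3 → ℝ) (T μ : ℝ) (γ α : E3 → ℝ) (r : ℝ) : ℝ :=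
  cst * (∫ p, ‖p‖ ^ 2 * γ p) - μ * (r + cst * ∫ p, γ p) - T * (cst * ∫ p, sDens (γ p) (α p))
    + U 0 / 2 * (r + cst * ∫ p, γ p) ^ 2 + 1 / 2 * cst ^ 2 * (dbl U α α + dbl U γ γ)
    + r * (cst * ((∫ p, U p * γ p) + ∫ p, U p * α p))

/-- Admissibility makes each integral converge, so sums under the integral signs split and the
iterated integral becomes one over the product space. -/
theorem freeEnergy_eq_energy {V : E3 → ℝ} (hU : IsPotential (Vhat V)) (T μ : ℝ)
    {x : (E3 → ℝ) × (E3 → ℝ) × ℝ} (hx : Adm x.1 x.2.1) :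
    freeEnergy V T μ x = energy (Vhat V) T μ x.1 x.2.1 x.2.2 := by
  have i1 := hU.integrable_dbl hx.ctl_alpha hx.ctl_alpha
  have i2 := hU.integrable_dbl hx.ctl_gamma hx.ctl_gamma
  have h1 : (∫ p : E3, ∫ q : E3, Vhat V (p - q) * (x.2.1 p * x.2.1 q + x.1 p * x.1 q)) =
      dbl (Vhat V) x.2.1 x.2.1 + dbl (Vhat V) x.1 x.1 := by
    unfold dbl
    rw [← integral_add i1 i2]
    refine Eq.trans ?_ (integral_prod _ (i1.add i2)).symm
    simp only [Pi.add_apply, mul_add]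
  have h2 : (∫ p : E3, Vhat V p * (x.1 p + x.2.1 p)) =
      (∫ p, Vhat V p * x.1 p) + ∫ p, Vhat V p * x.2.1 p := by
    rw [← integral_add (hU.integrable_mul hx.ctl_gamma) (hU.integrable_mul hx.ctl_alpha)]
    congr 1
    ext p
    ring
  have h3 : ((2 * Real.pi) ^ 6)⁻¹ = cst ^ 2 := by
    unfold cst
    rw [inv_pow, ← pow_mul]
  unfold freeEnergy energy entropy rhoGamma sDens
  simp only [h1, h2, h3]
  rfl

/-! ### Lower bounds and coercivity. -/

namespace IsPotential

variable {U : E3 → ℝ} (hU : IsPotential U)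
include hU

/-- α ≥ -γ - 1/2 and U ≥ 0, so only the constant survives. -/
theorem integral_mul_gamma_add_alpha_ge {γ α : E3 → ℝ} (h : Adm γ α) :
    -(1 / 2 * ∫ p, U p) ≤ (∫ p, U p * γ p) + ∫ p, U p * α p := by
  rw [← integral_add (hU.integrable_mul h.ctl_gamma) (hU.integrable_mul h.ctl_alpha),
    ← integral_const_mul, ← integral_neg]
  refine integral_mono_ae (hU.integrable.const_mul _).neg
    ((hU.integrable_mul h.ctl_gamma).add (hU.integrable_mul h.ctl_alpha)) ?_
  filter_upwards [h.dom] with p hp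
  have h1 := (abs_le.1 hp.abs_le_add_half).1
  have := hU.nonneg p
  nlinarith

/-- Coercivity of the functional. -/
theorem exists_coercive {T : ℝ} (hT : 0 < T) (μ : ℝ) :
    ∃ K, ∀ (γ α : E3 → ℝ) (r : ℝ), Adm γ α → 0 ≤ r →
      cst / 2 * (∫ p, ‖p‖ ^ 2 * γ p) + U 0 / 4 * (r + cst * ∫ p, γ p) ^ 2 - K ≤
        energy U T μ γ α r := by
  -- Total coefficient of ρ in the negative terms: the chemical potential, the mass part of the
  -- entropy bound, and the coupling to the condensate.
  set b := |μ| + 1 / 2 + cst * (1 / 2 * ∫ p, U p) with hb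
  refine ⟨8 * T ^ 3 * cst * (∫ p, jap p) + b ^ 2 / U 0, fun γ α r h hr => ?_⟩
  have c0 := cst_pos
  have hent : T * ∫ p, sDens (γ p) (α p) ≤
      1 / 2 * ((∫ p, γ p) + ∫ p, ‖p‖ ^ 2 * γ p) + 8 * T ^ 3 * ∫ p, jap p := by
    rw [← h.integral_weight, ← integral_const_mul, ← integral_const_mul, ← integral_const_mul,
      ← integral_add (h.int.const_mul _) (integrable_jap.const_mul _)]
    refine integral_mono_ae (h.int_sDens.const_mul _)
      ((h.int.const_mul _).add (integrable_jap.const_mul _)) ?_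
    filter_upwards [h.dom] with p hp
    -- With t = 1/(2T) the entropy term consumes exactly half of the kinetic energy.
    have h1 := mul_le_mul_of_nonneg_left
      (hp.sDens_le_weight (t := 1 / (2 * T)) (by positivity) p) hT.le
    refine h1.trans_eq ?_
    field_simp
    ring
  have hL := hU.integral_mul_gamma_add_alpha_ge h
  have hα := hU.dbl_nonneg h.ctl_alpha
  have hγ := hU.dbl_nonneg h.ctl_gamma
  have hM := h.gamma_nonneg
  have hUint : 0 ≤ ∫ p, U p := integral_nonneg hU.nonneg
  have hJ : 0 ≤ ∫ p, jap p := integral_nonneg jap_nonneg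
  unfold energy
  set k := ∫ p, ‖p‖ ^ 2 * γ p
  set M := ∫ p, γ p
  set S := ∫ p, sDens (γ p) (α p)
  set X := (∫ p, U p * γ p) + ∫ p, U p * α p
  set J := ∫ p, jap p
  set W := ∫ p, U p
  set ρ := r + cst * M with hρ
  have hρr : r ≤ ρ := by rw [hρ]; nlinarith
  have hρM : cst * M ≤ ρ := by linarith
  have hρ0 : 0 ≤ ρ := hr.trans hρr
  have e1 : r * (cst * X) ≥ -(ρ * (cst * (1 / 2 * W))) := by
    have := mul_le_mul_of_nonneg_left (mul_le_mul_of_nonneg_left hL c0.le) hr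
    have h2 := mul_le_mul_of_nonneg_right hρr
      (show 0 ≤ cst * (1 / 2 * W) by positivity)
    linarith
  have e2 : T * (cst * S) ≤ cst / 2 * k + 1 / 2 * ρ + 8 * T ^ 3 * cst * J := by
    have := mul_le_mul_of_nonneg_left hent c0.le
    nlinarith
  have e3 : μ * ρ ≤ |μ| * ρ := mul_le_mul_of_nonneg_right (le_abs_self μ) hρ0
  have e4 : 0 ≤ 1 / 2 * cst ^ 2 * (dbl U α α + dbl U γ γ) := by positivity
  -- Completing the square: half of the quadratic term in ρ absorbs everything linear.
  have e5 : b * ρ ≤ U 0 / 4 * ρ ^ 2 + b ^ 2 / U 0 := by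
    have h0 := hU.pos_zero
    have : U 0 / 4 * ρ ^ 2 + b ^ 2 / U 0 - b * ρ = (U 0)⁻¹ * (U 0 * ρ / 2 - b) ^ 2 := by
      field_simp; ring
    have h2 : 0 ≤ (U 0)⁻¹ * (U 0 * ρ / 2 - b) ^ 2 := by positivity
    linarith
  have e6 : b * ρ = |μ| * ρ + 1 / 2 * ρ + ρ * (cst * (1 / 2 * W)) := by rw [hb]; ring
  nlinarith

/-- Sublevel sets of the functional are bounded. -/
theorem exists_sublevel_bound {T : ℝ} (hT : 0 < T) (μ B : ℝ) :
    ∃ C, 0 ≤ C ∧ ∀ (γ α : E3 → ℝ) (r : ℝ), Adm γ α → 0 ≤ r → energy U T μ γ α r ≤ B →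
      r ≤ C ∧ ∫ p, γ p ≤ C ∧ ∫ p, ‖p‖ ^ 2 * γ p ≤ C := by
  obtain ⟨K, hK⟩ := hU.exists_coercive hT μ
  have c0 := cst_pos
  have u0 := hU.pos_zero
  set D := |B + K|
  have hD : 0 ≤ D := abs_nonneg _
  refine ⟨2 / cst * D + (1 + 4 / U 0 * D) + (1 + 4 / U 0 * D) / cst, by positivity,
    fun γ α r h hr hB => ?_⟩
  have h1 := hK γ α r h hr
  have hk := h.kin_nonneg
  have hM := h.gamma_nonneg
  set k := ∫ p, ‖p‖ ^ 2 * γ p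
  set M := ∫ p, γ p
  have h2 : cst / 2 * k + U 0 / 4 * (r + cst * M) ^ 2 ≤ D := by
    have : B + K ≤ D := le_abs_self _
    linarith
  have hk2 : k ≤ 2 / cst * D := by
    have : cst / 2 * k ≤ D := by nlinarith [sq_nonneg (r + cst * M)]
    rw [div_mul_eq_mul_div, le_div_iff₀ c0]
    linarith
  have hρ : r + cst * M ≤ 1 + 4 / U 0 * D := by
    have h3 : U 0 / 4 * (r + cst * M) ^ 2 ≤ D := by nlinarith
    have h4 : (r + cst * M) ^ 2 ≤ 4 / U 0 * D := by
      rw [div_mul_eq_mul_div, le_div_iff₀ u0]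
      linarith
    nlinarith [sq_nonneg (r + cst * M - 1)]
  have hcM : 0 ≤ cst * M := by positivity
  have hM2 : M ≤ (1 + 4 / U 0 * D) / cst := by
    rw [le_div_iff₀ c0]
    linarith
  have z1 : 0 ≤ 2 / cst * D := by positivity
  have z2 : 0 ≤ 1 + 4 / U 0 * D := by positivity
  have z3 : 0 ≤ (1 + 4 / U 0 * D) / cst := by positivity
  refine ⟨by linarith, by linarith, by linarith⟩

end IsPotential

/-! ### Lower semicontinuity of the energy -/

section Fatou

variable {X : Type*} [MeasurableSpace X] {m : Measure X}

/-- Fatou's lemma for Bochner integrals. Integrability of the limit is part of the conclusion, since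
a Bochner integral bound alone would not give it. -/
theorem integrable_of_tendsto_of_integral_le {f : ℕ → X → ℝ} {F : X → ℝ} {C : ℝ}
    (hf : ∀ n, Integrable (f n) m) (h0 : ∀ n, ∀ᵐ x ∂m, 0 ≤ f n x)
    (hF : ∀ᵐ x ∂m, Tendsto (fun n => f n x) atTop (𝓝 (F x))) (hC : ∀ n, ∫ x, f n x ∂m ≤ C) :
    Integrable F m ∧ ∫ x, F x ∂m ≤ C := by
  have hm : AEStronglyMeasurable F m :=
    aestronglyMeasurable_of_tendsto_ae atTop (fun n => (hf n).aestronglyMeasurable) hF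
  have hC0 : 0 ≤ C := (integral_nonneg_of_ae (h0 0)).trans (hC 0)
  have hF0 : ∀ᵐ x ∂m, 0 ≤ F x := by
    filter_upwards [hF, ae_all_iff.2 h0] with x h1 h2
    exact ge_of_tendsto' h1 h2
  have hle : ∫⁻ x, ENNReal.ofReal (F x) ∂m ≤ ENNReal.ofReal C := by
    calc ∫⁻ x, ENNReal.ofReal (F x) ∂m
        = ∫⁻ x, liminf (fun n => ENNReal.ofReal (f n x)) atTop ∂m := by
          refine lintegral_congr_ae ?_
          filter_upwards [hF] with x hx
          exact ((ENNReal.continuous_ofReal.tendsto _).comp hx).liminf_eq.symm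
      _ ≤ liminf (fun n => ∫⁻ x, ENNReal.ofReal (f n x) ∂m) atTop :=
          lintegral_liminf_le' fun n => (hf n).aestronglyMeasurable.aemeasurable.ennreal_ofReal
      _ ≤ liminf (fun _ : ℕ => ENNReal.ofReal C) atTop := by
          refine liminf_le_liminf (Eventually.of_forall fun n => ?_)
          rw [← ofReal_integral_eq_lintegral_ofReal (hf n) (h0 n)]
          exact ENNReal.ofReal_le_ofReal (hC n)
      _ = ENNReal.ofReal C := liminf_const _
  have hint : Integrable F m :=
    ⟨hm, (hasFiniteIntegral_iff_ofReal hF0).2 (hle.trans_lt ENNReal.ofReal_lt_top)⟩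
  refine ⟨hint, ?_⟩
  rwa [← ofReal_integral_eq_lintegral_ofReal hint hF0, ENNReal.ofReal_le_ofReal_iff hC0] at hle

/-- Fatou's lemma for functions bounded below by a family with convergent integrals. -/
theorem eventually_integral_sub_le {f g : ℕ → X → ℝ} {F G : X → ℝ}
    (hf : ∀ n, Integrable (f n) m) (hg : ∀ n, Integrable (g n) m)
    (hF : Integrable F m) (hG : Integrable G m)
    (hlow : ∀ n, ∀ᵐ x ∂m, -g n x ≤ f n x)
    (hfF : ∀ᵐ x ∂m, Tendsto (fun n => f n x) atTop (𝓝 (F x)))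
    (hgG : ∀ᵐ x ∂m, Tendsto (fun n => g n x) atTop (𝓝 (G x)))
    (hint : Tendsto (fun n => ∫ x, g n x ∂m) atTop (𝓝 (∫ x, G x ∂m))) {η : ℝ} (hη : 0 < η) :
    ∀ᶠ n in atTop, (∫ x, F x ∂m) - η ≤ ∫ x, f n x ∂m := by
  by_contra hcon
  rw [not_eventually] at hcon
  have hg2 : ∀ᶠ n in atTop, ∫ x, g n x ∂m < (∫ x, G x ∂m) + η / 2 :=
    hint.eventually_lt_const (by linarith)
  -- Along this subsequence f stays below by η while ∫g exceeds its limit by less than η/2; Fatou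
  -- for f + g ≥ 0 then gives a contradiction.
  obtain ⟨k, hk, hkP⟩ := extraction_of_frequently_atTop (hcon.and_eventually hg2)
  have key := (integrable_of_tendsto_of_integral_le (m := m)
    (f := fun n x => f (k n) x + g (k n) x) (F := fun x => F x + G x)
    (C := (∫ x, F x ∂m) + (∫ x, G x ∂m) - η / 2) (fun n => (hf _).add (hg _)) (fun n => ?_) ?_
    (fun n => ?_)).2
  · rw [integral_add hF hG] at key
    linarith
  · filter_upwards [hlow (k n)] with x hx
    linarith
  · filter_upwards [hfF, hgG] with x h1 h2
    exact (h1.add h2).comp hk.tendsto_atTop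
  · rw [integral_add (hf _) (hg _)]
    have h1 := not_le.1 (hkP n).1
    have h2 := (hkP n).2
    linarith

end Fatou

namespace IsPotential

variable {U : E3 → ℝ} (hU : IsPotential U)
include hU

/-- A bounded kernel makes the form continuous in L¹: replace the two factors one at a time. -/
theorem tendsto_dbl {u : ℕ → E3 → ℝ} {v : E3 → ℝ} (hu : ∀ n, Integrable (u n))
    (hv : Integrable v) (h0 : ∀ n, ∀ᵐ p, 0 ≤ u n p) (hv0 : ∀ᵐ p, 0 ≤ v p)
    (hL : Tendsto (fun n => ∫ p, |u n p - v p|) atTop (𝓝 0))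
    (hI : Tendsto (fun n => ∫ p, u n p) atTop (𝓝 (∫ p, v p))) :
    Tendsto (fun n => dbl U (u n) (u n)) atTop (𝓝 (dbl U v v)) := by
  obtain ⟨C, hC0, hC⟩ := hU.norm_le
  rw [tendsto_iff_norm_sub_tendsto_zero]
  have hlim : Tendsto (fun n => C * ((∫ p, |u n p - v p|) * (∫ p, u n p) +
      (∫ p, v p) * ∫ p, |u n p - v p|)) atTop (𝓝 0) := by
    have := ((hL.mul hI).add (hL.const_mul (∫ p, v p))).const_mul C
    simpa using this
  refine squeeze_zero (fun _ => norm_nonneg _) (fun n => ?_) hlim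
  unfold dbl
  rw [← integral_sub (hU.integrable_both (hu n) (hu n)) (hU.integrable_both hv hv)]
  have hd : Integrable fun p => |u n p - v p| := ((hu n).sub hv).abs
  have i1 : Integrable (fun z : E3 × E3 => |u n z.1 - v z.1| * u n z.2) vol2 :=
    hd.mul_prod (hu n)
  have i2 : Integrable (fun z : E3 × E3 => v z.1 * |u n z.2 - v z.2|) vol2 := hv.mul_prod hd
  refine (norm_integral_le_of_norm_le ((i1.add i2).const_mul C) ?_).trans_eq ?_
  · filter_upwards [ae_fst (h0 n), ae_snd (h0 n), ae_fst hv0, ae_snd hv0] with z a1 a2 a3 a4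
    rw [← mul_sub, norm_mul]
    refine mul_le_mul (hC _) ?_ (norm_nonneg _) hC0
    have e : u n z.1 * u n z.2 - v z.1 * v z.2 =
        (u n z.1 - v z.1) * u n z.2 + v z.1 * (u n z.2 - v z.2) := by ring
    rw [e, Real.norm_eq_abs]
    refine (abs_add_le _ _).trans_eq ?_
    rw [abs_mul, abs_mul, abs_of_nonneg a2, abs_of_nonneg a3]
    rfl
  · rw [integral_const_mul]
    congr 1
    refine (integral_add i1 i2).trans ?_
    congr 1
    · exact integral_prod_mul (fun p => |u n p - v p|) (u n)
    · exact integral_prod_mul v (fun p => |u n p - v p|)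

omit hU in
/-- Semicontinuity of the kinetic energy minus the entropy. -/
theorem eventually_kin_sub_entropy_ge {γs αs : ℕ → E3 → ℝ} {γ α : E3 → ℝ} (h : ∀ n, Adm (γs n) (αs n)) (hadm : Adm γ α)
    (hγ : ∀ᵐ p, Tendsto (fun n => γs n p) atTop (𝓝 (γ p)))
    (hα : ∀ᵐ p, Tendsto (fun n => αs n p) atTop (𝓝 (α p)))
    {T : ℝ} (hT : 0 < T)
    (hM : Tendsto (fun n => ∫ p, γs n p) atTop (𝓝 (∫ p, γ p))) {η : ℝ} (hη : 0 < η) :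
    ∀ᶠ n in atTop, (∫ p, (‖p‖ ^ 2 * γ p - T * sDens (γ p) (α p))) - η ≤
      ∫ p, (‖p‖ ^ 2 * γs n p - T * sDens (γs n p) (αs n p)) := by
  -- Half of the kinetic energy pays for the entropy. What remains to dominate is γ/2 plus a fixed
  -- function, and its integral converges because the mass does.
  refine eventually_integral_sub_le (g := fun n p => 1 / 2 * γs n p + 8 * T ^ 3 * jap p)
    (G := fun p => 1 / 2 * γ p + 8 * T ^ 3 * jap p)
    (fun n => (h n).int_kin.sub ((h n).int_sDens.const_mul T))
    (fun n => ((h n).int_gamma.const_mul _).add (integrable_jap.const_mul _))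
    (hadm.int_kin.sub (hadm.int_sDens.const_mul T))
    ((hadm.int_gamma.const_mul _).add (integrable_jap.const_mul _)) (fun n => ?_) ?_ ?_ ?_ hη
  · filter_upwards [(h n).dom] with p hp
    simp only [Pi.sub_apply]
    have h1 := mul_le_mul_of_nonneg_left
      (hp.sDens_le_weight (t := 1 / (2 * T)) (by positivity) p) hT.le
    have h2 : T * (1 / (2 * T) * ((1 + ‖p‖ ^ 2) * γs n p) + 2 / (1 / (2 * T)) ^ 2 * jap p) =
        1 / 2 * ((1 + ‖p‖ ^ 2) * γs n p) + 8 * T ^ 3 * jap p := by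
      field_simp
      ring
    rw [h2] at h1
    have h3 : 0 ≤ ‖p‖ ^ 2 * γs n p := mul_nonneg (by positivity) hp.1
    linarith
  · filter_upwards [hγ, hα] with p h1 h2
    have h3 : Tendsto (fun n => sDens (γs n p) (αs n p)) atTop (𝓝 (sDens (γ p) (α p))) :=
      Tendsto.comp (f := fun n => (γs n p, αs n p)) (g := fun z : ℝ × ℝ => sDens z.1 z.2)
        (continuous_sDens.tendsto (γ p, α p)) (h1.prodMk_nhds h2)
    exact (h1.const_mul _).sub (h3.const_mul _)
  · filter_upwards [hγ] with p h1
    exact (h1.const_mul _).add_const _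
  · rw [integral_add (hadm.int_gamma.const_mul _) (integrable_jap.const_mul _),
      integral_const_mul]
    have : ∀ n, ∫ p, (1 / 2 * γs n p + 8 * T ^ 3 * jap p) =
        1 / 2 * (∫ p, γs n p) + ∫ p, 8 * T ^ 3 * jap p := fun n => by
      rw [integral_add ((h n).int_gamma.const_mul _) (integrable_jap.const_mul _),
        integral_const_mul]
    simp only [this]
    exact (hM.const_mul _).add_const _

/-- Semicontinuity of the coupling to the condensate. -/
theorem eventually_linear_ge {γs αs : ℕ → E3 → ℝ} {γ α : E3 → ℝ} (h : ∀ n, Adm (γs n) (αs n)) (hadm : Adm γ α)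
    (hγ : ∀ᵐ p, Tendsto (fun n => γs n p) atTop (𝓝 (γ p)))
    (hα : ∀ᵐ p, Tendsto (fun n => αs n p) atTop (𝓝 (α p)))
    {η : ℝ} (hη : 0 < η) :
    ∀ᶠ n in atTop, (∫ p, (U p * γ p + U p * α p)) - η ≤
      ∫ p, (U p * γs n p + U p * αs n p) := by
  have hint : ∀ {g a : E3 → ℝ}, Adm g a → Integrable fun p => U p * g p + U p * a p :=
    fun hga => (hU.integrable_mul hga.ctl_gamma).add (hU.integrable_mul hga.ctl_alpha)
  refine eventually_integral_sub_le (g := fun n p => 1 / 2 * U p)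
    (G := fun p => 1 / 2 * U p) (fun n => hint (h n)) (fun n => hU.integrable.const_mul _)
    (hint hadm) (hU.integrable.const_mul _) (fun n => ?_) ?_ ?_ tendsto_const_nhds hη
  · filter_upwards [(h n).dom] with p hp
    have h1 := (abs_le.1 hp.abs_le_add_half).1
    have := hU.nonneg p
    nlinarith
  · filter_upwards [hγ, hα] with p h1 h2
    exact (h1.const_mul _).add (h2.const_mul _)
  · exact Eventually.of_forall fun p => tendsto_const_nhds

/-- Semicontinuity of the pairing energy. -/
theorem eventually_pairing_ge {γs αs : ℕ → E3 → ℝ} {γ α : E3 → ℝ} (h : ∀ n, Adm (γs n) (αs n)) (hadm : Adm γ α)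
    (hγ : ∀ᵐ p, Tendsto (fun n => γs n p) atTop (𝓝 (γ p)))
    (hα : ∀ᵐ p, Tendsto (fun n => αs n p) atTop (𝓝 (α p)))
    (hdγ : Tendsto (fun n => dbl U (γs n) (γs n)) atTop (𝓝 (dbl U γ γ)))
    (hM : Tendsto (fun n => ∫ p, γs n p) atTop (𝓝 (∫ p, γ p))) {η : ℝ} (hη : 0 < η) :
    ∀ᶠ n in atTop, dbl U α α - η ≤ dbl U (αs n) (αs n) := by
  have hint : ∀ {g a : E3 → ℝ}, Adm g a → Integrable (fun z : E3 × E3 =>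
      2 * (U (z.1 - z.2) * (g z.1 * g z.2)) +
        (U (z.1 - z.2) * g z.1 + U (z.1 - z.2) * g z.2)) vol2 := fun hga =>
    ((hU.integrable_both hga.int_gamma hga.int_gamma).const_mul 2).add
      ((hU.integrable_fst hga.int_gamma).add (hU.integrable_snd hga.int_gamma))
  have hval : ∀ {g a : E3 → ℝ}, Adm g a → ∫ z : E3 × E3,
      (2 * (U (z.1 - z.2) * (g z.1 * g z.2)) +
        (U (z.1 - z.2) * g z.1 + U (z.1 - z.2) * g z.2)) ∂vol2 =
      2 * dbl U g g + 2 * ((∫ p, U p) * ∫ p, g p) := by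
    intro g a hga
    have e1 : ∫ z : E3 × E3, U (z.1 - z.2) * g z.1 ∂vol2 = (∫ p, U p) * ∫ p, g p := by
      rw [integral_prod _ (hU.integrable_fst hga.int_gamma), ← integral_const_mul]
      congr 1
      ext p
      refine (integral_mul_const (g p) (fun q => U (p - q))).trans ?_
      rw [integral_sub_left]
    have e2 : ∫ z : E3 × E3, U (z.1 - z.2) * g z.2 ∂vol2 = (∫ p, U p) * ∫ p, g p := by
      rw [← e1, ← integral_prod_swap]
      congr 1
      ext z
      simp [hU.sub_comm z.1 z.2]
    rw [integral_add (g := fun z : E3 × E3 => U (z.1 - z.2) * g z.1 + U (z.1 - z.2) * g z.2)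
        ((hU.integrable_both hga.int_gamma hga.int_gamma).const_mul 2)
      ((hU.integrable_fst hga.int_gamma).add (hU.integrable_snd hga.int_gamma)),
      integral_add (hU.integrable_fst hga.int_gamma) (hU.integrable_snd hga.int_gamma),
      e1, e2, integral_const_mul]
    unfold dbl
    ring
  -- The pairing integrand is at least -U(p - q)(2γ(p)γ(q) + γ(p) + γ(q)), whose integrals converge
  -- by `hval`. No L² convergence of α is needed.
  refine eventually_integral_sub_le (fun n => hU.integrable_dbl (h n).ctl_alpha (h n).ctl_alpha)
    (fun n => hint (h n)) (hU.integrable_dbl hadm.ctl_alpha hadm.ctl_alpha) (hint hadm)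
    (fun n => ?_) ?_ ?_ ?_ hη
  · filter_upwards [ae_fst (h n).dom, ae_snd (h n).dom] with z h1 h2
    have h3 := (abs_le.1 (abs_mul_le_of_le h1.1 h2.1 h1.abs_le_add_sqrt
      h2.abs_le_add_sqrt)).1
    have := mul_le_mul_of_nonneg_left h3 (hU.nonneg (z.1 - z.2))
    linarith
  · filter_upwards [ae_fst hα, ae_snd hα] with z h1 h2
    exact (h1.mul h2).const_mul _
  · filter_upwards [ae_fst hγ, ae_snd hγ] with z h1 h2
    exact (((h1.mul h2).const_mul _).const_mul _).add ((h1.const_mul _).add (h2.const_mul _))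
  · rw [hval hadm]
    simp only [fun n => hval (h n)]
    exact (hdγ.const_mul 2).add ((hM.const_mul _).const_mul 2)

/-- The energy is lower semicontinuous along sequences for which `γ` converges in `L¹` and almost
everywhere, and `α` converges almost everywhere. -/
theorem energy_le_of_tendsto {T : ℝ} (hT : 0 < T) (μ : ℝ) {γs αs : ℕ → E3 → ℝ} {rs : ℕ → ℝ}
    {γ α : E3 → ℝ} {r C B : ℝ} {b : ℕ → ℝ} (h : ∀ n, Adm (γs n) (αs n)) (hr0 : ∀ n, 0 ≤ rs n)
    (hγ : ∀ᵐ p, Tendsto (fun n => γs n p) atTop (𝓝 (γ p)))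
    (hα : ∀ᵐ p, Tendsto (fun n => αs n p) atTop (𝓝 (α p)))
    (hr : Tendsto rs atTop (𝓝 r))
    (hL1 : Tendsto (fun n => ∫ p, |γs n p - γ p|) atTop (𝓝 0))
    (hmass : ∀ n, ∫ p, γs n p ≤ C) (hkin : ∀ n, ∫ p, ‖p‖ ^ 2 * γs n p ≤ C)
    (hb : Tendsto b atTop (𝓝 B)) (hE : ∀ n, energy U T μ (γs n) (αs n) (rs n) ≤ b n) :
    Adm γ α ∧ energy U T μ γ α r ≤ B := by
  have c0 := cst_pos
  have hadm : Adm γ α := by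
    refine Adm.of_int ?_ ?_ ?_ ?_
    · exact (integrable_of_tendsto_of_integral_le (fun n => (h n).int_gamma)
        (fun n => (h n).nonneg) hγ hmass).1
    · refine (integrable_of_tendsto_of_integral_le (fun n => (h n).int_kin)
        (fun n => ?_) ?_ hkin).1
      · filter_upwards [(h n).nonneg] with p hp
        exact mul_nonneg (by positivity) hp
      · filter_upwards [hγ] with p hp
        exact hp.const_mul _
    · filter_upwards [hγ, hα, ae_all_iff.2 fun n => (h n).dom] with p h1 h2 h3
      exact ⟨ge_of_tendsto' h1 fun n => (h3 n).1,
        le_of_tendsto_of_tendsto' (h2.pow 2) (h1.mul (h1.const_add 1)) fun n => (h3 n).2⟩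
    · exact aestronglyMeasurable_of_tendsto_ae atTop (fun n => (h n).meas) hα
  refine ⟨hadm, ?_⟩
  have hM : Tendsto (fun n => ∫ p, γs n p) atTop (𝓝 (∫ p, γ p)) := by
    rw [tendsto_iff_norm_sub_tendsto_zero]
    refine squeeze_zero (fun _ => norm_nonneg _) (fun n => ?_) hL1
    rw [← integral_sub (h n).int_gamma hadm.int_gamma]
    exact norm_integral_le_integral_norm _
  have hdγ := hU.tendsto_dbl (fun n => (h n).int_gamma) hadm.int_gamma (fun n => (h n).nonneg)
    hadm.nonneg hL1 hM
  have hr0' : 0 ≤ r := ge_of_tendsto' hr hr0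
  -- Grouping: the first, third and fourth summands are only semicontinuous, each needing its own
  -- Fatou argument; the bracket converges. Kinetic energy and entropy must stay together, as
  -- neither has the right sign alone.
  have hsplit : ∀ {g a : E3 → ℝ} (s : ℝ), Adm g a → energy U T μ g a s =
      cst * (∫ p, (‖p‖ ^ 2 * g p - T * sDens (g p) (a p)))
      + (-μ * (s + cst * ∫ p, g p) + U 0 / 2 * (s + cst * ∫ p, g p) ^ 2
        + 1 / 2 * cst ^ 2 * dbl U g g) + 1 / 2 * cst ^ 2 * dbl U a a
      + s * (cst * ∫ p, (U p * g p + U p * a p)) := by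
    intro g a s hga
    unfold energy
    rw [integral_sub hga.int_kin (hga.int_sDens.const_mul T), integral_const_mul,
      integral_add (hU.integrable_mul hga.ctl_gamma) (hU.integrable_mul hga.ctl_alpha)]
    ring
  have hmain : ∀ η > 0, energy U T μ γ α r - (cst + 1 / 2 * cst ^ 2 + r * cst) * η ≤ B := by
    intro η hη
    rw [hsplit r hadm]
    set Y := ∫ p, (‖p‖ ^ 2 * γ p - T * sDens (γ p) (α p))
    set X := ∫ p, (U p * γ p + U p * α p)
    have hρ := hr.add (hM.const_mul cst)
    have hlim : Tendsto (fun n => cst * (Y - η)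
      + (-μ * (rs n + cst * ∫ p, γs n p) + U 0 / 2 * (rs n + cst * ∫ p, γs n p) ^ 2
        + 1 / 2 * cst ^ 2 * dbl U (γs n) (γs n)) + 1 / 2 * cst ^ 2 * (dbl U α α - η)
      + rs n * (cst * (X - η))) atTop (𝓝 (cst * (Y - η)
      + (-μ * (r + cst * ∫ p, γ p) + U 0 / 2 * (r + cst * ∫ p, γ p) ^ 2
        + 1 / 2 * cst ^ 2 * dbl U γ γ) + 1 / 2 * cst ^ 2 * (dbl U α α - η)
      + r * (cst * (X - η)))) :=
      (((((hρ.const_mul _).add ((hρ.pow 2).const_mul _)).add (hdγ.const_mul _)).const_add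
        _).add_const _).add (hr.mul_const _)
    have := le_of_tendsto_of_tendsto hlim hb (by
      filter_upwards [eventually_kin_sub_entropy_ge h hadm hγ hα hT hM hη,
        hU.eventually_linear_ge h hadm hγ hα hη,
        hU.eventually_pairing_ge h hadm hγ hα hdγ hM hη] with n h1 h2 h3
      refine le_trans ?_ (hE n)
      rw [hsplit (rs n) (h n)]
      have a1 := mul_le_mul_of_nonneg_left h1 c0.le
      have a2 := mul_le_mul_of_nonneg_left (mul_le_mul_of_nonneg_left h2 c0.le) (hr0 n)
      have a3 := mul_le_mul_of_nonneg_left h3 (show 0 ≤ 1 / 2 * cst ^ 2 by positivity)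
      linarith)
    refine le_trans (le_of_eq ?_) this
    ring
  have hK : 0 < cst + 1 / 2 * cst ^ 2 + r * cst := by positivity
  refine le_of_forall_pos_le_add fun ε hε => ?_
  have := hmain (ε / (cst + 1 / 2 * cst ^ 2 + r * cst)) (by positivity)
  rw [mul_div_cancel₀ _ hK.ne'] at this
  linarith

end IsPotential

/-! ### Moving the low-momentum part of a state into the condensate -/

theorem volume_real_ball {δ : ℝ} (hδ : 0 ≤ δ) :
    volume.real (Metric.ball (0 : E3) δ) = δ ^ 3 * volume.real (Metric.ball (0 : E3) 1) := by
  rw [measureReal_def, measureReal_def, Measure.addHaar_ball volume (0 : E3) hδ, ENNReal.toReal_mul,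
    ENNReal.toReal_ofReal (by positivity)]
  simp

/-- Gibbs bound with x = δ: the remainder 2/δ² times the ball's volume, of order δ³, is of order δ.
-/
theorem integral_sDens_le_of_ball {γ α : E3 → ℝ} (h : Adm γ α) {δ : ℝ} (hδ : 0 < δ) :
    ∫ p, sDens ((Metric.ball (0 : E3) δ).indicator γ p) ((Metric.ball (0 : E3) δ).indicator α p) ≤
      δ * (∫ p, (Metric.ball (0 : E3) δ).indicator γ p) +
        2 * volume.real (Metric.ball (0 : E3) 1) * δ := by
  set A := Metric.ball (0 : E3) δ
  have hA : MeasurableSet A := measurableSet_ball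
  have hi := h.indicator hA
  have hc : Integrable (A.indicator fun _ => 2 / δ ^ 2) := by
    rw [integrable_indicator_iff hA]
    exact integrableOn_const measure_ball_lt_top.ne
  have e : 2 * volume.real (Metric.ball (0 : E3) 1) * δ = ∫ p, A.indicator (fun _ => 2 / δ ^ 2) p := by
    rw [integral_indicator hA, setIntegral_const, volume_real_ball hδ.le, smul_eq_mul]
    field_simp
  rw [e, ← integral_const_mul, ← integral_add (hi.int_gamma.const_mul _) hc]
  refine integral_mono_ae hi.int_sDens ((hi.int_gamma.const_mul _).add hc) ?_
  filter_upwards [h.dom] with p hp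
  by_cases hpA : p ∈ A
  · simp only [Set.indicator_of_mem hpA]
    exact hp.sDens_le hδ
  · simp [Set.indicator_of_notMem hpA, sDens_zero]

namespace IsPotential

variable {U : E3 → ℝ} (hU : IsPotential U)
include hU

/-- On the support of φ the mean field of ψ differs from its value at 0 by at most Λ(1 + ∫h)δ. At 0
it equals ∫Uψ, the form in which a condensate couples. -/
theorem dbl_ball_ge {Λ : ℝ} (hΛ0 : 0 ≤ Λ) (hΛ : ∀ (φ g : E3 → ℝ), Ctl φ g → ∀ p p',
    |conv U φ p - conv U φ p'| ≤ Λ * (1 + ∫ q, g q) * ‖p - p'‖)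
    {φ ψ g h : E3 → ℝ} (hφ : Ctl φ g) (hψ : Ctl ψ h) (hφi : Integrable φ) {δ : ℝ}
    (hsupp : ∀ p, δ ≤ ‖p‖ → φ p = 0) :
    conv U ψ 0 * (∫ p, φ p) - Λ * (1 + ∫ q, h q) * δ * ∫ p, |φ p| ≤ dbl U φ ψ := by
  rw [hU.dbl_eq_integral hφ hψ, ← integral_const_mul, ← integral_const_mul,
    ← integral_sub (hφi.const_mul _) (hφi.abs.const_mul _)]
  refine integral_mono ((hφi.const_mul _).sub (hφi.abs.const_mul _))
    (hU.integrable_mul_conv hφ hψ) fun p => ?_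
  have hh0 : 0 ≤ ∫ q, h q := integral_nonneg_of_ae hψ.nonneg
  by_cases hp : δ ≤ ‖p‖
  · simp [hsupp p hp]
  · have h1 := hΛ ψ h hψ p 0
    rw [sub_zero] at h1
    have h2 : |conv U ψ p - conv U ψ 0| ≤ Λ * (1 + ∫ q, h q) * δ :=
      h1.trans (mul_le_mul_of_nonneg_left (not_le.1 hp).le (by positivity))
    have h3 := mul_le_mul_of_nonneg_left h2 (abs_nonneg (φ p))
    rw [← abs_mul] at h3
    have h4 := (abs_le.1 h3).1
    simp only
    linarith

omit hU in
-- Bookkeeping for condensing a ball. Index 1 on M, s, k, a, g is the inside; M₂, s₂, k₂, a₀, g₀ are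
-- outside. M is mass, s entropy, k kinetic energy, a and g the integrals of Uα and Uγ; q and w are
-- the forms of α and γ (inner, cross, outer), and m₁, n₁ are ∫α, ∫|α| inside. The total density is
-- unchanged. The cross terms c²(a₀m₁ + g₀M₁) are traded for the new coupling c²M₁(g₀ - |a₀|),
-- affordable because |m₁| ≤ M₁ + O(δ).
theorem condense_arith {c T μ u r C₀ Cu Λ v δ KA a₀ a₁ g₀ g₁ q₁ q₂ q₃ w₁ w₂ w₃ s₁ s₂ k₁ k₂ n₁ m₁
    M₁ M₂ : ℝ} (c0 : 0 < c) (hT : 0 < T) (hC₀ : 0 ≤ C₀) (hCu0 : 0 ≤ Cu) (hΛ0 : 0 ≤ Λ) (hv0 : 0 ≤ v)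
    (hδ : 0 < δ) (hδ1 : δ ≤ 1) (hr : 0 ≤ r) (hrC : r ≤ C₀) (hM : M₁ + M₂ ≤ C₀)
    (hMi : 0 ≤ M₁) (hMo : 0 ≤ M₂) (hn0 : 0 ≤ n₁) (habs : n₁ ≤ M₁ + 1 / 2 * (v * δ))
    (haabs : |m₁| ≤ M₁ + 1 / 2 * (v * δ)) (bS : s₁ ≤ δ * M₁ + 2 * v * δ)
    (bα : a₀ * m₁ - Λ * (1 + M₂) * δ * n₁ ≤ q₂) (bγ : g₀ * M₁ - Λ * (1 + M₂) * δ * M₁ ≤ w₂)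
    (bA : |a₀| ≤ KA) (bX : -(Cu * (1 / 2 * (v * δ))) ≤ g₁ + a₁) (hαα0 : 0 ≤ q₁) (hγγ0 : 0 ≤ w₁)
    (hK0 : 0 ≤ k₁) :
    c * k₂ - μ * (r + c * M₁ + c * M₂) - T * (c * s₂) + u / 2 * (r + c * M₁ + c * M₂) ^ 2
      + 1 / 2 * c ^ 2 * (q₃ + w₃) + (r + c * M₁) * (c * (g₀ + -|a₀|)) ≤
    c * (k₁ + k₂) - μ * (r + c * (M₁ + M₂)) - T * (c * (s₁ + s₂))
      + u / 2 * (r + c * (M₁ + M₂)) ^ 2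
      + 1 / 2 * c ^ 2 * (q₁ + 2 * q₂ + q₃ + (w₁ + 2 * w₂ + w₃))
      + r * (c * (g₁ + g₀ + (a₁ + a₀)))
      + (T * c * (C₀ + 2 * v) + c ^ 2 * (Λ * (1 + C₀) * (C₀ + v) + Λ * (1 + C₀) * C₀) +
        C₀ * c * (Cu * v) + c ^ 2 * (KA * v)) * δ := by
  have hM₂ : M₂ ≤ C₀ := by linarith
  have hM₁ : M₁ ≤ C₀ := by linarith
  have hvδ : v * δ ≤ v := mul_le_of_le_one_right hv0 hδ1
  have hn₁ : n₁ ≤ C₀ + v := by linarith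
  have t1 : T * c * s₁ ≤ T * c * ((C₀ + 2 * v) * δ) := by
    refine mul_le_mul_of_nonneg_left (bS.trans ?_) (by positivity)
    nlinarith
  have t2 : Λ * (1 + M₂) * δ * n₁ ≤ Λ * (1 + C₀) * δ * (C₀ + v) := by
    gcongr
  have t3 : Λ * (1 + M₂) * δ * M₁ ≤ Λ * (1 + C₀) * δ * C₀ := by gcongr
  have t4 : r * c * -(Cu * (1 / 2 * (v * δ))) ≤ r * c * (g₁ + a₁) :=
    mul_le_mul_of_nonneg_left bX (by positivity)
  have t4' : r * c * (Cu * (1 / 2 * (v * δ))) ≤ C₀ * c * (Cu * (v * δ)) := by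
    have h1 : 0 ≤ v * δ := by positivity
    refine mul_le_mul (mul_le_mul_of_nonneg_right hrC c0.le) ?_ (by positivity) (by positivity)
    exact mul_le_mul_of_nonneg_left (by linarith) hCu0
  have t5 : -(KA * (v * δ)) ≤ a₀ * m₁ + M₁ * |a₀| := by
    have h1 : |a₀ * m₁| ≤ |a₀| * (M₁ + 1 / 2 * (v * δ)) := by
      rw [abs_mul]
      exact mul_le_mul_of_nonneg_left haabs (abs_nonneg _)
    have h2 := (abs_le.1 h1).1
    have h3 : |a₀| * (v * δ) ≤ KA * (v * δ) :=
      mul_le_mul_of_nonneg_right bA (by positivity)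
    have h4 : 0 ≤ |a₀| * (v * δ) := by positivity
    linarith
  have t6 : 0 ≤ r * c * (a₀ + |a₀|) :=
    mul_nonneg (by positivity) (by linarith [neg_abs_le a₀])
  have u2 := mul_le_mul_of_nonneg_left (add_le_add (add_le_add bα bγ) t5) (sq_nonneg c)
  have u3 := mul_le_mul_of_nonneg_left (add_le_add t2 t3) (sq_nonneg c)
  have u4 : 0 ≤ c ^ 2 * (q₁ + w₁) := by positivity
  have u5 : 0 ≤ c * k₁ := by positivity
  linarith

/-- Replacing the part of a state in a small ball around the origin by condensate, possibly after
changing the sign of `α`, raises the energy by a uniformly small amount. -/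
theorem exists_condense_bound {T : ℝ} (hT : 0 < T) (μ : ℝ) {C₀ : ℝ} (hC₀ : 0 ≤ C₀) :
    ∃ K, ∀ δ : ℝ, 0 < δ → δ ≤ 1 → ∀ (γ α : E3 → ℝ) (r : ℝ), Adm γ α → 0 ≤ r → r ≤ C₀ →
      ∫ p, γ p ≤ C₀ → ∃ σ : ℝ, (σ = 1 ∨ σ = -1) ∧
        energy U T μ ((Metric.ball (0 : E3) δ)ᶜ.indicator γ)
          (fun p => σ * (Metric.ball (0 : E3) δ)ᶜ.indicator α p)
          (r + cst * ∫ p, (Metric.ball (0 : E3) δ).indicator γ p) ≤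
        energy U T μ γ α r + K * δ := by
  obtain ⟨Cu, hCu0, hCu⟩ := hU.norm_le
  have hCu' : ∀ p, U p ≤ Cu := fun p => (le_abs_self _).trans (hCu p)
  obtain ⟨Λ, hΛ0, hΛ⟩ := hU.exists_lipschitz_conv
  have c0 := cst_pos
  set v := volume.real (Metric.ball (0 : E3) 1) with hv
  have hv0 : 0 ≤ v := measureReal_nonneg
  set W := ∫ p, U p with hW
  have hW0 : 0 ≤ W := integral_nonneg hU.nonneg
  set KA := 3 / 2 * Cu * C₀ + 1 / 2 * W with hKA
  have hKA0 : 0 ≤ KA := by positivity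
  refine ⟨T * cst * (C₀ + 2 * v) + cst ^ 2 * (Λ * (1 + C₀) * (C₀ + v) + Λ * (1 + C₀) * C₀) +
    C₀ * cst * (Cu * v) + cst ^ 2 * (KA * v), fun δ hδ hδ1 γ α r h hr hrC hM => ?_⟩
  set A := Metric.ball (0 : E3) δ with hAdef
  have hA : MeasurableSet A := measurableSet_ball
  have hi := h.indicator hA
  have ho := h.indicator hA.compl
  set γi := A.indicator γ with hγi
  set αi := A.indicator α with hαi
  set γo := Aᶜ.indicator γ with hγo
  set αo := Aᶜ.indicator α with hαo
  have eγ : γ = fun p => γi p + γo p := (Set.indicator_self_add_compl A γ).symm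
  have eα : α = fun p => αi p + αo p := (Set.indicator_self_add_compl A α).symm
  have hδ3 : δ ^ 3 ≤ δ := by
    have : δ ^ 2 ≤ 1 := pow_le_one₀ hδ.le hδ1
    calc δ ^ 3 = δ * δ ^ 2 := by ring
      _ ≤ δ * 1 := by gcongr
      _ = δ := mul_one _
  have hvol : volume.real A ≤ v * δ := by
    rw [hAdef, volume_real_ball hδ.le, mul_comm]
    exact mul_le_mul_of_nonneg_left hδ3 hv0
  have hhalf : Integrable (A.indicator fun _ => (1 / 2 : ℝ)) := by
    rw [integrable_indicator_iff hA]
    exact integrableOn_const measure_ball_lt_top.ne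
  have hhalfI : ∫ p, A.indicator (fun _ => (1 / 2 : ℝ)) p ≤ 1 / 2 * (v * δ) := by
    rw [integral_indicator hA, setIntegral_const, smul_eq_mul]
    linarith
  have hαiB : ∀ᵐ p, |αi p| ≤ γi p + A.indicator (fun _ => (1 / 2 : ℝ)) p := by
    filter_upwards [h.dom] with p hp
    by_cases hpA : p ∈ A
    · simp only [hγi, hαi, Set.indicator_of_mem hpA]
      exact hp.abs_le_add_half
    · simp [hγi, hαi, Set.indicator_of_notMem hpA]
  have hαiI : Integrable αi :=
    (hi.int_gamma.add hhalf).mono' hi.meas hαiB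
  have habs : ∫ p, |αi p| ≤ (∫ p, γi p) + 1 / 2 * (v * δ) := by
    have := integral_mono_ae hαiI.abs (hi.int_gamma.add hhalf) hαiB
    refine this.trans ?_
    have e := integral_add hi.int_gamma hhalf
    exact e.le.trans (by linarith)
  have haabs : |∫ p, αi p| ≤ (∫ p, γi p) + 1 / 2 * (v * δ) :=
    (norm_integral_le_integral_norm αi).trans habs
  have hn0 : 0 ≤ ∫ p, |αi p| := integral_nonneg fun p => abs_nonneg _
  have dM : ∫ p, γ p = (∫ p, γi p) + ∫ p, γo p := by
    conv_lhs => rw [eγ]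
    exact integral_add hi.int_gamma ho.int_gamma
  have dK : ∫ p, ‖p‖ ^ 2 * γ p = (∫ p, ‖p‖ ^ 2 * γi p) + ∫ p, ‖p‖ ^ 2 * γo p := by
    conv_lhs => rw [eγ]
    simp only [mul_add]
    exact integral_add hi.int_kin ho.int_kin
  have dS : ∫ p, sDens (γ p) (α p) = (∫ p, sDens (γi p) (αi p)) + ∫ p, sDens (γo p) (αo p) := by
    rw [← integral_add hi.int_sDens ho.int_sDens]
    congr 1
    ext p
    by_cases hpA : p ∈ A <;> simp [hγi, hαi, hγo, hαo, hpA, sDens_zero]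
  have dUγ : ∫ p, U p * γ p = (∫ p, U p * γi p) + ∫ p, U p * γo p := by
    conv_lhs => rw [eγ]
    simp only [mul_add]
    exact integral_add (hU.integrable_mul hi.ctl_gamma) (hU.integrable_mul ho.ctl_gamma)
  have dUα : ∫ p, U p * α p = (∫ p, U p * αi p) + ∫ p, U p * αo p := by
    conv_lhs => rw [eα]
    simp only [mul_add]
    exact integral_add (hU.integrable_mul hi.ctl_alpha) (hU.integrable_mul ho.ctl_alpha)
  have dγγ : dbl U γ γ = dbl U γi γi + 2 * dbl U γi γo + dbl U γo γo := by
    conv_lhs => rw [eγ]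
    exact hU.dbl_quad_add hi.ctl_gamma ho.ctl_gamma
  have dαα : dbl U α α = dbl U αi αi + 2 * dbl U αi αo + dbl U αo αo := by
    conv_lhs => rw [eα]
    exact hU.dbl_quad_add hi.ctl_alpha ho.ctl_alpha
  have hMi := hi.gamma_nonneg
  have hMo := ho.gamma_nonneg
  have bS := integral_sDens_le_of_ball h hδ
  have hsupp : ∀ (f : E3 → ℝ) (p : E3), δ ≤ ‖p‖ → A.indicator f p = 0 := fun f p hp => by
    refine Set.indicator_of_notMem ?_ _
    simpa [hAdef] using hp
  have bα := hU.dbl_ball_ge hΛ0 hΛ hi.ctl_alpha ho.ctl_alpha hαiI (hsupp α)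
  have bγ := hU.dbl_ball_ge hΛ0 hΛ hi.ctl_gamma ho.ctl_gamma hi.int_gamma (hsupp γ)
  rw [hU.conv_zero] at bα bγ
  have absγ : ∫ p, |γi p| = ∫ p, γi p := by
    refine integral_congr_ae ?_
    filter_upwards [hi.nonneg] with p hp using abs_of_nonneg hp
  rw [absγ] at bγ
  have bA : |∫ p, U p * αo p| ≤ KA := by
    have := hU.abs_conv_le hCu' ho.ctl_alpha 0
    rw [hU.conv_zero] at this
    refine this.trans ?_
    have : ∫ p, γo p ≤ C₀ := by linarith
    rw [hKA]
    gcongr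
  have bX : -(Cu * (1 / 2 * (v * δ))) ≤ (∫ p, U p * γi p) + ∫ p, U p * αi p := by
    rw [← integral_add (hU.integrable_mul hi.ctl_gamma) (hU.integrable_mul hi.ctl_alpha)]
    have h1 : -(Cu * (1 / 2 * (v * δ))) ≤ ∫ p, -(Cu * A.indicator (fun _ => (1 / 2 : ℝ)) p) := by
      rw [integral_neg, integral_const_mul]
      exact neg_le_neg (mul_le_mul_of_nonneg_left hhalfI hCu0)
    refine h1.trans (integral_mono_ae (hhalf.const_mul _).neg
      ((hU.integrable_mul hi.ctl_gamma).add (hU.integrable_mul hi.ctl_alpha)) ?_)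
    filter_upwards [h.dom] with p hp
    by_cases hpA : p ∈ A
    · have h2 := (abs_le.1 hp.abs_le_add_half).1
      have h3 := hU.nonneg p
      have h4 := hCu' p
      simp only [hγi, hαi, Set.indicator_of_mem hpA]
      nlinarith
    · simp [hγi, hαi, Set.indicator_of_notMem hpA]
  have hαα0 := hU.dbl_nonneg hi.ctl_alpha
  have hγγ0 := hU.dbl_nonneg hi.ctl_gamma
  have hK0 := hi.kin_nonneg
  -- Entropy and quadratic terms are even in α, so the sign can be chosen to make the coupling of
  -- the outer α to the condensate as negative as possible.
  obtain ⟨σ, hσ, hσA⟩ : ∃ σ : ℝ, (σ = 1 ∨ σ = -1) ∧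
      σ * (∫ p, U p * αo p) = -|∫ p, U p * αo p| := by
    rcases le_total 0 (∫ p, U p * αo p) with h0 | h0
    · exact ⟨-1, Or.inr rfl, by rw [abs_of_nonneg h0]; ring⟩
    · exact ⟨1, Or.inl rfl, by rw [abs_of_nonpos h0]; ring⟩
  refine ⟨σ, hσ, ?_⟩
  have sS : ∀ p, sDens (γo p) (σ * αo p) = sDens (γo p) (αo p) := fun p => by
    rcases hσ with rfl | rfl
    · rw [one_mul]
    · rw [neg_one_mul, sDens_neg]
  have sD : dbl U (fun p => σ * αo p) (fun p => σ * αo p) = dbl U αo αo := by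
    unfold dbl
    congr 1
    ext z
    rcases hσ with rfl | rfl <;> ring
  have sL : ∫ p, U p * (σ * αo p) = -|∫ p, U p * αo p| := by
    rw [← hσA, ← integral_const_mul]
    congr 1
    ext p
    ring
  unfold energy
  simp only [sS]
  rw [dM] at hM
  rw [sD, sL, dM, dK, dS, dUγ, dUα, dγγ, dαα]
  generalize (∫ p, U p * αo p) = a₀ at *
  generalize (∫ p, U p * αi p) = a₁ at *
  generalize (∫ p, U p * γo p) = g₀ at *
  generalize (∫ p, U p * γi p) = g₁ at *
  generalize dbl U αi αi = q₁ at *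
  generalize dbl U αi αo = q₂ at *
  generalize dbl U αo αo = q₃ at *
  generalize dbl U γi γi = w₁ at *
  generalize dbl U γi γo = w₂ at *
  generalize dbl U γo γo = w₃ at *
  generalize (∫ p, sDens (γi p) (αi p)) = s₁ at *
  generalize (∫ p, sDens (γo p) (αo p)) = s₂ at *
  generalize (∫ p, ‖p‖ ^ 2 * γi p) = k₁ at *
  generalize (∫ p, ‖p‖ ^ 2 * γo p) = k₂ at *
  generalize (∫ p, |αi p|) = n₁ at *
  generalize (∫ p, αi p) = m₁ at *
  generalize (∫ p, γi p) = M₁ at *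
  generalize (∫ p, γo p) = M₂ at *
  exact condense_arith c0 hT hC₀ hCu0 hΛ0 hv0 hδ hδ1 hr hrC hM hMi hMo hn0 habs haabs bS bα bγ bA bX
    hαα0 hγγ0 hK0

end IsPotential

/-! ### Selecting convergent sequences from nested convex sets -/

section Selection

variable {X : Type*} [MeasurableSpace X] {m : Measure X}

theorem norm_toLp_sq {f : X → ℝ} (hf : MemLp f 2 m) : ‖hf.toLp f‖ ^ 2 = ∫ x, f x ^ 2 ∂m := by
  rw [← real_inner_self_eq_norm_sq, L2.inner_def]
  refine integral_congr_ae ?_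
  filter_upwards [hf.coeFn_toLp] with x hx
  rw [hx]
  simp [sq]

/-- In a decreasing sequence of nonempty midpoint-convex sets of pairs of square integrable
functions that stay within a bounded distance of the origin, one can select a sequence that
converges in `L²` and almost everywhere. -/
theorem exists_seq_tendsto_of_nested (K : ℕ → Set ((X → ℝ) × (X → ℝ))) (hanti : Antitone K)
    (hmem : ∀ n, ∀ x ∈ K n, MemLp x.1 2 m ∧ MemLp x.2 2 m) {C : ℝ}
    (hbd : ∀ n, ∃ x ∈ K n, (∫ p, x.1 p ^ 2 ∂m) + ∫ p, x.2 p ^ 2 ∂m ≤ C)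
    (hmid : ∀ n, ∀ x ∈ K n, ∀ y ∈ K n, ((fun p => (1 - 1 / 2) * x.1 p + 1 / 2 * y.1 p,
      fun p => (1 - 1 / 2) * x.2 p + 1 / 2 * y.2 p) : (X → ℝ) × (X → ℝ)) ∈ K n) :
    ∃ (x : ℕ → (X → ℝ) × (X → ℝ)) (u v : X → ℝ), (∀ n, x n ∈ K n) ∧
      MemLp u 2 m ∧ MemLp v 2 m ∧
      (∀ᵐ p ∂m, Tendsto (fun n => (x n).1 p) atTop (𝓝 (u p))) ∧
      (∀ᵐ p ∂m, Tendsto (fun n => (x n).2 p) atTop (𝓝 (v p))) ∧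
      Tendsto (fun n => ∫ p, ((x n).1 p - u p) ^ 2 ∂m) atTop (𝓝 0) ∧
      Tendsto (fun n => ∫ p, (x n).1 p ^ 2 ∂m) atTop (𝓝 (∫ p, u p ^ 2 ∂m)) ∧
      Tendsto (fun n => ∫ p, (x n).2 p ^ 2 ∂m) atTop (𝓝 (∫ p, v p ^ 2 ∂m)) := by
  set N : (X → ℝ) × (X → ℝ) → ℝ := fun x => (∫ p, x.1 p ^ 2 ∂m) + ∫ p, x.2 p ^ 2 ∂m with hN
  have hN0 : ∀ x, 0 ≤ N x := fun x =>
    add_nonneg (integral_nonneg fun p => sq_nonneg _) (integral_nonneg fun p => sq_nonneg _)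
  have hbdd : ∀ n, BddBelow (N '' K n) := fun n => ⟨0, by rintro _ ⟨x, -, rfl⟩; exact hN0 x⟩
  have hne : ∀ n, (N '' K n).Nonempty := fun n => by
    obtain ⟨x, hx, -⟩ := hbd n
    exact ⟨_, x, hx, rfl⟩
  -- Least squared norm in K n. It increases with n and is bounded by C, so elements of almost
  -- minimal norm are Cauchy by the parallelogram law. This gives strong convergence without weak
  -- compactness.
  set ν : ℕ → ℝ := fun n => sInf (N '' K n) with hν
  have hνC : ∀ n, ν n ≤ C := fun n => by
    obtain ⟨x, hx, hxC⟩ := hbd n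
    exact (csInf_le (hbdd n) ⟨x, hx, rfl⟩).trans hxC
  have hνmono : Monotone ν := fun a b hab =>
    csInf_le_csInf (hbdd a) (hne b) (Set.image_mono (hanti hab))
  have hνbdd : BddAbove (Set.range ν) := ⟨C, by rintro _ ⟨n, rfl⟩; exact hνC n⟩
  have hνlim := tendsto_atTop_ciSup hνmono hνbdd
  set ν' := ⨆ n, ν n with hν'
  have hνle : ∀ n, ν n ≤ ν' := fun n => le_ciSup hνbdd n
  have hex : ∀ n : ℕ, ∃ x ∈ K n, N x ≤ ν n + 1 / ((n : ℝ) + 1) := fun n => by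
    obtain ⟨_, ⟨x, hx, rfl⟩, hlt⟩ := exists_lt_of_csInf_lt (hne n)
      (show sInf (N '' K n) < ν n + 1 / ((n : ℝ) + 1) by
        have : (0 : ℝ) < 1 / ((n : ℝ) + 1) := by positivity
        simp only [hν]; linarith)
    exact ⟨x, hx, hlt.le⟩
  choose x hxK hxN using hex
  have m1 : ∀ n, MemLp (x n).1 2 m := fun n => (hmem n _ (hxK n)).1
  have m2 : ∀ n, MemLp (x n).2 2 m := fun n => (hmem n _ (hxK n)).2
  have hpar : ∀ (f g : X → ℝ), MemLp f 2 m → MemLp g 2 m →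
      ∫ p, (f p - g p) ^ 2 ∂m = 2 * (∫ p, f p ^ 2 ∂m) + 2 * (∫ p, g p ^ 2 ∂m) -
        4 * ∫ p, ((1 - 1 / 2) * f p + 1 / 2 * g p) ^ 2 ∂m := by
    intro f g hf hg
    have i1 := hf.integrable_sq
    have i2 := hg.integrable_sq
    have i3 : Integrable (fun p => ((1 - 1 / 2) * f p + 1 / 2 * g p) ^ 2) m :=
      ((hf.const_mul _).add (hg.const_mul _)).integrable_sq
    rw [← integral_const_mul, ← integral_const_mul, ← integral_const_mul,
      ← integral_add (i1.const_mul _) (i2.const_mul _),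
      ← integral_sub (f := fun p => 2 * f p ^ 2 + 2 * g p ^ 2) ((i1.const_mul _).add (i2.const_mul _)) (i3.const_mul _)]
    congr 1
    ext p
    ring
  have hdist : ∀ a b M : ℕ, M ≤ a → M ≤ b →
      (∫ p, ((x a).1 p - (x b).1 p) ^ 2 ∂m) + ∫ p, ((x a).2 p - (x b).2 p) ^ 2 ∂m ≤
        4 * (ν' - ν M) + 4 * (1 / ((M : ℝ) + 1)) := by
    intro a b M ha hb
    -- Both points lie in K M, hence so does their midpoint, whose squared norm is at least ν M.
    have hm := hmid M _ (hanti ha (hxK a)) _ (hanti hb (hxK b))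
    have h1 : ν M ≤ N _ := csInf_le (hbdd M) ⟨_, hm, rfl⟩
    simp only [hN] at h1
    rw [hpar _ _ (m1 a) (m1 b), hpar _ _ (m2 a) (m2 b)]
    have h2 := hxN a
    have h3 := hxN b
    simp only [hN] at h2 h3
    have h4 := hνle a
    have h5 := hνle b
    have h6 : 1 / ((a : ℝ) + 1) ≤ 1 / ((M : ℝ) + 1) := by gcongr
    have h7 : 1 / ((b : ℝ) + 1) ≤ 1 / ((M : ℝ) + 1) := by gcongr
    linarith
  have hB : Tendsto (fun M : ℕ => √(4 * (ν' - ν M) + 4 * (1 / ((M : ℝ) + 1)))) atTop (𝓝 0) := by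
    have h1 := ((hνlim.const_sub ν').const_mul 4).add
      (tendsto_one_div_add_atTop_nhds_zero_nat.const_mul (4 : ℝ))
    have := (Real.continuous_sqrt.tendsto _).comp h1
    simpa [Function.comp_def] using this
  have hcau1 : CauchySeq fun n => (m1 n).toLp (x n).1 := by
    refine cauchySeq_of_le_tendsto_0 _ (fun a b M ha hb => ?_) hB
    refine Real.le_sqrt_of_sq_le ?_
    rw [dist_eq_norm, ← MemLp.toLp_sub, norm_toLp_sq]
    refine le_trans ?_ (hdist a b M ha hb)
    exact le_add_of_nonneg_right (integral_nonneg fun p => sq_nonneg _)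
  have hcau2 : CauchySeq fun n => (m2 n).toLp (x n).2 := by
    refine cauchySeq_of_le_tendsto_0 _ (fun a b M ha hb => ?_) hB
    refine Real.le_sqrt_of_sq_le ?_
    rw [dist_eq_norm, ← MemLp.toLp_sub, norm_toLp_sq]
    refine le_trans ?_ (hdist a b M ha hb)
    exact le_add_of_nonneg_left (integral_nonneg fun p => sq_nonneg _)
  obtain ⟨u, hu⟩ := cauchySeq_tendsto_of_complete hcau1
  obtain ⟨v, hv⟩ := cauchySeq_tendsto_of_complete hcau2
  have nsq : ∀ w : Lp ℝ 2 m, ‖w‖ ^ 2 = ∫ p, w p ^ 2 ∂m := fun w => by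
    rw [← norm_toLp_sq (Lp.memLp w), Lp.toLp_coeFn]
  have hae : ∀ (f : ℕ → X → ℝ) (hf : ∀ n, MemLp (f n) 2 m) (w : Lp ℝ 2 m),
      Tendsto (fun n => (hf n).toLp (f n)) atTop (𝓝 w) →
      ∃ φ : ℕ → ℕ, StrictMono φ ∧ ∀ᵐ p ∂m, Tendsto (fun n => f (φ n) p) atTop (𝓝 (w p)) := by
    intro f hf w hw
    obtain ⟨φ, hφ, h⟩ := (tendstoInMeasure_of_tendsto_Lp hw).exists_seq_tendsto_ae
    refine ⟨φ, hφ, ?_⟩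
    filter_upwards [h, ae_all_iff.2 fun n => (hf n).coeFn_toLp] with p h1 h2
    simpa only [h2] using h1
  obtain ⟨φ, hφ, hφae⟩ := hae _ m1 u hu
  obtain ⟨ψ, hψ, hψae⟩ := hae (fun n => (x (φ n)).2) (fun n => m2 _) v (hv.comp hφ.tendsto_atTop)
  have hlim := (hφ.comp hψ).tendsto_atTop
  -- Passing to subsequences only increases the index, and the sets decrease.
  have hle : ∀ n, n ≤ φ (ψ n) := (hφ.comp hψ).id_le
  refine ⟨fun n => x (φ (ψ n)), u, v, fun n => hanti (hle n) (hxK _), Lp.memLp u, Lp.memLp v,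
    ?_, hψae, ?_, ?_, ?_⟩
  · filter_upwards [hφae] with p hp using hp.comp hψ.tendsto_atTop
  · have h1 := (((tendsto_iff_norm_sub_tendsto_zero.1 hu).comp hlim).pow 2)
    simp only [ne_eq, OfNat.ofNat_ne_zero, not_false_eq_true, zero_pow] at h1
    refine h1.congr fun n => ?_
    simp only [Function.comp]
    rw [nsq]
    refine integral_congr_ae ?_
    filter_upwards [Lp.coeFn_sub ((m1 (φ (ψ n))).toLp _) u, (m1 (φ (ψ n))).coeFn_toLp] with p h2 h3
    rw [h2, Pi.sub_apply, h3]
  · rw [← nsq]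
    refine ((hu.norm.pow 2).comp hlim).congr fun n => ?_
    simp only [Function.comp]
    rw [norm_toLp_sq]
  · rw [← nsq]
    refine ((hv.norm.pow 2).comp hlim).congr fun n => ?_
    simp only [Function.comp]
    rw [norm_toLp_sq]

end Selection

/-- `L²` convergence together with a bound on the second moment gives `L¹` convergence. -/
theorem tendsto_integral_abs_of_sq {d : ℕ → E3 → ℝ} {C : ℝ} (h1 : ∀ n, Integrable (d n))
    (h2 : ∀ n, Integrable fun p => d n p ^ 2) (h3 : ∀ n, Integrable fun p => ‖p‖ ^ 2 * |d n p|)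
    (hC : ∀ n, ∫ p, ‖p‖ ^ 2 * |d n p| ≤ C)
    (hlim : Tendsto (fun n => ∫ p, d n p ^ 2) atTop (𝓝 0)) :
    Tendsto (fun n => ∫ p, |d n p|) atTop (𝓝 0) := by
  have hC0 : 0 ≤ C := (integral_nonneg fun p => by positivity).trans (hC 0)
  -- Inside the ball use |d| ≤ λd²/2 + 1/(2λ), outside it the second moment. Below, R is fixed
  -- first, then λ, then n.
  have key : ∀ (R lam : ℝ), 0 < R → 0 < lam → ∀ n, ∫ p, |d n p| ≤
      lam / 2 * (∫ p, d n p ^ 2) + volume.real (Metric.ball (0 : E3) R) / (2 * lam) + C / R ^ 2 := by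
    intro R lam hR hlam n
    have hA : MeasurableSet (Metric.ball (0 : E3) R) := measurableSet_ball
    have hi : Integrable ((Metric.ball (0 : E3) R).indicator fun _ => 1 / (2 * lam)) := by
      rw [integrable_indicator_iff hA]
      exact integrableOn_const measure_ball_lt_top.ne
    have j1 := (h2 n).const_mul (lam / 2)
    have j2 := (h3 n).const_mul (1 / R ^ 2)
    have hle : ∫ p, |d n p| ≤ ∫ p, (lam / 2 * d n p ^ 2 +
        (Metric.ball (0 : E3) R).indicator (fun _ => 1 / (2 * lam)) p +
        1 / R ^ 2 * (‖p‖ ^ 2 * |d n p|)) := by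
      refine integral_mono (h1 n).abs ((j1.add hi).add j2) fun p => ?_
      by_cases hp : p ∈ Metric.ball (0 : E3) R
      · simp only [Set.indicator_of_mem hp]
        have e : lam / 2 * d n p ^ 2 + 1 / (2 * lam) - |d n p| =
            1 / (2 * lam) * (lam * |d n p| - 1) ^ 2 := by
          rw [← sq_abs]; field_simp; ring
        have : 0 ≤ 1 / (2 * lam) * (lam * |d n p| - 1) ^ 2 := by positivity
        have : 0 ≤ 1 / R ^ 2 * (‖p‖ ^ 2 * |d n p|) := by positivity
        linarith
      · simp only [Set.indicator_of_notMem hp]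
        have hp' : R ≤ ‖p‖ := by simpa using hp
        have : 0 ≤ lam / 2 * d n p ^ 2 := by positivity
        have h4 : 1 ≤ 1 / R ^ 2 * ‖p‖ ^ 2 := by
          rw [one_div, ← div_eq_inv_mul, one_le_div (by positivity)]
          gcongr
        have := mul_le_mul_of_nonneg_right h4 (abs_nonneg (d n p))
        linarith
    refine hle.trans ?_
    rw [integral_add (f := fun p => lam / 2 * d n p ^ 2 +
        (Metric.ball (0 : E3) R).indicator (fun _ => 1 / (2 * lam)) p) (j1.add hi) j2,
      integral_add j1 hi, integral_const_mul, integral_const_mul, integral_indicator hA,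
      setIntegral_const, smul_eq_mul]
    have := hC n
    have e : 1 / R ^ 2 * ∫ p, ‖p‖ ^ 2 * |d n p| ≤ 1 / R ^ 2 * C := by gcongr
    have e2 : 1 / R ^ 2 * C = C / R ^ 2 := by ring
    have e3 : volume.real (Metric.ball (0 : E3) R) * (1 / (2 * lam)) =
        volume.real (Metric.ball (0 : E3) R) / (2 * lam) := by ring
    linarith
  rw [Metric.tendsto_atTop]
  intro ε hε
  obtain ⟨R, hR0, hR⟩ : ∃ R : ℝ, 0 < R ∧ C / R ^ 2 ≤ ε / 4 := by
    refine ⟨1 + 4 * C / ε, by positivity, ?_⟩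
    have h0 : 0 ≤ 4 * C / ε := by positivity
    rw [div_le_iff₀ (by positivity)]
    have h4 : 4 * C / ε * ε = 4 * C := by field_simp
    nlinarith [mul_nonneg h0 hε.le]
  set v := volume.real (Metric.ball (0 : E3) R)
  have hv : 0 ≤ v := measureReal_nonneg
  obtain ⟨lam, hl0, hl⟩ : ∃ lam : ℝ, 0 < lam ∧ v / (2 * lam) ≤ ε / 4 := by
    refine ⟨1 + 2 * v / ε, by positivity, ?_⟩
    rw [div_le_iff₀ (by positivity)]
    have : 2 * v / ε * ε = 2 * v := by field_simp
    nlinarith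
  obtain ⟨n0, hn0⟩ := (Metric.tendsto_atTop.1 hlim) (ε / (4 * lam)) (by positivity)
  refine ⟨n0, fun n hn => ?_⟩
  have h5 := hn0 n hn
  have h6 : 0 ≤ ∫ p, d n p ^ 2 := integral_nonneg fun p => sq_nonneg _
  have h7 : 0 ≤ ∫ p, |d n p| := integral_nonneg fun p => abs_nonneg _
  rw [Real.dist_eq, sub_zero, abs_of_nonneg h6] at h5
  rw [Real.dist_eq, sub_zero, abs_of_nonneg h7]
  have h8 := key R lam hR0 hl0 n
  have h9 : lam / 2 * (∫ p, d n p ^ 2) ≤ lam / 2 * (ε / (4 * lam)) := by gcongr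
  have h10 : lam / 2 * (ε / (4 * lam)) = ε / 8 := by field_simp; norm_num
  linarith

/-! ### Convexity and the penalised functional -/

/-- Admissible pairs with `γ`, and hence `α`, square integrable. -/
structure AdmSq (γ α : E3 → ℝ) : Prop extends Adm γ α where
  sq : Integrable fun p => γ p ^ 2

namespace AdmSq

variable {γ α γ' α' : E3 → ℝ}

theorem memLp_gamma (h : AdmSq γ α) : MemLp γ 2 :=
  (memLp_two_iff_integrable_sq h.meas_gamma).2 h.sq

theorem memLp_alpha (h : AdmSq γ α) : MemLp α 2 := by
  refine (memLp_two_iff_integrable_sq h.meas).2 ?_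
  refine (h.int_gamma.add h.sq).mono' (h.meas.pow 2) ?_
  filter_upwards [h.dom] with p hp
  rw [Real.norm_of_nonneg (sq_nonneg _)]
  simp only [Pi.add_apply]
  linarith [hp.2]

theorem zero : AdmSq (fun _ => 0) (fun _ => 0) := ⟨Adm.zero, by simp⟩

theorem mix (h : AdmSq γ α) (h' : AdmSq γ' α') {t : ℝ} (h0 : 0 ≤ t) (h1 : t ≤ 1) :
    AdmSq (fun p => (1 - t) * γ p + t * γ' p) (fun p => (1 - t) * α p + t * α' p) :=
  ⟨h.toAdm.mix h'.toAdm h0 h1,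
    ((h.memLp_gamma.const_mul (1 - t)).add (h'.memLp_gamma.const_mul t)).integrable_sq⟩

theorem piecewise (h : AdmSq γ α) (h' : AdmSq γ' α') {A : Set E3} (hA : MeasurableSet A)
    [DecidablePred (· ∈ A)] : AdmSq (A.piecewise γ γ') (A.piecewise α α') := by
  refine ⟨h.toAdm.piecewise h'.toAdm hA, ?_⟩
  refine (Integrable.piecewise hA h.sq.integrableOn h'.sq.integrableOn).congr
    (Eventually.of_forall fun p => ?_)
  by_cases hp : p ∈ A <;> simp [hp]

end AdmSq

/-- The energy with a quadratic penalty. -/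
def penEnergy (U : E3 → ℝ) (T μ r ε : ℝ) (γ α : E3 → ℝ) : ℝ :=
  energy U T μ γ α r + ε * (cst * ((∫ p, γ p ^ 2) + ∫ p, α p ^ 2))

/-- Minimizers of the penalised energy among square integrable admissible pairs. -/
structure IsPenMin (U : E3 → ℝ) (T μ r ε : ℝ) (γ α : E3 → ℝ) : Prop extends AdmSq γ α where
  le : ∀ γ' α', AdmSq γ' α' → penEnergy U T μ r ε γ α ≤ penEnergy U T μ r ε γ' α'

theorem integral_mix {X : Type*} [MeasurableSpace X] {m : Measure X} {f g : X → ℝ}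
    (hf : Integrable f m) (hg : Integrable g m) (t : ℝ) :
    ∫ p, ((1 - t) * f p + t * g p) ∂m = (1 - t) * (∫ p, f p ∂m) + t * ∫ p, g p ∂m := by
  rw [integral_add (hf.const_mul _) (hg.const_mul _), integral_const_mul, integral_const_mul]

theorem integral_mul_mix {X : Type*} [MeasurableSpace X] {m : Measure X} {w f g : X → ℝ}
    (hf : Integrable (fun p => w p * f p) m) (hg : Integrable (fun p => w p * g p) m) (t : ℝ) :
    ∫ p, w p * ((1 - t) * f p + t * g p) ∂m =
      (1 - t) * (∫ p, w p * f p ∂m) + t * ∫ p, w p * g p ∂m := by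
  rw [← integral_mix hf hg]
  congr 1
  ext p
  ring

theorem integral_mix_sq {X : Type*} [MeasurableSpace X] {m : Measure X} {f g : X → ℝ}
    (hf : MemLp f 2 m) (hg : MemLp g 2 m) (t : ℝ) :
    ∫ p, ((1 - t) * f p + t * g p) ^ 2 ∂m = (1 - t) * (∫ p, f p ^ 2 ∂m) + t * (∫ p, g p ^ 2 ∂m) -
      t * (1 - t) * ∫ p, (f p - g p) ^ 2 ∂m := by
  have i3 : Integrable (fun p => (f p - g p) ^ 2) m := (hf.sub hg).integrable_sq
  rw [← integral_mix hf.integrable_sq hg.integrable_sq, ← integral_const_mul,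
    ← integral_sub (f := fun p => (1 - t) * f p ^ 2 + t * g p ^ 2)
      ((hf.integrable_sq.const_mul _).add (hg.integrable_sq.const_mul _)) (i3.const_mul _)]
  congr 1
  ext p
  ring

/-! ### Convexity at fixed condensate density, and existence for the penalised problem. -/

namespace IsPotential

variable {U : E3 → ℝ} (hU : IsPotential U)
include hU

/-- Expansion of the energy along a segment. -/
theorem energy_mix_le {T : ℝ} (hT : 0 < T) (μ r : ℝ) {γ α γ' α' : E3 → ℝ} (h : Adm γ α)
    (h' : Adm γ' α') {t : ℝ} (h0 : 0 ≤ t) (h1 : t ≤ 1) :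
    energy U T μ (fun p => (1 - t) * γ p + t * γ' p) (fun p => (1 - t) * α p + t * α' p) r ≤
      (1 - t) * energy U T μ γ α r + t * energy U T μ γ' α' r - t * (1 - t) *
        (U 0 / 2 * (cst * ((∫ p, γ' p) - ∫ p, γ p)) ^ 2 + 1 / 2 * cst ^ 2 *
          ((dbl U α α - 2 * dbl U α α' + dbl U α' α') +
            (dbl U γ γ - 2 * dbl U γ γ' + dbl U γ' γ'))) := by
  have c0 := cst_pos
  have hm := h.mix h' h0 h1
  have hS : (1 - t) * (∫ p, sDens (γ p) (α p)) + t * (∫ p, sDens (γ' p) (α' p)) ≤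
      ∫ p, sDens ((1 - t) * γ p + t * γ' p) ((1 - t) * α p + t * α' p) := by
    rw [← integral_mix h.int_sDens h'.int_sDens]
    refine integral_mono_ae ((h.int_sDens.const_mul _).add (h'.int_sDens.const_mul _))
      hm.int_sDens ?_
    filter_upwards [h.dom, h'.dom] with p a b using a.le_sDens_mix b h0 h1
  have hS' := mul_le_mul_of_nonneg_left hS (show 0 ≤ T * cst by positivity)
  unfold energy
  rw [integral_mul_mix h.int_kin h'.int_kin, integral_mix h.int_gamma h'.int_gamma,
    integral_mul_mix (hU.integrable_mul h.ctl_gamma) (hU.integrable_mul h'.ctl_gamma),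
    integral_mul_mix (hU.integrable_mul h.ctl_alpha) (hU.integrable_mul h'.ctl_alpha),
    hU.dbl_quad_mix h.ctl_gamma h'.ctl_gamma, hU.dbl_quad_mix h.ctl_alpha h'.ctl_alpha]
  linarith

/-- The defect along the segment is a sum of a square and two nonnegative forms. The condensate
density is held fixed, since its coupling to the state is bilinear. -/
theorem energy_mix_convex {T : ℝ} (hT : 0 < T) (μ r : ℝ) {γ α γ' α' : E3 → ℝ} (h : Adm γ α)
    (h' : Adm γ' α') {t : ℝ} (h0 : 0 ≤ t) (h1 : t ≤ 1) :
    energy U T μ (fun p => (1 - t) * γ p + t * γ' p) (fun p => (1 - t) * α p + t * α' p) r ≤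
      (1 - t) * energy U T μ γ α r + t * energy U T μ γ' α' r := by
  refine (hU.energy_mix_le hT μ r h h' h0 h1).trans (sub_le_self _ ?_)
  have a1 := hU.dbl_le_add h.ctl_alpha h'.ctl_alpha
  have a2 := hU.dbl_le_add h.ctl_gamma h'.ctl_gamma
  have u0 := hU.pos_zero.le
  refine mul_nonneg (mul_nonneg h0 (sub_nonneg.2 h1)) (add_nonneg (by positivity) ?_)
  exact mul_nonneg (by positivity) (by linarith)

/-- Strong convexity from the penalty: it yields uniqueness of the minimizer, and hence radial
symmetry. -/
theorem penEnergy_mix_le {T : ℝ} (hT : 0 < T) (μ r ε : ℝ) {γ α γ' α' : E3 → ℝ} (h : AdmSq γ α)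
    (h' : AdmSq γ' α') {t : ℝ} (h0 : 0 ≤ t) (h1 : t ≤ 1) :
    penEnergy U T μ r ε (fun p => (1 - t) * γ p + t * γ' p)
        (fun p => (1 - t) * α p + t * α' p) ≤
      (1 - t) * penEnergy U T μ r ε γ α + t * penEnergy U T μ r ε γ' α' -
        t * (1 - t) * (ε * (cst * ((∫ p, (γ p - γ' p) ^ 2) + ∫ p, (α p - α' p) ^ 2))) := by
  have := hU.energy_mix_convex hT μ r h.toAdm h'.toAdm h0 h1
  unfold penEnergy
  rw [integral_mix_sq h.memLp_gamma h'.memLp_gamma, integral_mix_sq h.memLp_alpha h'.memLp_alpha]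
  linarith

/-- The penalised functional has a minimizer. -/
theorem exists_isPenMin {T : ℝ} (hT : 0 < T) (μ : ℝ) {r ε : ℝ} (hr : 0 ≤ r) (hε : 0 < ε) :
    ∃ γ α, IsPenMin U T μ r ε γ α := by
  have c0 := cst_pos
  obtain ⟨K₀, hK₀⟩ := hU.exists_coercive hT μ
  have hlow : ∀ γ α, Adm γ α → -K₀ ≤ energy U T μ γ α r := fun γ α h => by
    have h1 := hK₀ γ α r h hr
    have h2 : 0 ≤ cst / 2 * (∫ p, ‖p‖ ^ 2 * γ p) := mul_nonneg (by positivity) h.kin_nonneg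
    have h3 : 0 ≤ U 0 / 4 * (r + cst * ∫ p, γ p) ^ 2 :=
      mul_nonneg (by have := hU.pos_zero; positivity) (sq_nonneg _)
    linarith
  have hpen0 : ∀ γ α : E3 → ℝ, 0 ≤ (∫ p, γ p ^ 2) + ∫ p, α p ^ 2 := fun γ α =>
    add_nonneg (integral_nonneg fun p => sq_nonneg _) (integral_nonneg fun p => sq_nonneg _)
  set V : Set ℝ := {e | ∃ γ α, AdmSq γ α ∧ penEnergy U T μ r ε γ α = e} with hV
  have hVne : V.Nonempty := ⟨_, _, _, AdmSq.zero, rfl⟩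
  have hVbdd : BddBelow V := ⟨-K₀, by
    rintro _ ⟨γ, α, h, rfl⟩
    have h1 := hlow γ α h.toAdm
    have h2 : 0 ≤ ε * (cst * ((∫ p, γ p ^ 2) + ∫ p, α p ^ 2)) :=
      mul_nonneg hε.le (mul_nonneg c0.le (hpen0 γ α))
    unfold penEnergy
    linarith⟩
  set I := sInf V with hI
  -- Sublevel sets decreasing to the infimum. They are convex, and the penalty itself bounds their
  -- L² norms, so a strongly convergent selection exists.
  set K : ℕ → Set ((E3 → ℝ) × (E3 → ℝ)) := fun n =>
    {x | AdmSq x.1 x.2 ∧ penEnergy U T μ r ε x.1 x.2 ≤ I + 1 / ((n : ℝ) + 1)} with hK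
  have hanti : Antitone K := fun a b hab x hx => ⟨hx.1, hx.2.trans (by gcongr)⟩
  have hone : ∀ n : ℕ, 1 / ((n : ℝ) + 1) ≤ 1 := fun n => by
    rw [div_le_one (by positivity)]
    linarith [(Nat.cast_nonneg n : (0 : ℝ) ≤ n)]
  have hbd : ∀ n, ∃ x ∈ K n, (∫ p, x.1 p ^ 2) + ∫ p, x.2 p ^ 2 ≤ (I + 1 + K₀) / (ε * cst) := by
    intro n
    obtain ⟨_, ⟨γ, α, h, rfl⟩, hlt⟩ := exists_lt_of_csInf_lt hVne
      (show sInf V < I + 1 / ((n : ℝ) + 1) by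
        have : (0 : ℝ) < 1 / ((n : ℝ) + 1) := by positivity
        linarith)
    refine ⟨(γ, α), ⟨h, hlt.le⟩, ?_⟩
    rw [le_div_iff₀ (by positivity)]
    have h1 := hlow γ α h.toAdm
    have h2 := hone n
    unfold penEnergy at hlt
    linarith
  have hmid : ∀ n, ∀ x ∈ K n, ∀ y ∈ K n, ((fun p => (1 - 1 / 2) * x.1 p + 1 / 2 * y.1 p,
      fun p => (1 - 1 / 2) * x.2 p + 1 / 2 * y.2 p) : (E3 → ℝ) × (E3 → ℝ)) ∈ K n := by
    rintro n x ⟨hx, hx'⟩ y ⟨hy, hy'⟩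
    refine ⟨hx.mix hy (by norm_num) (by norm_num), ?_⟩
    refine (hU.penEnergy_mix_le hT μ r ε hx hy (by norm_num) (by norm_num)).trans ?_
    have : 0 ≤ ε * (cst * ((∫ p, (x.1 p - y.1 p) ^ 2) + ∫ p, (x.2 p - y.2 p) ^ 2)) :=
      mul_nonneg hε.le (mul_nonneg c0.le
        (add_nonneg (integral_nonneg fun p => sq_nonneg _) (integral_nonneg fun p => sq_nonneg _)))
    linarith
  obtain ⟨x, u, v, hxK, hu, hv, aeu, aev, hL2, hnu, hnv⟩ := exists_seq_tendsto_of_nested K hanti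
    (fun n x hx => ⟨hx.1.memLp_gamma, hx.1.memLp_alpha⟩) hbd hmid
  have hadm : ∀ n, AdmSq (x n).1 (x n).2 := fun n => (hxK n).1
  have hEx : ∀ n, energy U T μ (x n).1 (x n).2 r ≤ I + 1 / ((n : ℝ) + 1) -
      ε * (cst * ((∫ p, (x n).1 p ^ 2) + ∫ p, (x n).2 p ^ 2)) := fun n => by
    have := (hxK n).2
    unfold penEnergy at this
    linarith
  obtain ⟨C, hC0, hC⟩ := hU.exists_sublevel_bound hT μ (I + 1)
  have hCn : ∀ n, ∫ p, (x n).1 p ≤ C ∧ ∫ p, ‖p‖ ^ 2 * (x n).1 p ≤ C := fun n => by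
    refine (hC _ _ r (hadm n).toAdm hr ((hEx n).trans ?_)).2
    have h1 := hone n
    have h2 := mul_nonneg hε.le (mul_nonneg c0.le (hpen0 (x n).1 (x n).2))
    linarith
  have hu1 := integrable_of_tendsto_of_integral_le (fun n => (hadm n).int_gamma)
    (fun n => (hadm n).nonneg) aeu fun n => (hCn n).1
  have hu2 := integrable_of_tendsto_of_integral_le (f := fun n p => ‖p‖ ^ 2 * (x n).1 p)
    (F := fun p => ‖p‖ ^ 2 * u p) (fun n => (hadm n).int_kin)
    (fun n => by
      filter_upwards [(hadm n).nonneg] with p hp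
      exact mul_nonneg (by positivity) hp)
    (by filter_upwards [aeu] with p hp using hp.const_mul _) fun n => (hCn n).2
  have hu0 : ∀ᵐ p, 0 ≤ u p := by
    filter_upwards [aeu, ae_all_iff.2 fun n => (hadm n).nonneg] with p h1 h2
    exact ge_of_tendsto' h1 h2
  have hL1 : Tendsto (fun n => ∫ p, |(x n).1 p - u p|) atTop (𝓝 0) := by
    have hdom : ∀ n, ∀ᵐ p, ‖‖p‖ ^ 2 * |(x n).1 p - u p|‖ ≤
        ‖p‖ ^ 2 * (x n).1 p + ‖p‖ ^ 2 * u p := fun n => by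
      filter_upwards [(hadm n).nonneg, hu0] with p h1 h2
      rw [Real.norm_of_nonneg (by positivity), ← mul_add]
      refine mul_le_mul_of_nonneg_left ?_ (by positivity)
      exact (abs_sub _ _).trans_eq (by rw [abs_of_nonneg h1, abs_of_nonneg h2])
    have hi : ∀ n, Integrable fun p => ‖p‖ ^ 2 * |(x n).1 p - u p| := fun n => by
      refine ((hadm n).int_kin.add hu2.1).mono' ?_ (hdom n)
      exact (continuous_norm.pow 2).aestronglyMeasurable.mul
        ((hadm n).int_gamma.sub hu1.1).abs.aestronglyMeasurable
    refine tendsto_integral_abs_of_sq (C := C + C) (fun n => (hadm n).int_gamma.sub hu1.1)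
      (fun n => ((hadm n).memLp_gamma.sub hu).integrable_sq) hi (fun n => ?_) hL2
    refine (integral_mono_ae (hi n) ((hadm n).int_kin.add hu2.1) ?_).trans ?_
    · filter_upwards [hdom n] with p hp using (le_abs_self _).trans hp
    · exact (integral_add (hadm n).int_kin hu2.1).trans_le (add_le_add (hCn n).2 hu2.2)
  -- The penalty is moved to the bounding sequence. Its convergence, from that of the L² norms,
  -- reduces the claim to semicontinuity of the unpenalised energy.
  obtain ⟨hAdm, hle⟩ := hU.energy_le_of_tendsto hT μ (fun n => (hadm n).toAdm) (fun _ => hr) aeu aev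
    tendsto_const_nhds hL1 (fun n => (hCn n).1) (fun n => (hCn n).2)
    (B := I + 0 - ε * (cst * ((∫ p, u p ^ 2) + ∫ p, v p ^ 2)))
    ((tendsto_one_div_add_atTop_nhds_zero_nat.const_add I).sub
      (((hnu.add hnv).const_mul cst).const_mul ε)) hEx
  refine ⟨u, v, ⟨⟨hAdm, hu.integrable_sq⟩, fun γ' α' h' => ?_⟩⟩
  have h1 : I ≤ penEnergy U T μ r ε γ' α' := csInf_le hVbdd ⟨γ', α', h', rfl⟩
  refine le_trans ?_ h1
  unfold penEnergy
  linarith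

end IsPotential

/-- The penalised minimizer is unique. -/
theorem IsPenMin.ae_eq {U : E3 → ℝ} (hU : IsPotential U) {T μ r ε : ℝ} (hT : 0 < T) (hε : 0 < ε)
    {γ α γ' α' : E3 → ℝ} (h : IsPenMin U T μ r ε γ α) (h' : IsPenMin U T μ r ε γ' α') :
    γ =ᵐ[volume] γ' ∧ α =ᵐ[volume] α' := by
  have h1 := hU.penEnergy_mix_le hT μ r ε h.toAdmSq h'.toAdmSq (t := 1 / 2) (by norm_num)
    (by norm_num)
  have h2 := h.le _ _ (h.toAdmSq.mix h'.toAdmSq (t := 1 / 2) (by norm_num) (by norm_num))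
  have h3 := h'.le _ _ h.toAdmSq
  have hεc : 0 < ε * cst := mul_pos hε cst_pos
  have i1 : 0 ≤ ∫ p, (γ p - γ' p) ^ 2 := integral_nonneg fun p => sq_nonneg _
  have i2 : 0 ≤ ∫ p, (α p - α' p) ^ 2 := integral_nonneg fun p => sq_nonneg _
  have hsum : (ε * cst) * ((∫ p, (γ p - γ' p) ^ 2) + ∫ p, (α p - α' p) ^ 2) ≤ 0 := by
    linarith
  have hsum' : (∫ p, (γ p - γ' p) ^ 2) + ∫ p, (α p - α' p) ^ 2 ≤ 0 := by
    by_contra hcon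
    exact absurd hsum (not_le.2 (mul_pos hεc (not_le.1 hcon)))
  have aux : ∀ {f g : E3 → ℝ}, MemLp f 2 → MemLp g 2 → ∫ p, (f p - g p) ^ 2 = 0 →
      f =ᵐ[volume] g := by
    intro f g hf hg h0
    have := (integral_eq_zero_iff_of_nonneg (fun p => sq_nonneg (f p - g p))
      (hf.sub hg).integrable_sq).1 h0
    filter_upwards [this] with p hp
    exact sub_eq_zero.1 (pow_eq_zero_iff two_ne_zero |>.1 hp)
  exact ⟨aux h.memLp_gamma h'.memLp_gamma (by linarith),
    aux h.memLp_alpha h'.memLp_alpha (by linarith)⟩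

/-! ### Rotation invariance -/

section Rotation

variable (R : E3 ≃ₗᵢ[ℝ] E3)

theorem integral_comp_isometry (f : E3 → ℝ) : ∫ p, f (R p) = ∫ p, f p :=
  R.measurePreserving.integral_comp R.toHomeomorph.measurableEmbedding f

theorem ae_comp_isometry {P : E3 → Prop} (h : ∀ᵐ p, P p) : ∀ᵐ p, P (R p) :=
  R.measurePreserving.quasiMeasurePreserving.ae h

theorem AdmSq.comp_isometry {γ α : E3 → ℝ} (h : AdmSq γ α) :
    AdmSq (fun p => γ (R p)) (fun p => α (R p)) := by
  have hR := R.measurePreserving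
  refine ⟨⟨?_, ae_comp_isometry R h.dom, h.meas.comp_measurePreserving hR⟩, ?_⟩
  · have := (hR.integrable_comp_emb R.toHomeomorph.measurableEmbedding).2 h.int
    refine this.congr (Eventually.of_forall fun p => ?_)
    simp
  · exact (hR.integrable_comp_emb R.toHomeomorph.measurableEmbedding).2 h.sq

theorem dbl_comp_isometry {U : E3 → ℝ} (hU : IsPotential U) (φ : E3 → ℝ) :
    dbl U (fun p => φ (R p)) (fun p => φ (R p)) = dbl U φ φ := by
  unfold dbl
  have hR := R.measurePreserving.prod R.measurePreserving
  rw [← hR.integral_comp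
    (R.toHomeomorph.prodCongr R.toHomeomorph).measurableEmbedding
    (fun z : E3 × E3 => U (z.1 - z.2) * (φ z.1 * φ z.2))]
  congr 1
  ext z
  simp only [Prod.map_fst, Prod.map_snd, ← map_sub]
  rw [hU.radial (R (z.1 - z.2)) (z.1 - z.2) (R.norm_map _)]

theorem penEnergy_comp_isometry {U : E3 → ℝ} (hU : IsPotential U) (T μ r ε : ℝ) (γ α : E3 → ℝ) :
    penEnergy U T μ r ε (fun p => γ (R p)) (fun p => α (R p)) = penEnergy U T μ r ε γ α := by
  have hUR : ∀ p, U p = U (R p) := fun p => hU.radial _ _ (R.norm_map p).symm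
  have e1 : ∫ p, ‖p‖ ^ 2 * γ (R p) = ∫ p, ‖p‖ ^ 2 * γ p := by
    rw [← integral_comp_isometry R fun p => ‖p‖ ^ 2 * γ p]
    simp
  have e2 : ∀ f : E3 → ℝ, ∫ p, U p * f (R p) = ∫ p, U p * f p := fun f => by
    rw [← integral_comp_isometry R fun p => U p * f p]
    simp only [← hUR]
  unfold penEnergy energy
  rw [e1, e2, e2, dbl_comp_isometry R hU, dbl_comp_isometry R hU, integral_comp_isometry R γ,
    integral_comp_isometry R fun p => sDens (γ p) (α p), integral_comp_isometry R fun p => γ p ^ 2,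
    integral_comp_isometry R fun p => α p ^ 2]

theorem IsPenMin.comp_isometry {U : E3 → ℝ} (hU : IsPotential U) {T μ r ε : ℝ} {γ α : E3 → ℝ}
    (h : IsPenMin U T μ r ε γ α) : IsPenMin U T μ r ε (fun p => γ (R p)) (fun p => α (R p)) :=
  ⟨h.toAdmSq.comp_isometry R, fun γ' α' h' =>
    (penEnergy_comp_isometry R hU T μ r ε γ α).trans_le (h.le γ' α' h')⟩

theorem conv_comp_isometry {U : E3 → ℝ} (hU : IsPotential U) {φ : E3 → ℝ}
    (hφ : (fun p => φ (R p)) =ᵐ[volume] φ) (p : E3) : conv U φ (R p) = conv U φ p := by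
  unfold conv
  rw [← integral_comp_isometry R]
  refine integral_congr_ae ?_
  filter_upwards [hφ] with q hq
  rw [hq, ← map_sub, hU.radial (R (p - q)) (p - q) (R.norm_map _)]

end Rotation

theorem exists_isometry_eq {p q : E3} (h : ‖p‖ = ‖q‖) : ∃ R : E3 ≃ₗᵢ[ℝ] E3, R p = q :=
  ⟨(ℝ ∙ (p - q))ᗮ.reflection, Submodule.reflection_sub h⟩

/-- The mean fields of a penalised minimizer are radial. -/
theorem IsPenMin.isRadial_conv {U : E3 → ℝ} (hU : IsPotential U) {T μ r ε : ℝ} (hT : 0 < T)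
    (hε : 0 < ε) {γ α : E3 → ℝ} (h : IsPenMin U T μ r ε γ α) :
    IsRadial (conv U γ) ∧ IsRadial (conv U α) := by
  constructor
  all_goals
    intro p q hpq
    obtain ⟨R, rfl⟩ := exists_isometry_eq hpq
    symm
    refine conv_comp_isometry R hU ?_ p
  · exact ((h.comp_isometry R hU).ae_eq hU hT hε h).1
  · exact ((h.comp_isometry R hU).ae_eq hU hT hε h).2

/-! ### The variational inequality for penalised minimizers -/

/-- `f` is integrable with integral `a`. -/
def HasInt (f : E3 → ℝ) (a : ℝ) : Prop := Integrable f ∧ ∫ p, f p = a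

namespace HasInt

variable {f g : E3 → ℝ} {a b : ℝ}

theorem of_integrable (h : Integrable f) : HasInt f (∫ p, f p) := ⟨h, rfl⟩

theorem add (h : HasInt f a) (h' : HasInt g b) : HasInt (fun p => f p + g p) (a + b) :=
  ⟨h.1.add h'.1, by rw [integral_add h.1 h'.1, h.2, h'.2]⟩

theorem sub (h : HasInt f a) (h' : HasInt g b) : HasInt (fun p => f p - g p) (a - b) :=
  ⟨h.1.sub h'.1, by rw [integral_sub h.1 h'.1, h.2, h'.2]⟩

theorem const_mul (h : HasInt f a) (k : ℝ) : HasInt (fun p => k * f p) (k * a) :=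
  ⟨h.1.const_mul k, by rw [integral_const_mul, h.2]⟩

end HasInt

/-- The coefficient of `γ(p)` in the linearised energy. -/
def fieldE (U : E3 → ℝ) (μ r : ℝ) (γ : E3 → ℝ) (p : E3) : ℝ :=
  ‖p‖ ^ 2 - μ + U 0 * (r + cst * ∫ q, γ q) + cst * conv U γ p + r * U p

/-- The coefficient of `α(p)` in the linearised energy. -/
def fieldW (U : E3 → ℝ) (r : ℝ) (α : E3 → ℝ) (p : E3) : ℝ := cst * conv U α p + r * U p

/-- The density of the first variation of the penalised energy at `(γ, α)` towards `(γ', α')`. -/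
def firstVar (U : E3 → ℝ) (T μ r ε : ℝ) (γ α γ' α' : E3 → ℝ) (p : E3) : ℝ :=
  fieldE U μ r γ p * (γ' p - γ p) + fieldW U r α p * (α' p - α p)
    + 2 * ε * (γ p * (γ' p - γ p) + α p * (α' p - α p))
    - T * (sDens (γ' p) (α' p) - sDens (γ p) (α p))

namespace IsPotential

variable {U : E3 → ℝ} (hU : IsPotential U)
include hU

/-- Term by term integration, tracking integrability with the value. The convolution terms become
values of the bilinear form by Fubini. -/
theorem hasInt_firstVar (T μ r ε : ℝ) {γ α γ' α' : E3 → ℝ} (h : AdmSq γ α) (h' : AdmSq γ' α') :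
    HasInt (firstVar U T μ r ε γ α γ' α')
      (((∫ p, ‖p‖ ^ 2 * γ' p) - ∫ p, ‖p‖ ^ 2 * γ p)
        + (-μ + U 0 * (r + cst * ∫ q, γ q)) * ((∫ p, γ' p) - ∫ p, γ p)
        + cst * (dbl U γ' γ - dbl U γ γ) + r * ((∫ p, U p * γ' p) - ∫ p, U p * γ p)
        + cst * (dbl U α' α - dbl U α α) + r * ((∫ p, U p * α' p) - ∫ p, U p * α p)
        + 2 * ε * (((∫ p, γ p * γ' p) - ∫ p, γ p ^ 2) + ((∫ p, α p * α' p) - ∫ p, α p ^ 2))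
        - T * ((∫ p, sDens (γ' p) (α' p)) - ∫ p, sDens (γ p) (α p))) := by
  have a1 := (HasInt.of_integrable h'.int_kin).sub (.of_integrable h.int_kin)
  have a2 := ((HasInt.of_integrable h'.int_gamma).sub (.of_integrable h.int_gamma)).const_mul
    (-μ + U 0 * (r + cst * ∫ q, γ q))
  have conv_int : ∀ {φ ψ g k : E3 → ℝ}, Ctl φ g → Ctl ψ k →
      HasInt (fun p => φ p * conv U ψ p) (dbl U φ ψ) := fun hφ hψ =>
    ⟨hU.integrable_mul_conv hφ hψ, (hU.dbl_eq_integral hφ hψ).symm⟩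
  have a3 := ((conv_int h'.ctl_gamma h.ctl_gamma).sub
    (conv_int h.ctl_gamma h.ctl_gamma)).const_mul cst
  have a4 := ((HasInt.of_integrable (hU.integrable_mul h'.ctl_gamma)).sub
    (.of_integrable (hU.integrable_mul h.ctl_gamma))).const_mul r
  have a5 := ((conv_int h'.ctl_alpha h.ctl_alpha).sub
    (conv_int h.ctl_alpha h.ctl_alpha)).const_mul cst
  have a6 := ((HasInt.of_integrable (hU.integrable_mul h'.ctl_alpha)).sub
    (.of_integrable (hU.integrable_mul h.ctl_alpha))).const_mul r
  have a7 := (((HasInt.of_integrable (h.memLp_gamma.integrable_mul h'.memLp_gamma)).sub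
    (.of_integrable h.sq)).add
    ((HasInt.of_integrable (h.memLp_alpha.integrable_mul h'.memLp_alpha)).sub
    (.of_integrable h.memLp_alpha.integrable_sq))).const_mul (2 * ε)
  have a8 := ((HasInt.of_integrable h'.int_sDens).sub (.of_integrable h.int_sDens)).const_mul T
  have := ((((((a1.add a2).add a3).add a4).add a5).add a6).add a7).sub a8
  simp only [Pi.mul_apply] at this
  convert this using 1
  ext p
  unfold firstVar fieldE fieldW
  ring

/-- One-sided variation towards a competitor. The entropy enters as a difference rather than a
derivative, which is infinite at β = 1/2; concavity makes this legitimate. -/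
theorem integral_firstVar_nonneg {T : ℝ} (hT : 0 < T) {μ r ε : ℝ} {γ α γ' α' : E3 → ℝ}
    (h : IsPenMin U T μ r ε γ α) (h' : AdmSq γ' α') :
    0 ≤ ∫ p, firstVar U T μ r ε γ α γ' α' p := by
  have c0 := cst_pos
  -- The quadratic part of the penalised energy evaluated at the difference of the two states.
  -- Subtracting it from the energy increment leaves exactly the linear terms and the entropy
  -- difference.
  set q := U 0 / 2 * (cst * ((∫ p, γ' p) - ∫ p, γ p)) ^ 2 + 1 / 2 * cst ^ 2 *
          ((dbl U α α - 2 * dbl U α α' + dbl U α' α') +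
            (dbl U γ γ - 2 * dbl U γ γ' + dbl U γ' γ')) +
        ε * (cst * ((∫ p, (γ p - γ' p) ^ 2) + ∫ p, (α p - α' p) ^ 2)) with hq
  have key : ∀ t : ℝ, 0 < t → t ≤ 1 → penEnergy U T μ r ε γ α ≤
      penEnergy U T μ r ε γ' α' - (1 - t) * q := by
    intro t h0 h1
    have b1 := h.le _ _ (h.toAdmSq.mix h' h0.le h1)
    have b2 := hU.energy_mix_le hT μ r h.toAdm h'.toAdm h0.le h1
    unfold penEnergy at b1 ⊢
    rw [integral_mix_sq h.memLp_gamma h'.memLp_gamma,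
      integral_mix_sq h.memLp_alpha h'.memLp_alpha] at b1
    have b3 := b1.trans (add_le_add b2 le_rfl)
    refine le_of_mul_le_mul_left ?_ h0
    rw [hq]
    linarith
  have lim : penEnergy U T μ r ε γ α ≤ penEnergy U T μ r ε γ' α' - q := by
    refine le_of_forall_pos_le_add fun η hη => ?_
    have h1 : 0 < η / (|q| + 1 + η) := by positivity
    have h2 : η / (|q| + 1 + η) ≤ 1 := by
      rw [div_le_one (by positivity)]
      linarith [abs_nonneg q]
    refine (key _ h1 h2).trans ?_
    have h3 : η / (|q| + 1 + η) * q ≤ η / (|q| + 1 + η) * (|q| + 1 + η) :=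
      mul_le_mul_of_nonneg_left (by linarith [le_abs_self q]) h1.le
    have h4 : η / (|q| + 1 + η) * (|q| + 1 + η) = η := by
      have : |q| + 1 + η ≠ 0 := by positivity
      field_simp
    linarith
  have expand : ∀ {f g : E3 → ℝ}, MemLp f 2 → MemLp g 2 →
      ∫ p, (f p - g p) ^ 2 = (∫ p, f p ^ 2) - 2 * (∫ p, f p * g p) + ∫ p, g p ^ 2 := by
    intro f g hf hg
    have := (((HasInt.of_integrable hf.integrable_sq).sub
      ((HasInt.of_integrable (hf.integrable_mul hg)).const_mul 2)).add
      (HasInt.of_integrable hg.integrable_sq)).2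
    simp only [Pi.mul_apply] at this
    rw [← this]
    congr 1
    ext p
    ring
  rw [(hU.hasInt_firstVar T μ r ε h.toAdmSq h').2, hU.dbl_comm γ' γ, hU.dbl_comm α' α]
  refine nonneg_of_mul_nonneg_right (b := _) (a := cst) ?_ c0
  rw [hq, expand h.memLp_gamma h'.memLp_gamma, expand h.memLp_alpha h'.memLp_alpha] at lim
  unfold penEnergy energy at lim
  linarith

/-- The pointwise first-order condition. -/
theorem ae_firstVar_nonneg {T : ℝ} (hT : 0 < T) {μ r ε : ℝ} {γ α γ' α' : E3 → ℝ}
    (h : IsPenMin U T μ r ε γ α) (h' : AdmSq γ' α') :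
    ∀ᵐ p, 0 ≤ firstVar U T μ r ε γ α γ' α' p := by
  classical
  refine ae_nonneg_of_forall_setIntegral_nonneg
    (hU.hasInt_firstVar T μ r ε h.toAdmSq h').1 fun A hA _ => ?_
  -- Switching to the competitor only on `A` makes the density vanish off `A`, so all its set
  -- integrals are nonnegative.
  have h1 := hU.integral_firstVar_nonneg hT h (h'.piecewise h.toAdmSq hA)
  rw [← integral_indicator hA]
  refine h1.trans_eq ?_
  congr 1
  ext p
  by_cases hp : p ∈ A <;> simp [hp, firstVar]

/-- Where the gap `e - |w|` is bounded below, `γ` is bounded above. -/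
theorem ae_gamma_le {T : ℝ} (hT : 0 < T) {μ r ε : ℝ} (hε : 0 ≤ ε) {γ α : E3 → ℝ}
    (h : IsPenMin U T μ r ε γ α) {η : ℝ} (hη : 0 < η) :
    ∀ᵐ p, η ≤ fieldE U μ r γ p - |fieldW U r α p| →
      γ p ≤ |fieldW U r α p| / η + 16 * T ^ 3 / η ^ 3 := by
  filter_upwards [hU.ae_firstVar_nonneg hT h AdmSq.zero, h.dom] with p hp hd hgap
  unfold firstVar at hp
  rw [sDens_zero] at hp
  set e := fieldE U μ r γ p
  set w := fieldW U r α p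
  -- The competitor is the zero state. With this x the entropy costs only half of the gap ηγ, and
  -- the other half bounds γ.
  have h1 := hd.sDens_le (x := η / (2 * T)) (by positivity)
  have h2 := mul_le_mul_of_nonneg_left h1 hT.le
  have h3 : T * (η / (2 * T) * γ p + 2 / (η / (2 * T)) ^ 2) = η / 2 * γ p + 8 * T ^ 3 / η ^ 2 := by
    field_simp
    ring
  have h4 : -(|w| * (γ p + 1 / 2)) ≤ w * α p := by
    have := mul_le_mul_of_nonneg_left hd.abs_le_add_half (abs_nonneg w)
    rw [← abs_mul] at this
    exact (abs_le.1 (this)).1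
  have h5 := mul_le_mul_of_nonneg_right hgap hd.1
  have h6 : 0 ≤ ε * (γ p ^ 2 + α p ^ 2) := by positivity
  have h7 : η / 2 * γ p ≤ |w| / 2 + 8 * T ^ 3 / η ^ 2 := by nlinarith
  have h8 : |w| / η + 16 * T ^ 3 / η ^ 3 = (2 / η) * (|w| / 2 + 8 * T ^ 3 / η ^ 2) := by
    field_simp
    ring
  rw [h8]
  calc γ p = (2 / η) * (η / 2 * γ p) := by field_simp
    _ ≤ _ := by gcongr

/-- Where the gap `e - |w|` is small, `γ` is large. -/
theorem ae_le_gamma {T : ℝ} (hT : 0 < T) {μ r ε : ℝ} (hε : 0 ≤ ε) {γ α : E3 → ℝ}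
    (h : IsPenMin U T μ r ε γ α) :
    ∀ᵐ p, T * Real.log (3 / 2) ≤ 3 / 2 * (2 * γ p + 1) *
      (fieldE U μ r γ p - |fieldW U r α p| + 2 * ε * (2 * γ p + 1)) := by
  classical
  -- The competitor is localised to a ball to keep it integrable.
  have key : ∀ (σ : ℝ), σ = 1 ∨ σ = -1 → ∀ R : ℕ, ∀ᵐ p, p ∈ Metric.ball (0 : E3) R →
      T * Real.log (3 / 2) ≤ 3 / 2 * (2 * γ p + 1) *
        (fieldE U μ r γ p - σ * fieldW U r α p + 2 * ε * (2 * γ p + 1)) := by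
    intro σ hσ R
    set A := Metric.ball (0 : E3) R
    have hA : MeasurableSet A := measurableSet_ball
    have hfin : volume A ≠ ⊤ := measure_ball_lt_top.ne
    set γ' : E3 → ℝ := A.piecewise (fun p => 4 * γ p + 3 / 2) γ
    set α' : E3 → ℝ := A.piecewise (fun p => α p - σ * (3 * γ p + 3 / 2)) α
    have hLp : MemLp (fun p => A.indicator (fun p => 3 * γ p + 3 / 2) p) 2 :=
      (memLp_indicator_iff_restrict hA).2 (((h.memLp_gamma.restrict A).const_mul 3).add
        (by
          have : IsFiniteMeasure (volume.restrict A) := ⟨by simpa using hfin.lt_top⟩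
          exact memLp_const _))
    have heq : γ' = fun p => γ p + A.indicator (fun p => 3 * γ p + 3 / 2) p := by
      ext p
      by_cases hp : p ∈ A
      · simp only [γ', Set.piecewise_eq_of_mem _ _ _ hp, Set.indicator_of_mem hp]
        ring
      · simp [γ', hp]
    have hadm : AdmSq γ' α' := by
      refine ⟨⟨?_, ?_, ?_⟩, ?_⟩
      · have i1 : IntegrableOn (fun p : E3 => (1 + ‖p‖ ^ 2) * (3 * γ p + 3 / 2)) A := by
          have c1 : IntegrableOn (fun p : E3 => (1 + ‖p‖ ^ 2) * (3 / 2)) A :=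
            ((by fun_prop : Continuous fun p : E3 => (1 + ‖p‖ ^ 2) * (3 / 2)).continuousOn.integrableOn_compact
              (isCompact_closedBall 0 (R : ℝ))).mono_set Metric.ball_subset_closedBall
          refine ((h.int.const_mul 3).integrableOn.add c1).congr (Eventually.of_forall fun p => ?_)
          simp only [Pi.add_apply]
          ring
        refine (h.int.add ((integrable_indicator_iff hA).2 i1)).congr
          (Eventually.of_forall fun p => ?_)
        rw [heq]
        by_cases hp : p ∈ A
        · simp only [Pi.add_apply, Set.indicator_of_mem hp]
          ring
        · simp [hp]
      · filter_upwards [h.dom] with p hp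
        by_cases hpA : p ∈ A
        · simp only [γ', α', Set.piecewise_eq_of_mem _ _ _ hpA]
          exact (hp.raise hσ).1
        · simpa [γ', α', hpA] using hp
      · exact AEStronglyMeasurable.piecewise hA
          (h.meas.sub (((h.meas_gamma.const_mul 3).add_const _).const_mul σ)).restrict
          h.meas.restrict
      · rw [heq]
        exact (h.memLp_gamma.add hLp).integrable_sq
    filter_upwards [hU.ae_firstVar_nonneg hT h hadm, h.dom] with p hp hd hpA
    have h1 := (hd.raise hσ).2
    unfold firstVar at hp
    simp only [γ', α', Set.piecewise_eq_of_mem _ _ _ hpA] at hp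
    have h2 := mul_le_mul_of_nonneg_left h1 hT.le
    -- The competitor of `PtDom.raise` gains entropy log (3/2) while γ rises by 3γ + 3/2 and α falls
    -- by σ times that amount. This inequality controls the α part of the penalty.
    have h3 : -(σ * α p) ≤ γ p + 1 / 2 := by
      have := abs_le.1 hd.abs_le_add_half
      rcases hσ with rfl | rfl <;> linarith
    have h4 : 0 ≤ 3 * γ p + 3 / 2 := by linarith [hd.1]
    have h5 := mul_le_mul_of_nonneg_left h3 (mul_nonneg hε h4)
    have h6 : 0 ≤ ε * (3 * γ p + 3 / 2) := mul_nonneg hε h4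
    linarith
  have key' : ∀ (σ : ℝ), σ = 1 ∨ σ = -1 → ∀ᵐ p,
      T * Real.log (3 / 2) ≤ 3 / 2 * (2 * γ p + 1) *
        (fieldE U μ r γ p - σ * fieldW U r α p + 2 * ε * (2 * γ p + 1)) := by
    intro σ hσ
    filter_upwards [ae_all_iff.2 (key σ hσ)] with p hp
    obtain ⟨R, hR⟩ := exists_nat_gt ‖p‖
    exact hp R (by simpa using hR)
  filter_upwards [key' 1 (Or.inl rfl), key' (-1) (Or.inr rfl)] with p h1 h2
  rcases abs_cases (fieldW U r α p) with ⟨h3, -⟩ | ⟨h3, -⟩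
  · rwa [h3, ← one_mul (fieldW U r α p)]
  · rwa [h3, ← neg_one_mul (fieldW U r α p)]

end IsPotential

/-! ### No concentration away from the origin -/

theorem volume_real_closedBall {δ : ℝ} (hδ : 0 ≤ δ) :
    volume.real (Metric.closedBall (0 : E3) δ) =
      δ ^ 3 * volume.real (Metric.ball (0 : E3) 1) := by
  rw [Measure.addHaar_real_closedBall_eq_addHaar_real_ball, volume_real_ball hδ]

theorem volume_real_ball_one_pos : 0 < volume.real (Metric.ball (0 : E3) 1) :=
  ENNReal.toReal_pos (Metric.measure_ball_pos volume _ one_pos).ne' measure_ball_lt_top.ne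

/-- A function exceeding `a 2ᵏ` on the dyadic shells outside a sphere has a large integral. -/
theorem le_integral_of_shells {z : E3 → ℝ} {s δ a : ℝ} {K : ℕ} (hδ : 0 < δ) (hs : δ ≤ s)
    (ha : 0 ≤ a) (hz : IntegrableOn z (Metric.closedBall 0 (s + 1))) (hz0 : ∀ᵐ p, 0 ≤ z p)
    (hlow : ∀ k < K, ∀ᵐ p, ‖p‖ ∈ Set.Ioc (s + (1 / 2) ^ (k + 1)) (s + (1 / 2) ^ k) →
      a * 2 ^ k ≤ z p) :
    K * (3 / 2 * a * volume.real (Metric.ball (0 : E3) 1) * δ ^ 2) ≤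
      ∫ p in Metric.closedBall (0 : E3) (s + 1), z p := by
  set v := volume.real (Metric.ball (0 : E3) 1) with hv
  have hv0 : 0 < v := volume_real_ball_one_pos
  set f : ℕ → ℝ := fun k => s + (1 / 2) ^ k with hf
  have hfanti : Antitone f := fun i j hij =>
    add_le_add le_rfl (pow_le_pow_of_le_one (by norm_num) (by norm_num) hij)
  set S : ℕ → Set E3 := fun k => (fun p : E3 => ‖p‖) ⁻¹' Set.Ioc (f (k + 1)) (f k) with hS
  have hSm : ∀ k, MeasurableSet (S k) := fun k => measurable_norm measurableSet_Ioc
  have hdisj : Pairwise (Function.onFun Disjoint S) := fun i j hij =>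
    (hfanti.pairwise_disjoint_on_Ioc_succ hij).preimage _
  have hSsub : ∀ k, S k ⊆ Metric.closedBall 0 (s + 1) := fun k p hp => by
    rw [mem_closedBall_zero_iff]
    refine hp.2.trans ?_
    exact add_le_add le_rfl (pow_le_one₀ (by norm_num) (by norm_num))
  -- The k-th shell has volume at least of order 2⁻ᵏ, which cancels the height a·2ᵏ: each of the K
  -- shells contributes the same amount.
  have hSvol : ∀ k, 3 / 2 * v * δ ^ 2 * (1 / 2) ^ k ≤ volume.real (S k) := by
    intro k
    have e : S k = Metric.closedBall 0 (f k) \ Metric.closedBall 0 (f (k + 1)) := by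
      ext p
      simp [hS, and_comm]
    have hs0 : 0 ≤ s := hδ.le.trans hs
    have hk0 : 0 ≤ f k := by simp only [hf]; positivity
    have hk1 : 0 ≤ f (k + 1) := by simp only [hf]; positivity
    rw [e, measureReal_sdiff (Metric.closedBall_subset_closedBall (hfanti (Nat.le_succ k)))
      measurableSet_closedBall measure_closedBall_lt_top.ne, volume_real_closedBall hk0,
      volume_real_closedBall hk1]
    simp only [hf]
    rw [pow_succ (1 / 2 : ℝ) k]
    set h := ((1 : ℝ) / 2) ^ k
    have hh : 0 ≤ h := by positivity
    have h1 : δ ^ 2 ≤ s ^ 2 := by gcongr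
    have h2 : 3 / 2 * δ ^ 2 * h ≤ (s + h) ^ 3 - (s + h * (1 / 2)) ^ 3 := by
      have h3 : 0 ≤ s := hδ.le.trans hs
      have e2 : (s + h) ^ 3 - (s + h * (1 / 2)) ^ 3 =
          3 / 2 * s ^ 2 * h + 9 / 4 * (s * h ^ 2) + 7 / 8 * h ^ 3 := by ring
      rw [e2]
      have h4 := mul_le_mul_of_nonneg_right h1 hh
      have h5 : 0 ≤ s * h ^ 2 := by positivity
      have h6 : 0 ≤ h ^ 3 := by positivity
      linarith
    calc 3 / 2 * v * δ ^ 2 * h = (3 / 2 * δ ^ 2 * h) * v := by ring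
      _ ≤ ((s + h) ^ 3 - (s + h * (1 / 2)) ^ 3) * v := by gcongr
      _ = _ := by ring
  have hSint : ∀ k ∈ Finset.range K, 3 / 2 * a * v * δ ^ 2 ≤ ∫ p in S k, z p := by
    intro k hk
    have h1 : ∫ p in S k, a * 2 ^ k ≤ ∫ p in S k, z p := by
      refine setIntegral_mono_on_ae (integrableOn_const
        ((measure_mono (hSsub k)).trans_lt measure_closedBall_lt_top).ne)
        (hz.mono_set (hSsub k)) (hSm k) (hlow k (Finset.mem_range.1 hk))
    refine le_trans ?_ h1
    rw [setIntegral_const, smul_eq_mul]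
    have h2 := mul_le_mul_of_nonneg_right (hSvol k) (show 0 ≤ a * 2 ^ k by positivity)
    refine le_trans (le_of_eq ?_) h2
    have h3 : ((1 : ℝ) / 2) ^ k * 2 ^ k = 1 := by rw [← mul_pow]; norm_num
    linear_combination (-(3 / 2 * a * v * δ ^ 2)) * h3
  have hsum := Finset.card_nsmul_le_sum (Finset.range K) _ _ hSint
  rw [Finset.card_range, nsmul_eq_mul] at hsum
  refine hsum.trans ?_
  rw [← integral_biUnion_finset (Finset.range K) (fun k _ => hSm k)
    (fun i _ j _ hij => hdisj hij) fun k _ => hz.mono_set (hSsub k)]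
  refine setIntegral_mono_set hz (ae_restrict_of_ae hz0) ?_
  exact (Set.iUnion₂_subset fun k _ => hSsub k).eventuallyLE

namespace IsPotential

variable {U : E3 → ℝ} (hU : IsPotential U)
include hU

/-- Away from the origin the gap `e - |w|` of penalised minimizers is bounded below, uniformly in
the penalisation. -/
theorem exists_gap_bound {T : ℝ} (hT : 0 < T) (μ : ℝ) {r C₀ δ : ℝ} (hr : 0 ≤ r) (hδ : 0 < δ) :
    ∃ η > 0, ∃ ε₀ > 0, ∀ ε, 0 < ε → ε < ε₀ → ∀ γ α, IsPenMin U T μ r ε γ α → ∫ p, γ p ≤ C₀ →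
      ∀ p, δ ≤ ‖p‖ → η ≤ fieldE U μ r γ p - |fieldW U r α p| := by
  have c0 := cst_pos
  obtain ⟨Cu, hCu0, hCu⟩ := hU.norm_le
  have hCu' : ∀ p, U p ≤ Cu := fun p => (le_abs_self _).trans (hCu p)
  obtain ⟨Λ, hΛ0, hΛ⟩ := hU.exists_lipschitz_conv
  obtain ⟨L₀, hL₀, hLip⟩ := hU.lip
  rcases lt_or_ge C₀ 0 with hC | hC
  · exact ⟨1, one_pos, 1, one_pos, fun ε _ _ γ α h hM => absurd h.gamma_nonneg (by linarith)⟩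
  set W := ∫ p, U p with hW
  have hW0 : 0 ≤ W := integral_nonneg hU.nonneg
  set KA := 3 / 2 * Cu * C₀ + 1 / 2 * W with hKA
  set K₁ := |μ| + 2 * cst * KA + r * Cu with hK₁
  have hK₁0 : 0 ≤ K₁ := by positivity
  -- Beyond radius R the kinetic term beats all fields and the gap is at least 1, so only a bounded
  -- region needs the Lipschitz constant `L`.
  set R := 1 + K₁ with hR
  set L := 2 * (R + 1) + 2 * cst * (Λ * (1 + C₀)) + 2 * r * L₀ with hL
  have hL0 : 0 ≤ L := by positivity
  set κ := 2 / 3 * (T * Real.log (3 / 2)) with hκ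
  have hκ0 : 0 < κ := by
    have := Real.log_pos (show (1 : ℝ) < 3 / 2 by norm_num)
    positivity
  set a := κ / (2 * (1 + L)) with ha
  have ha0 : 0 < a := by positivity
  set v := volume.real (Metric.ball (0 : E3) 1) with hv
  have hv0 : 0 < v := volume_real_ball_one_pos
  set Z := 2 * C₀ + (R + 1) ^ 3 * v with hZ
  -- Enough shells to exceed `Z`, the largest possible integral of 2γ + 1 over the ball of radius R
  -- + 1.
  obtain ⟨K, hK⟩ := exists_nat_gt (Z / (3 / 2 * a * v * δ ^ 2))
  rw [div_lt_iff₀ (by positivity)] at hK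
  -- The gap bound is the resolution of the finest shell. Below the threshold for ε, the penalty
  -- contributes less than κ/2 wherever 2γ + 1 < a·2ᵏ with k < K.
  refine ⟨(1 / 2) ^ K, by positivity, κ / (4 * a ^ 2 * 4 ^ K), by positivity,
    fun ε hε hε₀ γ α h hM p₀ hp₀ => ?_⟩
  set gap : E3 → ℝ := fun p => fieldE U μ r γ p - |fieldW U r α p| with hgap
  show (1 / 2) ^ K ≤ gap p₀
  have hM0 := h.gamma_nonneg
  have hUr : ∀ p, |U p| ≤ Cu := hCu
  have hconvB : ∀ {φ : E3 → ℝ}, Ctl φ γ → ∀ p, |conv U φ p| ≤ KA := fun hφ p => by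
    refine (hU.abs_conv_le hCu' hφ p).trans ?_
    rw [hKA]
    gcongr
  have hconvL : ∀ {φ : E3 → ℝ}, Ctl φ γ → ∀ p q,
      |conv U φ p - conv U φ q| ≤ Λ * (1 + C₀) * ‖p - q‖ := fun hφ p q => by
    refine (hΛ _ _ hφ p q).trans ?_
    gcongr
  have hradial : ∀ p q, ‖p‖ = ‖q‖ → gap p = gap q := fun p q hpq => by
    obtain ⟨r1, r2⟩ := h.isRadial_conv hU hT hε
    simp only [hgap, fieldE, fieldW]
    rw [r1 p q hpq, r2 p q hpq, hU.radial p q hpq, hpq]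
  have hfar : ∀ p, R ≤ ‖p‖ → 1 ≤ gap p := fun p hp => by
    have h1 := (abs_le.1 (hconvB h.ctl_gamma p)).1
    have h2 := hconvB h.ctl_alpha p
    have h3 : |fieldW U r α p| ≤ cst * KA + r * Cu := by
      refine (abs_add_le _ _).trans ?_
      rw [abs_mul, abs_mul, abs_of_nonneg c0.le, abs_of_nonneg hr]
      have := hUr p
      gcongr
    have h4 : 1 + K₁ ≤ ‖p‖ ^ 2 := by
      have : R * 1 ≤ ‖p‖ * ‖p‖ :=
        mul_le_mul hp (by linarith) zero_le_one (norm_nonneg p)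
      rw [mul_one, ← sq] at this
      linarith
    have h5 : 0 ≤ U 0 * (r + cst * ∫ q, γ q) :=
      mul_nonneg hU.pos_zero.le (by positivity)
    have h6 : 0 ≤ r * U p := mul_nonneg hr (hU.nonneg p)
    have h7 := mul_le_mul_of_nonneg_left h1 c0.le
    have h8 := le_abs_self μ
    simp only [hgap, fieldE]
    linarith
  have hgapL : ∀ p q, ‖p‖ ≤ R + 1 → ‖q‖ ≤ R + 1 → gap q ≤ gap p + L * ‖q - p‖ := by
    intro p q hp hq
    have h1 := (abs_le.1 (hconvL h.ctl_gamma q p)).2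
    have h2 := hconvL h.ctl_alpha q p
    have h3 := hLip q p
    have h4 : |fieldW U r α p| - |fieldW U r α q| ≤
        cst * (Λ * (1 + C₀) * ‖q - p‖) + r * (L₀ * ‖q - p‖) := by
      have e1 := abs_sub_abs_le_abs_sub (fieldW U r α p) (fieldW U r α q)
      refine e1.trans ?_
      have e : fieldW U r α p - fieldW U r α q =
          -(cst * (conv U α q - conv U α p) + r * (U q - U p)) := by unfold fieldW; ring
      rw [e, abs_neg]
      refine (abs_add_le _ _).trans ?_
      rw [abs_mul, abs_mul, abs_of_nonneg c0.le, abs_of_nonneg hr]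
      gcongr
    have h5 : ‖q‖ ^ 2 - ‖p‖ ^ 2 ≤ 2 * (R + 1) * ‖q - p‖ := by
      have e : ‖q‖ ^ 2 - ‖p‖ ^ 2 = (‖q‖ + ‖p‖) * (‖q‖ - ‖p‖) := by ring
      rw [e]
      have e1 : ‖q‖ - ‖p‖ ≤ ‖q - p‖ := norm_sub_norm_le q p
      calc (‖q‖ + ‖p‖) * (‖q‖ - ‖p‖) ≤ (‖q‖ + ‖p‖) * ‖q - p‖ := by gcongr
        _ ≤ 2 * (R + 1) * ‖q - p‖ := by gcongr; linarith
    have h6 := mul_le_mul_of_nonneg_left h1 c0.le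
    have h7 := mul_le_mul_of_nonneg_left (abs_le.1 h3).2 hr
    simp only [hgap, fieldE, hL]
    linarith
  by_contra hcon
  have hlt : gap p₀ < (1 / 2) ^ K := not_le.1 hcon
  have hpow1 : ((1 : ℝ) / 2) ^ K ≤ 1 := pow_le_one₀ (by norm_num) (by norm_num)
  have hp₀R : ‖p₀‖ < R := by
    by_contra hc
    have := hfar p₀ (not_lt.1 hc)
    linarith
  set s := ‖p₀‖ with hs
  have hs0 : 0 < s := hδ.trans_le hp₀
  have hz : IntegrableOn (fun p => 2 * γ p + 1) (Metric.closedBall (0 : E3) (s + 1)) :=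
    (h.int_gamma.const_mul 2).integrableOn.add
      (integrableOn_const measure_closedBall_lt_top.ne)
  have hz0 : ∀ᵐ p, 0 ≤ 2 * γ p + 1 := h.nonneg.mono fun p hp => by linarith
  have hshell := le_integral_of_shells (K := K) hδ hp₀ ha0.le hz hz0 (fun k hk => ?_)
  · have hup : ∫ p in Metric.closedBall (0 : E3) (s + 1), (2 * γ p + 1) ≤ Z := by
      rw [integral_add (h.int_gamma.const_mul 2).integrableOn
        (integrableOn_const measure_closedBall_lt_top.ne), setIntegral_const, smul_eq_mul, mul_one,
        volume_real_closedBall (by positivity), integral_const_mul]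
      have h1 : ∫ p in Metric.closedBall (0 : E3) (s + 1), γ p ≤ ∫ p, γ p :=
        setIntegral_le_integral h.int_gamma h.nonneg
      have h2 : (s + 1) ^ 3 * v ≤ (R + 1) ^ 3 * v := by gcongr
      rw [hZ]
      linarith
    linarith
  · filter_upwards [hU.ae_le_gamma hT hε.le h, h.nonneg] with p hp hγ hpk
    set b := ((1 : ℝ) / 2) ^ k with hb
    have hb0 : 0 < b := by positivity
    have hKb : ((1 : ℝ) / 2) ^ K ≤ b :=
      pow_le_pow_of_le_one (by norm_num) (by norm_num) hk.le
    have hb1 : b ≤ 1 := pow_le_one₀ (by norm_num) (by norm_num)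
    have hps : s ≤ ‖p‖ := by
      have h1 := hpk.1
      have : (0 : ℝ) < (1 / 2) ^ (k + 1) := by positivity
      linarith
    -- By radiality p may be moved onto the ray through p₀, at distance ‖p‖ - s ≤ b from p₀. There
    -- gap ≤ 2⁻ᴷ + L b, and 2⁻ᴷ ≤ b.
    have hgapp : gap p ≤ (1 + L) * b := by
      have e1 : ‖(‖p‖ / s) • p₀‖ = ‖p‖ := by
        rw [norm_smul, Real.norm_of_nonneg (by positivity), ← hs]
        field_simp
      have e2 : ‖(‖p‖ / s) • p₀ - p₀‖ = ‖p‖ - s := by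
        have : (‖p‖ / s) • p₀ - p₀ = ((‖p‖ - s) / s) • p₀ := by
          rw [sub_div, div_self hs0.ne', sub_smul, one_smul]
        rw [this, norm_smul, Real.norm_of_nonneg (div_nonneg (by linarith) hs0.le), ← hs]
        field_simp
      have h2 := hpk.2
      rw [hradial p _ e1.symm]
      have h3 := hgapL p₀ ((‖p‖ / s) • p₀) (by linarith) (by rw [e1]; linarith)
      rw [e2] at h3
      have h4 : L * (‖p‖ - s) ≤ L * b := mul_le_mul_of_nonneg_left (by linarith) hL0
      linarith
    have h5 : κ ≤ (2 * γ p + 1) * (gap p + 2 * ε * (2 * γ p + 1)) := by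
      rw [hκ]
      linarith
    by_contra hc
    have hc' : 2 * γ p + 1 < a * 2 ^ k := not_le.1 hc
    have hz1 : 0 ≤ 2 * γ p + 1 := by linarith
    have hb2 : (2 : ℝ) ^ k * b = 1 := by rw [hb, ← mul_pow]; norm_num
    have h6 : (2 * γ p + 1) * gap p ≤ κ / 2 := by
      calc (2 * γ p + 1) * gap p ≤ (2 * γ p + 1) * ((1 + L) * b) := by gcongr
        _ ≤ (a * 2 ^ k) * ((1 + L) * b) := by gcongr
        _ = a * (1 + L) := by linear_combination (a * (1 + L)) * hb2
        _ = κ / 2 := by rw [ha]; field_simp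
    have h7 : (2 * γ p + 1) * (2 * ε * (2 * γ p + 1)) ≤ 2 * ε * (a ^ 2 * 4 ^ K) := by
      calc (2 * γ p + 1) * (2 * ε * (2 * γ p + 1)) = 2 * ε * (2 * γ p + 1) ^ 2 := by ring
        _ ≤ 2 * ε * (a * 2 ^ k) ^ 2 := by gcongr
        _ ≤ 2 * ε * (a * 2 ^ K) ^ 2 := by gcongr; norm_num
        _ = 2 * ε * (a ^ 2 * 4 ^ K) := by
          rw [mul_pow, ← pow_mul, mul_comm K 2, pow_mul]; norm_num
    rw [lt_div_iff₀ (by positivity)] at hε₀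
    linarith

end IsPotential

/-! ### Approximation and continuity in the condensate density -/

namespace IsPotential

variable {U : E3 → ℝ} (hU : IsPotential U)
include hU

/-- Away from the origin penalised minimizers are bounded, uniformly in the penalisation. -/
theorem exists_gamma_bound {T : ℝ} (hT : 0 < T) (μ : ℝ) {r C₀ δ : ℝ} (hr : 0 ≤ r) (hδ : 0 < δ) :
    ∃ G, ∃ ε₀ > 0, ∀ ε, 0 < ε → ε < ε₀ → ∀ γ α, IsPenMin U T μ r ε γ α → ∫ p, γ p ≤ C₀ →
      ∀ᵐ p, δ ≤ ‖p‖ → γ p ≤ G := by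
  have c0 := cst_pos
  obtain ⟨η, hη, ε₀, hε₀, hgap⟩ := hU.exists_gap_bound hT μ (C₀ := C₀) hr hδ
  obtain ⟨Cu, hCu0, hCu⟩ := hU.norm_le
  have hCu' : ∀ p, U p ≤ Cu := fun p => (le_abs_self _).trans (hCu p)
  set Wb := cst * (3 / 2 * Cu * C₀ + 1 / 2 * ∫ p, U p) + r * Cu with hWb
  refine ⟨Wb / η + 16 * T ^ 3 / η ^ 3, ε₀, hε₀, fun ε h0 h1 γ α h hM => ?_⟩
  filter_upwards [hU.ae_gamma_le hT h0.le h hη] with p hp hpδ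
  refine (hp (hgap ε h0 h1 γ α h hM p hpδ)).trans ?_
  have : |fieldW U r α p| ≤ Wb := by
    refine (abs_add_le _ _).trans ?_
    rw [abs_mul, abs_mul, abs_of_nonneg c0.le, abs_of_nonneg hr]
    have e1 := hU.abs_conv_le hCu' h.ctl_alpha p
    have e2 : |U p| ≤ Cu := hCu p
    rw [hWb]
    gcongr
    refine e1.trans ?_
    gcongr
  gcongr

/-- Square integrable pairs are dense in energy. -/
theorem exists_admSq_energy_le (T μ r : ℝ) {γ α : E3 → ℝ} (h : Adm γ α) {η : ℝ} (hη : 0 < η) :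
    ∃ γ' α', AdmSq γ' α' ∧ energy U T μ γ' α' r ≤ energy U T μ γ α r + η := by
  set g := h.meas_gamma.mk γ with hg
  have hgm : Measurable g := h.meas_gamma.stronglyMeasurable_mk.measurable
  have hge : γ =ᵐ[volume] g := h.meas_gamma.ae_eq_mk
  -- Truncate where γ is large: on these sets γ² ≤ kγ. Every term of the energy converges as the
  -- sets exhaust space. A measurable representative of γ makes them measurable.
  set A : ℕ → Set E3 := fun k => {p | g p ≤ k} with hA
  have hAm : ∀ k, MeasurableSet (A k) := fun k => measurableSet_le hgm measurable_const
  have hAmono : Monotone A := fun i j hij p hp => le_trans (show g p ≤ i from hp) (by exact_mod_cast hij)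
  have hAun : ⋃ k, A k = Set.univ := by
    refine Set.eq_univ_of_forall fun p => Set.mem_iUnion.2 ?_
    obtain ⟨k, hk⟩ := exists_nat_ge (g p)
    exact ⟨k, hk⟩
  have hadm : ∀ k, AdmSq ((A k).indicator γ) ((A k).indicator α) := fun k => by
    refine ⟨h.indicator (hAm k), ?_⟩
    refine (h.int_gamma.const_mul (k : ℝ)).mono' ((h.meas_gamma.indicator (hAm k)).pow 2) ?_
    filter_upwards [hge, h.nonneg] with p hp h0
    rw [Real.norm_of_nonneg (sq_nonneg _)]
    by_cases hpA : p ∈ A k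
    · have h1 : g p ≤ k := hpA
      rw [Set.indicator_of_mem hpA, sq]
      exact mul_le_mul_of_nonneg_right (by rw [hp]; exact h1) h0
    · rw [Set.indicator_of_notMem hpA]
      have : (0 : ℝ) ≤ k * γ p := mul_nonneg (Nat.cast_nonneg k) h0
      simpa using this
  have lim1 : ∀ f : E3 → ℝ, Integrable f →
      Tendsto (fun k => ∫ p, (A k).indicator f p) atTop (𝓝 (∫ p, f p)) := fun f hf => by
    have := tendsto_setIntegral_of_monotone hAm hAmono (f := f) (by rw [hAun]; exact hf.integrableOn)
    rw [hAun, setIntegral_univ] at this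
    exact this.congr fun k => (integral_indicator (hAm k)).symm
  have limw : ∀ w f : E3 → ℝ, Integrable (fun p => w p * f p) →
      Tendsto (fun k => ∫ p, w p * (A k).indicator f p) atTop (𝓝 (∫ p, w p * f p)) :=
    fun w f hf => by
      refine (lim1 _ hf).congr fun k => ?_
      congr 1
      ext p
      by_cases hp : p ∈ A k <;> simp [hp]
  have lim2 : ∀ f : E3 → ℝ, Ctl f γ →
      Tendsto (fun k => dbl U ((A k).indicator f) ((A k).indicator f)) atTop (𝓝 (dbl U f f)) :=
    fun f hf => by
      have hm : ∀ k, MeasurableSet (A k ×ˢ A k) := fun k => (hAm k).prod (hAm k)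
      have hun : ⋃ k, A k ×ˢ A k = Set.univ := by
        rw [Set.iUnion_prod_of_monotone hAmono hAmono, hAun, Set.univ_prod_univ]
      have := tendsto_setIntegral_of_monotone hm
        (fun i j hij => Set.prod_mono (hAmono hij) (hAmono hij))
        (by rw [hun]; exact (hU.integrable_dbl hf hf).integrableOn)
      rw [hun, setIntegral_univ] at this
      refine this.congr fun k => ?_
      rw [← integral_indicator (hm k)]
      unfold dbl
      congr 1
      ext z
      by_cases h1 : z.1 ∈ A k <;> by_cases h2 : z.2 ∈ A k <;>
        simp [h1, h2]
  have limS : Tendsto (fun k => ∫ p, sDens ((A k).indicator γ p) ((A k).indicator α p)) atTop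
      (𝓝 (∫ p, sDens (γ p) (α p))) := by
    refine (lim1 _ h.int_sDens).congr fun k => ?_
    congr 1
    ext p
    by_cases hp : p ∈ A k <;> simp [hp, sDens_zero]
  have hlim : Tendsto (fun k => energy U T μ ((A k).indicator γ) ((A k).indicator α) r) atTop
      (𝓝 (energy U T μ γ α r)) := by
    unfold energy
    have hρ := ((lim1 _ h.int_gamma).const_mul cst).const_add r
    exact ((((((limw _ _ h.int_kin).const_mul _).sub (hρ.const_mul μ)).sub
      ((limS.const_mul _).const_mul T)).add ((hρ.pow 2).const_mul _)).add
      (((lim2 _ h.ctl_alpha).add (lim2 _ h.ctl_gamma)).const_mul _)).add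
      ((((limw _ _ (hU.integrable_mul h.ctl_gamma)).add
        (limw _ _ (hU.integrable_mul h.ctl_alpha))).const_mul _).const_mul r)
  obtain ⟨k, hk⟩ := (hlim.eventually_lt_const
    (show energy U T μ γ α r < energy U T μ γ α r + η by linarith)).exists
  exact ⟨_, _, hadm k, hk.le⟩

/-- The energy is Lipschitz in the condensate density, uniformly on bounded sets. -/
theorem exists_energy_lipschitz (T μ : ℝ) {C : ℝ} (hC : 0 ≤ C) :
    ∃ D, 0 ≤ D ∧ ∀ (γ α : E3 → ℝ) (r r' : ℝ), Adm γ α → ∫ p, γ p ≤ C → 0 ≤ r → r ≤ C → 0 ≤ r' →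
      r' ≤ C → energy U T μ γ α r ≤ energy U T μ γ α r' + D * |r - r'| := by
  have c0 := cst_pos
  obtain ⟨Cu, hCu0, hCu⟩ := hU.norm_le
  have hCu' : ∀ p, U p ≤ Cu := fun p => (le_abs_self _).trans (hCu p)
  have hW0 : 0 ≤ ∫ p, U p := integral_nonneg hU.nonneg
  set KA := 3 / 2 * Cu * C + 1 / 2 * ∫ p, U p with hKA
  have hKA0 : 0 ≤ KA := by positivity
  have hU0 := hU.pos_zero
  refine ⟨|μ| + U 0 / 2 * (2 * C + 2 * (cst * C)) + cst * (2 * KA), by positivity,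
    fun γ α r r' h hM hr hrC hr' hrC' => ?_⟩
  have hM0 := h.gamma_nonneg
  have hB : ∀ {φ : E3 → ℝ}, Ctl φ γ → |∫ p, U p * φ p| ≤ KA := fun hφ => by
    have := hU.abs_conv_le hCu' hφ 0
    rw [hU.conv_zero] at this
    refine this.trans ?_
    rw [hKA]
    gcongr
  have h1 := hB h.ctl_gamma
  have h2 := hB h.ctl_alpha
  set X := (∫ p, U p * γ p) + ∫ p, U p * α p with hX
  have hXB : |X| ≤ 2 * KA := (abs_add_le _ _).trans (by linarith)
  set M := ∫ p, γ p
  have e : energy U T μ γ α r - energy U T μ γ α r' =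
      (-μ + U 0 / 2 * (r + r' + 2 * (cst * M)) + cst * X) * (r - r') := by
    unfold energy
    ring
  have hle : |-μ + U 0 / 2 * (r + r' + 2 * (cst * M)) + cst * X| ≤
      |μ| + U 0 / 2 * (2 * C + 2 * (cst * C)) + cst * (2 * KA) := by
    refine (abs_add_three _ _ _).trans ?_
    rw [abs_neg, abs_mul cst, abs_of_nonneg c0.le,
      abs_of_nonneg (show 0 ≤ U 0 / 2 * (r + r' + 2 * (cst * M)) by positivity)]
    gcongr
    linarith
  have h3 := (le_abs_self _).trans_eq (abs_mul
    (-μ + U 0 / 2 * (r + r' + 2 * (cst * M)) + cst * X) (r - r'))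
  have h4 := mul_le_mul_of_nonneg_right hle (abs_nonneg (r - r'))
  linarith

end IsPotential

/-! ### Weighted measures and the final limit -/

theorem exists_bound_of_eventually {a : ℕ → ℝ} {B : ℝ} {N : ℕ} (h : ∀ k ≥ N, a k ≤ B) :
    ∃ B', 1 ≤ B' ∧ ∀ k, a k ≤ B' := by
  refine ⟨1 + |B| + ∑ k ∈ Finset.range N, |a k|, ?_, fun k => ?_⟩
  · have := Finset.sum_nonneg fun k (_ : k ∈ Finset.range N) => abs_nonneg (a k)
    linarith [abs_nonneg B]
  · rcases lt_or_ge k N with hk | hk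
    · have := Finset.single_le_sum (f := fun k => |a k|) (fun k _ => abs_nonneg _)
        (Finset.mem_range.2 hk)
      linarith [abs_nonneg B, le_abs_self (a k)]
    · have := Finset.sum_nonneg fun k (_ : k ∈ Finset.range N) => abs_nonneg (a k)
      linarith [le_abs_self B, h k hk]

/-- The exterior of the ball of radius `1 / (j + 1)`. -/
def ext (j : ℕ) : Set E3 := (Metric.ball (0 : E3) (1 / ((j : ℝ) + 1)))ᶜ

theorem mem_ext {j : ℕ} {p : E3} : p ∈ ext j ↔ 1 / ((j : ℝ) + 1) ≤ ‖p‖ := by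
  simp [ext]

theorem measurableSet_ext (j : ℕ) : MeasurableSet (ext j) := measurableSet_ball.compl

theorem eventually_mem_ext {p : E3} (hp : p ≠ 0) : ∀ᶠ j in atTop, p ∈ ext j := by
  have := (tendsto_one_div_add_atTop_nhds_zero_nat (𝕜 := ℝ)).eventually_le_const (norm_pos_iff.2 hp)
  filter_upwards [this] with j hj using mem_ext.2 hj

theorem ae_ne_zero : ∀ᵐ p : E3, p ≠ 0 := by
  have : volume ({0} : Set E3) = 0 := measure_singleton _
  exact compl_mem_ae_iff.2 this

/-- A measure equivalent to Lebesgue measure, for which functions with prescribed bounds on the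
integrals over the exteriors `ext j` are integrable. -/
def wMeasure (B : ℕ → ℝ) : Measure E3 :=
  Measure.sum fun j => ENNReal.ofReal ((1 / 2) ^ j / B j) • volume.restrict (ext j)

section wMeasure

variable {B : ℕ → ℝ} (hB : ∀ j, 1 ≤ B j)

theorem wMeasure_absolutelyContinuous (B : ℕ → ℝ) : wMeasure B ≪ volume := by
  refine Measure.absolutelyContinuous_sum_left fun j => ?_
  exact (Measure.smul_absolutelyContinuous).trans Measure.restrict_le_self.absolutelyContinuous

include hB

theorem weight_pos (j : ℕ) : 0 < (1 / 2 : ℝ) ^ j / B j :=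
  div_pos (by positivity) (by linarith [hB j])

/-- Every weight is positive and the exteriors cover all of space except the null set {0}. -/
theorem ae_of_ae_wMeasure {P : E3 → Prop} (h : ∀ᵐ p ∂wMeasure B, P p) : ∀ᵐ p, P p := by
  have h1 : ∀ j, ∀ᵐ p, p ∈ ext j → P p := fun j => by
    rw [← ae_restrict_iff' (measurableSet_ext j)]
    have h2 := (Measure.ae_sum_iff.1 h) j
    rwa [Measure.ae_ennreal_smul_measure_iff] at h2
    simpa using weight_pos hB j
  filter_upwards [ae_all_iff.2 h1, ae_ne_zero] with p hp hp0
  obtain ⟨j, hj⟩ := (eventually_mem_ext hp0).exists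
  exact hp j hj

omit hB in
theorem lintegral_wMeasure (B : ℕ → ℝ) (f : E3 → ENNReal) : ∫⁻ p, f p ∂wMeasure B =
    ∑' j, ENNReal.ofReal ((1 / 2) ^ j / B j) * ∫⁻ p in ext j, f p := by
  unfold wMeasure
  rw [lintegral_sum_measure]
  simp

theorem setLIntegral_ext_le (f : E3 → ENNReal) (j : ℕ) : ∫⁻ p in ext j, f p ≤
    ENNReal.ofReal (((1 / 2) ^ j / B j)⁻¹) * ∫⁻ p, f p ∂wMeasure B := by
  have hw := weight_pos hB j
  have h1 := ENNReal.le_tsum (f := fun j => ENNReal.ofReal ((1 / 2) ^ j / B j) *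
    ∫⁻ p in ext j, f p) j
  rw [← lintegral_wMeasure] at h1
  calc ∫⁻ p in ext j, f p = ENNReal.ofReal (((1 / 2) ^ j / B j)⁻¹) *
        (ENNReal.ofReal ((1 / 2) ^ j / B j) * ∫⁻ p in ext j, f p) := by
        rw [← mul_assoc, ← ENNReal.ofReal_mul (by positivity), inv_mul_cancel₀ hw.ne',
          ENNReal.ofReal_one, one_mul]
    _ ≤ _ := by gcongr

theorem integrableOn_ext_of_wMeasure {f : E3 → ℝ} (hm : AEStronglyMeasurable f)
    (h0 : ∀ p, 0 ≤ f p) (hf : Integrable f (wMeasure B)) (j : ℕ) :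
    IntegrableOn f (ext j) ∧ ∫ p in ext j, f p ≤
      ((1 / 2) ^ j / B j)⁻¹ * ∫ p, f p ∂wMeasure B := by
  have h1 := setLIntegral_ext_le hB (fun p => ENNReal.ofReal (f p)) j
  have hfin := (hasFiniteIntegral_iff_ofReal (Eventually.of_forall h0)).1 hf.2
  have hi : IntegrableOn f (ext j) := by
    refine ⟨hm.restrict, (hasFiniteIntegral_iff_ofReal (Eventually.of_forall h0)).2 ?_⟩
    exact h1.trans_lt (ENNReal.mul_lt_top ENNReal.ofReal_lt_top hfin)
  refine ⟨hi, ?_⟩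
  have hw := weight_pos hB j
  have hI : 0 ≤ ∫ p, f p ∂wMeasure B := integral_nonneg h0
  rw [← ofReal_integral_eq_lintegral_ofReal hi (Eventually.of_forall h0),
    ← ofReal_integral_eq_lintegral_ofReal hf (Eventually.of_forall h0),
    ← ENNReal.ofReal_mul (by positivity), ENNReal.ofReal_le_ofReal_iff (by positivity)] at h1
  exact h1

/-- The weight 2⁻ʲ/B j cancels the bound on `ext j`, leaving a geometric series of sum 2. -/
theorem integrable_wMeasure {f : E3 → ℝ} (h0 : ∀ p, 0 ≤ f p) (hf : Integrable f)
    (hfB : ∀ j, ∫ p in ext j, f p ≤ B j) :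
    Integrable f (wMeasure B) ∧ ∫ p, f p ∂wMeasure B ≤ 2 := by
  have h1 : ∫⁻ p, ENNReal.ofReal (f p) ∂wMeasure B ≤ ENNReal.ofReal 2 := by
    rw [lintegral_wMeasure]
    have h2 : ∀ j, ENNReal.ofReal ((1 / 2) ^ j / B j) * ∫⁻ p in ext j, ENNReal.ofReal (f p) ≤
        ENNReal.ofReal ((1 / 2) ^ j) := fun j => by
      rw [← ofReal_integral_eq_lintegral_ofReal hf.integrableOn (Eventually.of_forall h0),
        ← ENNReal.ofReal_mul (weight_pos hB j).le]
      refine ENNReal.ofReal_le_ofReal ?_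
      have hBj : 0 < B j := by linarith [hB j]
      calc (1 / 2 : ℝ) ^ j / B j * ∫ p in ext j, f p ≤ (1 / 2 : ℝ) ^ j / B j * B j :=
            mul_le_mul_of_nonneg_left (hfB j) (weight_pos hB j).le
        _ = (1 / 2) ^ j := by field_simp
    refine (ENNReal.tsum_le_tsum h2).trans ?_
    rw [← ENNReal.ofReal_tsum_of_nonneg (fun j => by positivity) summable_geometric_two,
      tsum_geometric_two]
  have hi : Integrable f (wMeasure B) :=
    ⟨hf.aestronglyMeasurable.mono_ac (wMeasure_absolutelyContinuous B),
      (hasFiniteIntegral_iff_ofReal (Eventually.of_forall h0)).2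
        (h1.trans_lt ENNReal.ofReal_lt_top)⟩
  refine ⟨hi, ?_⟩
  rwa [← ofReal_integral_eq_lintegral_ofReal hi (Eventually.of_forall h0),
    ENNReal.ofReal_le_ofReal_iff (by norm_num)] at h1

end wMeasure

namespace IsPotential

variable {U : E3 → ℝ} (hU : IsPotential U)
include hU

/-- The energies of penalised minimizers approach the infimum of the energy, and these minimizers
have uniformly bounded square integrals away from the origin. -/
theorem exists_bounded_minimizing {T : ℝ} (hT : 0 < T) (μ : ℝ) {r I : ℝ} (hr : 0 ≤ r)
    (hI : ∀ η > 0, ∃ γ α, Adm γ α ∧ energy U T μ γ α r ≤ I + η) :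
    ∃ (γs αs : ℕ → E3 → ℝ) (B : ℕ → ℝ), (∀ j, 1 ≤ B j) ∧ (∀ k, AdmSq (γs k) (αs k)) ∧
      (∀ η > 0, ∃ k, energy U T μ (γs k) (αs k) r ≤ I + η) ∧
      ∀ j k, (∫ p in ext j, γs k p ^ 2) ≤ B j ∧ (∫ p in ext j, αs k p ^ 2) ≤ B j := by
  have c0 := cst_pos
  have hε : ∀ k : ℕ, (0 : ℝ) < 1 / ((k : ℝ) + 1) := fun k => by positivity
  choose γs αs hmin using fun k : ℕ => hU.exists_isPenMin hT μ hr (hε k)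
  have hpen0 : ∀ γ α : E3 → ℝ, 0 ≤ (∫ p, γ p ^ 2) + ∫ p, α p ^ 2 := fun γ α =>
    add_nonneg (integral_nonneg fun p => sq_nonneg _) (integral_nonneg fun p => sq_nonneg _)
  have hle : ∀ k, energy U T μ (γs k) (αs k) r ≤
      penEnergy U T μ r (1 / ((k : ℝ) + 1)) (γs k) (αs k) := fun k =>
    le_add_of_nonneg_right (mul_nonneg (hε k).le (mul_nonneg c0.le (hpen0 _ _)))
  obtain ⟨C, hC0, hC⟩ := hU.exists_sublevel_bound hT μ (energy U T μ (fun _ => 0) (fun _ => 0) r)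
  have hM : ∀ k, ∫ p, γs k p ≤ C := fun k => by
    -- The zero state carries no penalty, so comparison with it bounds the energies, hence the
    -- masses, uniformly in k.
    refine (hC _ _ r (hmin k).toAdm hr ((hle k).trans (((hmin k).le _ _ AdmSq.zero).trans ?_))).2.1
    unfold penEnergy
    simp
  have hsq : ∀ j : ℕ, ∃ B, 1 ≤ B ∧ ∀ k,
      (∫ p in ext j, γs k p ^ 2) ≤ B ∧ (∫ p in ext j, αs k p ^ 2) ≤ B := fun j => by
    obtain ⟨G, ε₀, hε₀, hG⟩ := hU.exists_gamma_bound hT μ (C₀ := C) hr (hε j)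
    obtain ⟨N, hN⟩ := exists_nat_one_div_lt hε₀
    -- Where γ ≤ G, γ² + α² ≤ 2γ² + γ ≤ (2|G| + 1)γ, and the mass is bounded. The finitely many k <
    -- N are absorbed into a larger constant.
    have hev : ∀ k ≥ N, (∫ p in ext j, γs k p ^ 2) + (∫ p in ext j, αs k p ^ 2) ≤
        (2 * |G| + 1) * C := fun k hk => by
      have h1 : 1 / ((k : ℝ) + 1) < ε₀ := lt_of_le_of_lt (by gcongr) hN
      have h2 := hG _ (hε k) h1 _ _ (hmin k) (hM k)
      have i1 := (hmin k).sq.integrableOn (s := ext j)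
      have i2 := (hmin k).memLp_alpha.integrable_sq.integrableOn (s := ext j)
      rw [← integral_add i1 i2]
      have h3 : ∫ p in ext j, (γs k p ^ 2 + αs k p ^ 2) ≤ ∫ p in ext j, (2 * |G| + 1) * γs k p := by
        refine setIntegral_mono_on_ae (i1.add i2)
          ((hmin k).int_gamma.const_mul _).integrableOn (measurableSet_ext j) ?_
        filter_upwards [h2, (hmin k).dom] with p hp hd hpj
        have h4 := hp (mem_ext.1 hpj)
        have h5 := mul_le_mul_of_nonneg_right (h4.trans (le_abs_self G)) hd.1
        have h6 := hd.2
        nlinarith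
      refine h3.trans ?_
      rw [integral_const_mul]
      have h7 : ∫ p in ext j, γs k p ≤ ∫ p, γs k p :=
        setIntegral_le_integral (hmin k).int_gamma (hmin k).nonneg
      have := hM k
      gcongr
      linarith
    obtain ⟨B, hB1, hB⟩ := exists_bound_of_eventually hev
    refine ⟨B, hB1, fun k => ?_⟩
    have h1 : 0 ≤ ∫ p in ext j, γs k p ^ 2 := integral_nonneg fun p => sq_nonneg _
    have h2 : 0 ≤ ∫ p in ext j, αs k p ^ 2 := integral_nonneg fun p => sq_nonneg _
    have := hB k
    constructor <;> linarith
  choose B hB1 hB using hsq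
  refine ⟨γs, αs, B, hB1, fun k => (hmin k).toAdmSq, fun η hη => ?_, hB⟩
  -- One third of η each for near-optimality, for passing to square integrable pairs, and for the
  -- penalty.
  obtain ⟨γ, α, h, hγα⟩ := hI (η / 3) (by positivity)
  obtain ⟨γ', α', h', hγα'⟩ := hU.exists_admSq_energy_le T μ r h (η := η / 3) (by positivity)
  set N := cst * ((∫ p, γ' p ^ 2) + ∫ p, α' p ^ 2) with hN
  have hN0 : 0 ≤ N := mul_nonneg c0.le (hpen0 _ _)
  obtain ⟨k, hk⟩ := exists_nat_one_div_lt (show 0 < η / 3 / (N + 1) by positivity)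
  refine ⟨k, (hle k).trans (((hmin k).le _ _ h').trans ?_)⟩
  unfold penEnergy
  have h1 : 1 / ((k : ℝ) + 1) * N ≤ η / 3 / (N + 1) * (N + 1) :=
    mul_le_mul hk.le (by linarith) hN0 (by positivity)
  rw [div_mul_cancel₀ _ (by positivity)] at h1
  linarith

/-- For a fixed condensate density there is a minimizing sequence that converges almost everywhere,
and in `L¹` away from the origin. -/
theorem exists_convergent_minimizing {T : ℝ} (hT : 0 < T) (μ : ℝ) {r I : ℝ} (hr : 0 ≤ r)
    (hI : ∀ η > 0, ∃ γ α, Adm γ α ∧ energy U T μ γ α r ≤ I + η) :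
    ∃ (γs αs : ℕ → E3 → ℝ) (u v : E3 → ℝ) (C : ℝ), 0 ≤ C ∧ (∀ n, Adm (γs n) (αs n)) ∧
      (∀ n : ℕ, energy U T μ (γs n) (αs n) r ≤ I + 1 / ((n : ℝ) + 1)) ∧
      (∀ n, ∫ p, γs n p ≤ C) ∧ (∀ n, ∫ p, ‖p‖ ^ 2 * γs n p ≤ C) ∧
      (∀ᵐ p, Tendsto (fun n => γs n p) atTop (𝓝 (u p))) ∧
      (∀ᵐ p, Tendsto (fun n => αs n p) atTop (𝓝 (v p))) ∧ Integrable u ∧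
      ∀ j, Tendsto (fun n => ∫ p, |(ext j).indicator (fun p => γs n p - u p) p|) atTop (𝓝 0) := by
  obtain ⟨γ₀, α₀, B, hB, hadm₀, hE₀, hsq₀⟩ := hU.exists_bounded_minimizing hT μ hr hI
  set m := wMeasure B with hm
  -- Sublevel sets of the unpenalised energy, viewed in the weighted L². The penalised minimizers
  -- show that each contains a point of squared norm at most 2 + 2.
  set K : ℕ → Set ((E3 → ℝ) × (E3 → ℝ)) := fun n => {x | Adm x.1 x.2 ∧ MemLp x.1 2 m ∧
    MemLp x.2 2 m ∧ energy U T μ x.1 x.2 r ≤ I + 1 / ((n : ℝ) + 1)} with hK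
  have hanti : Antitone K := fun a b hab x hx => ⟨hx.1, hx.2.1, hx.2.2.1, hx.2.2.2.trans (by gcongr)⟩
  have hac := wMeasure_absolutelyContinuous B
  have hbd : ∀ n, ∃ x ∈ K n, (∫ p, x.1 p ^ 2 ∂m) + ∫ p, x.2 p ^ 2 ∂m ≤ 4 := fun n => by
    obtain ⟨k, hk⟩ := hE₀ (1 / ((n : ℝ) + 1)) (by positivity)
    obtain ⟨i1, l1⟩ := integrable_wMeasure hB (fun p => sq_nonneg (γ₀ k p)) (hadm₀ k).sq
      fun j => (hsq₀ j k).1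
    obtain ⟨i2, l2⟩ := integrable_wMeasure hB (fun p => sq_nonneg (α₀ k p))
      (hadm₀ k).memLp_alpha.integrable_sq fun j => (hsq₀ j k).2
    refine ⟨(γ₀ k, α₀ k), ⟨(hadm₀ k).toAdm, ?_, ?_, hk⟩, by linarith⟩
    · exact (memLp_two_iff_integrable_sq ((hadm₀ k).meas_gamma.mono_ac hac)).2 i1
    · exact (memLp_two_iff_integrable_sq ((hadm₀ k).meas.mono_ac hac)).2 i2
  have hmid : ∀ n, ∀ x ∈ K n, ∀ y ∈ K n, ((fun p => (1 - 1 / 2) * x.1 p + 1 / 2 * y.1 p,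
      fun p => (1 - 1 / 2) * x.2 p + 1 / 2 * y.2 p) : (E3 → ℝ) × (E3 → ℝ)) ∈ K n := by
    rintro n x ⟨hx, hx1, hx2, hx'⟩ y ⟨hy, hy1, hy2, hy'⟩
    refine ⟨hx.mix hy (by norm_num) (by norm_num), (hx1.const_mul _).add (hy1.const_mul _),
      (hx2.const_mul _).add (hy2.const_mul _), ?_⟩
    refine (hU.energy_mix_convex hT μ r hx hy (t := 1 / 2) (by norm_num) (by norm_num)).trans ?_
    linarith
  obtain ⟨x, u, v, hxK, hu, hv, aeu, aev, hL2, -, -⟩ := exists_seq_tendsto_of_nested K hanti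
    (fun n x hx => ⟨hx.2.1, hx.2.2.1⟩) hbd hmid
  replace aeu := ae_of_ae_wMeasure hB aeu
  replace aev := ae_of_ae_wMeasure hB aev
  obtain ⟨C, hC0, hC⟩ := hU.exists_sublevel_bound hT μ (I + 1)
  have hadm : ∀ n, Adm (x n).1 (x n).2 := fun n => (hxK n).1
  have hCn : ∀ n, ∫ p, (x n).1 p ≤ C ∧ ∫ p, ‖p‖ ^ 2 * (x n).1 p ≤ C := fun n => by
    refine (hC _ _ r (hadm n) hr ((hxK n).2.2.2.trans ?_)).2
    have : 1 / ((n : ℝ) + 1) ≤ 1 := by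
      rw [div_le_one (by positivity)]
      linarith [(Nat.cast_nonneg n : (0 : ℝ) ≤ n)]
    linarith
  have hu1 := integrable_of_tendsto_of_integral_le (fun n => (hadm n).int_gamma)
    (fun n => (hadm n).nonneg) aeu fun n => (hCn n).1
  have hu2 := integrable_of_tendsto_of_integral_le (f := fun n p => ‖p‖ ^ 2 * (x n).1 p)
    (F := fun p => ‖p‖ ^ 2 * u p) (fun n => (hadm n).int_kin)
    (fun n => by
      filter_upwards [(hadm n).nonneg] with p hp
      exact mul_nonneg (by positivity) hp)
    (by filter_upwards [aeu] with p hp using hp.const_mul _) fun n => (hCn n).2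
  have hu0 : ∀ᵐ p, 0 ≤ u p := by
    filter_upwards [aeu, ae_all_iff.2 fun n => (hadm n).nonneg] with p h1 h2
    exact ge_of_tendsto' h1 h2
  refine ⟨fun n => (x n).1, fun n => (x n).2, u, v, C, hC0, hadm, fun n => (hxK n).2.2.2,
    fun n => (hCn n).1, fun n => (hCn n).2, aeu, aev, hu1.1, fun j => ?_⟩
  have hS := measurableSet_ext j
  have hd1 : ∀ n, Integrable fun p => (x n).1 p - u p := fun n => (hadm n).int_gamma.sub hu1.1
  have hd2 : ∀ n, IntegrableOn (fun p => ((x n).1 p - u p) ^ 2) (ext j) ∧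
      ∫ p in ext j, ((x n).1 p - u p) ^ 2 ≤
        ((1 / 2) ^ j / B j)⁻¹ * ∫ p, ((x n).1 p - u p) ^ 2 ∂m := fun n =>
    integrableOn_ext_of_wMeasure hB ((hd1 n).aestronglyMeasurable.pow 2) (fun p => sq_nonneg _)
      ((hxK n).2.1.sub hu).integrable_sq j
  have hind : ∀ n, (fun p => (ext j).indicator (fun p => (x n).1 p - u p) p ^ 2) =
      (ext j).indicator fun p => ((x n).1 p - u p) ^ 2 := fun n => by
    ext p
    by_cases hp : p ∈ ext j <;> simp [hp]
  have hdom : ∀ n, ∀ᵐ p, ‖‖p‖ ^ 2 * |(ext j).indicator (fun p => (x n).1 p - u p) p|‖ ≤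
      ‖p‖ ^ 2 * (x n).1 p + ‖p‖ ^ 2 * u p := fun n => by
    filter_upwards [(hadm n).nonneg, hu0] with p h1 h2
    rw [Real.norm_of_nonneg (by positivity), ← mul_add]
    refine mul_le_mul_of_nonneg_left ?_ (by positivity)
    by_cases hp : p ∈ ext j
    · rw [Set.indicator_of_mem hp]
      exact (abs_sub _ _).trans_eq (by rw [abs_of_nonneg h1, abs_of_nonneg h2])
    · rw [Set.indicator_of_notMem hp, abs_zero]
      positivity
  have hi : ∀ n, Integrable fun p =>
      ‖p‖ ^ 2 * |(ext j).indicator (fun p => (x n).1 p - u p) p| := fun n => by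
    refine ((hadm n).int_kin.add hu2.1).mono' ?_ (hdom n)
    exact (continuous_norm.pow 2).aestronglyMeasurable.mul
      ((hd1 n).indicator hS).abs.aestronglyMeasurable
  refine tendsto_integral_abs_of_sq (C := C + C) (fun n => (hd1 n).indicator hS)
    (fun n => ?_) hi (fun n => ?_) ?_
  · rw [hind, integrable_indicator_iff hS]
    exact (hd2 n).1
  · refine (integral_mono_ae (hi n) ((hadm n).int_kin.add hu2.1) ?_).trans ?_
    · filter_upwards [hdom n] with p hp using (le_abs_self _).trans hp
    · exact (integral_add (hadm n).int_kin hu2.1).trans_le (add_le_add (hCn n).2 hu2.2)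
  · have hlim := hL2.const_mul (((1 / 2) ^ j / B j)⁻¹)
    rw [mul_zero] at hlim
    refine squeeze_zero (fun n => integral_nonneg fun p => sq_nonneg _) (fun n => ?_) hlim
    rw [hind, integral_indicator hS]
    exact (hd2 n).2

end IsPotential

/-! ### Existence of minimizers -/

theorem tendsto_integral_abs_indicator_ext_compl {u : E3 → ℝ} (hu : Integrable u) :
    Tendsto (fun j => ∫ p, |(ext j)ᶜ.indicator u p|) atTop (𝓝 0) := by
  have h := tendsto_integral_of_dominated_convergence (μ := volume)
    (F := fun j p => |(ext j)ᶜ.indicator u p|) (f := fun _ => 0) (fun p => |u p|)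
    (fun j => (hu.indicator (measurableSet_ext j).compl).abs.aestronglyMeasurable) hu.abs
    (fun j => Eventually.of_forall fun p => ?_) ?_
  · simpa using h
  · rw [Real.norm_eq_abs, abs_abs]
    by_cases hp : p ∈ (ext j)ᶜ
    · rw [Set.indicator_of_mem hp]
    · rw [Set.indicator_of_notMem hp, abs_zero]
      exact abs_nonneg _
  · filter_upwards [ae_ne_zero] with p hp
    refine tendsto_const_nhds.congr' ?_
    filter_upwards [eventually_mem_ext hp] with j hj
    rw [Set.indicator_of_notMem (Set.notMem_compl_iff.2 hj), abs_zero]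

namespace IsPotential

variable {U : E3 → ℝ} (hU : IsPotential U)

include hU

/-- If the energy levels above `I` are reached at a fixed condensate density `r`, then so is the
level `I`, possibly at a larger condensate density. -/
theorem exists_energy_le_of_level {T : ℝ} (hT : 0 < T) (μ : ℝ) {r I : ℝ} (hr : 0 ≤ r)
    (hI : ∀ η > 0, ∃ γ α, Adm γ α ∧ energy U T μ γ α r ≤ I + η) :
    ∃ γ α s, Adm γ α ∧ 0 ≤ s ∧ energy U T μ γ α s ≤ I := by
  have c0 := cst_pos
  obtain ⟨γs, αs, u, v, C, hC, hadm, hE, hmass, hkin, hγ, hα, hu, hL⟩ :=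
    hU.exists_convergent_minimizing hT μ hr hI
  -- Diagonal choice: convergence holds on each exterior separately, so n is taken large depending
  -- on the shrinking radius 1/(j + 1).
  have hpick : ∀ j : ℕ, ∃ n, j ≤ n ∧
      ∫ p, |(ext j).indicator (fun p => γs n p - u p) p| ≤ 1 / ((j : ℝ) + 1) := fun j => by
    have h1 := (hL j).eventually_le_const (show (0 : ℝ) < 1 / ((j : ℝ) + 1) by positivity)
    obtain ⟨n, hn1, hn2⟩ := (h1.and (eventually_ge_atTop j)).exists
    exact ⟨n, hn2, hn1⟩
  choose n hjn hn using hpick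
  have hn_top : Tendsto n atTop atTop := tendsto_atTop_mono hjn tendsto_id
  obtain ⟨K, hK⟩ := hU.exists_condense_bound hT μ (C₀ := max C r) (hC.trans (le_max_left _ _))
  have hcond : ∀ j : ℕ, ∃ σ : ℝ, (σ = 1 ∨ σ = -1) ∧
      energy U T μ ((ext j).indicator (γs (n j))) (fun p => σ * (ext j).indicator (αs (n j)) p)
        (r + cst * ∫ p, (ext j)ᶜ.indicator (γs (n j)) p) ≤
      energy U T μ (γs (n j)) (αs (n j)) r + K * (1 / ((j : ℝ) + 1)) := fun j => by
    have hj : 1 / ((j : ℝ) + 1) ≤ 1 := by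
      rw [div_le_one (by positivity)]
      linarith [(Nat.cast_nonneg j : (0 : ℝ) ≤ j)]
    have := hK (1 / ((j : ℝ) + 1)) (by positivity) hj _ _ r (hadm (n j)) hr (le_max_right _ _)
      ((hmass _).trans (le_max_left _ _))
    simpa only [ext, compl_compl] using this
  choose σ hσ hcond using hcond
  have hadm' : ∀ j, Adm ((ext j).indicator (γs (n j)))
      (fun p => σ j * (ext j).indicator (αs (n j)) p) := fun j => by
    have h1 := (hadm (n j)).indicator (measurableSet_ext j)
    rcases hσ j with h | h
    · simpa only [h, one_mul] using h1
    · simpa only [h, neg_one_mul] using h1.neg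
  have hind : ∀ (A : Set E3), MeasurableSet A → ∀ k, 0 ≤ ∫ p, A.indicator (γs k) p ∧
      ∫ p, A.indicator (γs k) p ≤ C := fun A hA k => by
    refine ⟨((hadm k).indicator hA).gamma_nonneg, le_trans ?_ (hmass k)⟩
    refine integral_mono_ae ((hadm k).int_gamma.indicator hA) (hadm k).int_gamma ?_
    filter_upwards [(hadm k).nonneg] with p hp
    exact Set.indicator_apply_le' (fun _ => le_rfl) fun _ => hp
  have hkin' : ∀ j, ∫ p, ‖p‖ ^ 2 * (ext j).indicator (γs (n j)) p ≤ C := fun j => by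
    refine le_trans (integral_mono_ae (hadm' j).int_kin (hadm (n j)).int_kin ?_) (hkin (n j))
    filter_upwards [(hadm (n j)).nonneg] with p hp
    exact mul_le_mul_of_nonneg_left (Set.indicator_apply_le' (fun _ => le_rfl) fun _ => hp)
      (by positivity)
  set rs : ℕ → ℝ := fun j => r + cst * ∫ p, (ext j)ᶜ.indicator (γs (n j)) p with hrs
  have hrs0 : ∀ j, 0 ≤ rs j := fun j =>
    add_nonneg hr (mul_nonneg c0.le (hind _ (measurableSet_ext j).compl _).1)
  have hrsC : ∀ j, rs j ≤ r + cst * C := fun j =>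
    add_le_add le_rfl (mul_le_mul_of_nonneg_left (hind _ (measurableSet_ext j).compl _).2 c0.le)
  -- The condensate densities and the signs are made convergent together; the limiting pair function
  -- is τv.
  obtain ⟨⟨s, τ⟩, hsτ, φ, hφ, hlim⟩ := ((isCompact_Icc (a := (0 : ℝ)) (b := r + cst * C)).prod
    (isCompact_Icc (a := (-1 : ℝ)) (b := 1))).tendsto_subseq (x := fun j => (rs j, σ j))
    (fun j => ⟨⟨hrs0 j, hrsC j⟩, by rcases hσ j with h | h <;> simp [h]⟩)
  have hlim1 : Tendsto (fun k => rs (φ k)) atTop (𝓝 s) := (continuous_fst.tendsto _).comp hlim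
  have hlim2 : Tendsto (fun k => σ (φ k)) atTop (𝓝 τ) := (continuous_snd.tendsto _).comp hlim
  have hz := (tendsto_one_div_add_atTop_nhds_zero_nat (𝕜 := ℝ))
  have hmain := hU.energy_le_of_tendsto hT μ
    (γs := fun k => (ext (φ k)).indicator (γs (n (φ k))))
    (αs := fun k p => σ (φ k) * (ext (φ k)).indicator (αs (n (φ k))) p)
    (rs := fun k => rs (φ k)) (γ := u) (α := fun p => τ * v p) (r := s) (C := C) (B := I)
    (b := fun k => I + 1 / (((φ k : ℕ) : ℝ) + 1) + K * (1 / (((φ k : ℕ) : ℝ) + 1)))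
    (fun k => hadm' _) (fun k => hrs0 _) ?_ ?_ hlim1 ?_
    (fun k => (hind _ (measurableSet_ext _) _).2) (fun k => hkin' _) ?_ ?_
  · exact ⟨_, _, s, hmain.1, hsτ.1.1, hmain.2⟩
  · filter_upwards [hγ, ae_ne_zero] with p hp hp0
    refine ((hp.comp hn_top).comp hφ.tendsto_atTop).congr' ?_
    filter_upwards [hφ.tendsto_atTop.eventually (eventually_mem_ext hp0)] with k hk
    simp [hk]
  · filter_upwards [hα, ae_ne_zero] with p hp hp0
    refine hlim2.mul (((hp.comp hn_top).comp hφ.tendsto_atTop).congr' ?_)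
    filter_upwards [hφ.tendsto_atTop.eventually (eventually_mem_ext hp0)] with k hk
    simp [hk]
  · have h1 := (hz.add (tendsto_integral_abs_indicator_ext_compl hu)).comp hφ.tendsto_atTop
    rw [add_zero] at h1
    refine squeeze_zero (fun k => integral_nonneg fun p => abs_nonneg _) (fun k => ?_) h1
    have hS := measurableSet_ext (φ k)
    have hi1 := ((((hadm (n (φ k))).int_gamma).sub hu).indicator hS).abs
    have hi2 := (hu.indicator hS.compl).abs
    -- The L¹ distance splits into the error on the exterior and the mass of u itself in the removed
    -- ball.
    refine le_trans (le_of_eq ?_) (add_le_add_left (hn (φ k)) _)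
    refine Eq.trans ?_ (integral_add hi1 hi2)
    refine integral_congr_ae (Eventually.of_forall fun p => ?_)
    by_cases hp : p ∈ ext (φ k) <;> simp [hp]
  · have h1 := ((hz.const_add I).add (hz.const_mul K)).comp hφ.tendsto_atTop
    simpa [Function.comp_def] using h1
  · intro k
    refine (hcond (φ k)).trans (add_le_add_left ((hE _).trans ?_) _)
    have h1 : ((φ k : ℕ) : ℝ) ≤ (n (φ k) : ℝ) := by exact_mod_cast hjn (φ k)
    gcongr

/-- The free energy functional of a potential has a minimizer. -/
theorem exists_minimizer {T : ℝ} (hT : 0 < T) (μ : ℝ) :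
    ∃ γ α r, Adm γ α ∧ 0 ≤ r ∧ ∀ γ' α' r', Adm γ' α' → 0 ≤ r' →
      energy U T μ γ α r ≤ energy U T μ γ' α' r' := by
  have c0 := cst_pos
  have u0 := hU.pos_zero
  set S : Set ℝ := {e | ∃ γ α r, Adm γ α ∧ 0 ≤ r ∧ energy U T μ γ α r = e} with hS
  have hSne : S.Nonempty := ⟨_, _, _, 0, Adm.zero, le_rfl, rfl⟩
  have hSbdd : BddBelow S := by
    obtain ⟨K, hK⟩ := hU.exists_coercive hT μ
    refine ⟨-K, ?_⟩
    rintro _ ⟨γ, α, r, h, hr, rfl⟩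
    have h1 := hK γ α r h hr
    have h2 : 0 ≤ cst / 2 * (∫ p, ‖p‖ ^ 2 * γ p) := mul_nonneg (by positivity) h.kin_nonneg
    have h3 : 0 ≤ U 0 / 4 * (r + cst * ∫ p, γ p) ^ 2 := by positivity
    linarith
  set I := sInf S with hI
  have hle : ∀ γ α r, Adm γ α → 0 ≤ r → I ≤ energy U T μ γ α r := fun γ α r h hr =>
    csInf_le hSbdd ⟨γ, α, r, h, hr, rfl⟩
  have hseq : ∀ n : ℕ, ∃ γ α r, Adm γ α ∧ 0 ≤ r ∧
      energy U T μ γ α r ≤ I + 1 / ((n : ℝ) + 1) := fun n => by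
    obtain ⟨_, ⟨γ, α, r, h, hr, rfl⟩, hlt⟩ := exists_lt_of_csInf_lt hSne
      (lt_add_of_pos_right I (show (0 : ℝ) < 1 / ((n : ℝ) + 1) by positivity))
    exact ⟨γ, α, r, h, hr, hlt.le⟩
  choose γs αs rs hadm hr0 hE using hseq
  obtain ⟨C, hC0, hC⟩ := hU.exists_sublevel_bound hT μ (I + 1)
  have hCn : ∀ n, rs n ≤ C ∧ ∫ p, γs n p ≤ C := fun n => by
    have h1 : 1 / ((n : ℝ) + 1) ≤ 1 := by
      rw [div_le_one (by positivity)]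
      linarith [(Nat.cast_nonneg n : (0 : ℝ) ≤ n)]
    have := hC _ _ _ (hadm n) (hr0 n) ((hE n).trans (by linarith))
    exact ⟨this.1, this.2.1⟩
  -- Only the limit r is kept from this minimizing sequence. Its states are used once more, in
  -- `hlevel`, to show that the infimum is approached at density r; a better sequence is then built
  -- at that fixed density.
  obtain ⟨r, hr, φ, hφ, hlim⟩ := (isCompact_Icc (a := (0 : ℝ)) (b := C)).tendsto_subseq
    (x := rs) (fun n => ⟨hr0 n, (hCn n).1⟩)
  obtain ⟨D, hD0, hD⟩ := hU.exists_energy_lipschitz T μ hC0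
  have hlevel : ∀ η > 0, ∃ γ α, Adm γ α ∧ energy U T μ γ α r ≤ I + η := fun η hη => by
    have h1 : Tendsto (fun k => 1 / (((φ k : ℕ) : ℝ) + 1) + D * |r - rs (φ k)|) atTop (𝓝 0) := by
      have h2 := (tendsto_one_div_add_atTop_nhds_zero_nat (𝕜 := ℝ)).comp hφ.tendsto_atTop
      have h3 := ((hlim.const_sub r).abs).const_mul D
      simpa using h2.add h3
    obtain ⟨k, hk⟩ := (h1.eventually_le_const hη).exists
    refine ⟨_, _, hadm (φ k), ?_⟩
    have h2 := hD _ _ r (rs (φ k)) (hadm (φ k)) (hCn _).2 hr.1 hr.2 (hr0 _) (hCn _).1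
    linarith [hE (φ k)]
  obtain ⟨γ, α, s, h, hs, hlast⟩ := hU.exists_energy_le_of_level hT μ hr.1 hlevel
  exact ⟨γ, α, s, h, hs, fun γ' α' r' h' hr' => hlast.trans (hle _ _ _ h' hr')⟩

end IsPotential

/-! ### The Fourier transform of a radial potential -/

section FourierPotential

variable {V : E3 → ℝ}

theorem isRadial_Vhat (hrad : IsRadial V) : IsRadial (Vhat V) := by
  intro p q hpq
  obtain ⟨R, rfl⟩ := exists_isometry_eq hpq
  unfold Vhat fourierC
  congr 1
  rw [← R.measurePreserving.integral_comp R.toHomeomorph.measurableEmbedding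
    (fun x => Complex.exp (-(Complex.I * ((inner ℝ (R p) x : ℝ) : ℂ))) * (V x : ℂ))]
  refine integral_congr_ae (Eventually.of_forall fun x => ?_)
  simp only [R.inner_map_map, hrad (R x) x (R.norm_map x)]

theorem Vhat_zero_pos (hint : Integrable V) (hnn : ∀ x, 0 ≤ V x) (hne : ¬ V =ᵐ[volume] 0) :
    0 < Vhat V 0 := by
  have h : Vhat V 0 = ∫ x, V x := by
    unfold Vhat fourierC
    simp only [inner_zero_left, Complex.ofReal_zero, mul_zero, neg_zero, Complex.exp_zero, one_mul]
    rw [integral_complex_ofReal, Complex.ofReal_re]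
  rw [h]
  refine (integral_nonneg hnn).lt_of_ne' fun h0 => hne ?_
  exact (integral_eq_zero_iff_of_nonneg hnn hint).1 h0

/-- The phase `e^{-i p·x}`. -/
def phase (p x : E3) : ℂ := Complex.exp (-(Complex.I * ((inner ℝ p x : ℝ) : ℂ)))

theorem continuous_phase_comp {X : Type*} [TopologicalSpace X] {f g : X → E3} (hf : Continuous f)
    (hg : Continuous g) : Continuous fun w => phase (f w) (g w) := by
  have h : Continuous fun w => (inner ℝ (f w) (g w) : ℝ) := hf.inner hg
  exact Complex.continuous_exp.comp
    ((continuous_const.mul (Complex.continuous_ofReal.comp h)).neg)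

theorem norm_phase (p x : E3) : ‖phase p x‖ = 1 := by
  unfold phase
  rw [show -(Complex.I * ((inner ℝ p x : ℝ) : ℂ)) = ((-inner ℝ p x : ℝ) : ℂ) * Complex.I by
    push_cast; ring]
  exact Complex.norm_exp_ofReal_mul_I _

theorem phase_sub (p q x : E3) : phase (p - q) x = phase p x * (starRingEnd ℂ) (phase q x) := by
  unfold phase
  rw [← Complex.exp_conj, ← Complex.exp_add]
  congr 1
  simp [inner_sub_left]
  ring

theorem integrable_phase_mul (hint : Integrable V) {φ : E3 → ℝ}
    (hφ : Integrable φ) :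
    Integrable (fun w : (E3 × E3) × E3 => phase (w.1.1 - w.1.2) w.2 *
      (((φ w.1.1 * φ w.1.2 : ℝ) : ℂ) * (V w.2 : ℂ))) (vol2.prod volume) := by
  have hφ2 : Integrable (fun z : E3 × E3 => ((φ z.1 * φ z.2 : ℝ) : ℂ)) vol2 :=
    (hφ.mul_prod hφ).ofReal
  have hV2 : Integrable (fun x => (V x : ℂ)) := hint.ofReal
  have hc : Continuous fun w : (E3 × E3) × E3 => phase (w.1.1 - w.1.2) w.2 :=
    continuous_phase_comp ((continuous_fst.comp continuous_fst).sub
      (continuous_snd.comp continuous_fst)) continuous_snd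
  have h1 : Integrable (fun w : (E3 × E3) × E3 => ((φ w.1.1 * φ w.1.2 : ℝ) : ℂ) * (V w.2 : ℂ))
      (vol2.prod volume) := Integrable.mul_prod (L := ℂ) hφ2 hV2
  have h3 : AEStronglyMeasurable (fun w : (E3 × E3) × E3 => phase (w.1.1 - w.1.2) w.2)
    (vol2.prod volume) := hc.aestronglyMeasurable
  have h4 : ∀ᵐ w : (E3 × E3) × E3 ∂(vol2.prod volume), ‖phase (w.1.1 - w.1.2) w.2‖ ≤ 1 :=
    Eventually.of_forall fun w => (norm_phase _ _).le
  exact h1.bdd_mul h3 h4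

/-- The phase at p - q factors into a phase and a conjugate phase, so the double momentum integral
is a squared modulus. -/
theorem integral_phase_sub_mul (x : E3) (φ : E3 → ℝ) :
    ∫ z : E3 × E3, phase (z.1 - z.2) x * (((φ z.1 * φ z.2 : ℝ) : ℂ) * (V x : ℂ)) ∂vol2 =
      ((V x * ‖∫ p, phase p x * (φ p : ℂ)‖ ^ 2 : ℝ) : ℂ) := by
  have h1 : ∀ z : E3 × E3, phase (z.1 - z.2) x * (((φ z.1 * φ z.2 : ℝ) : ℂ) * (V x : ℂ)) =
      (V x : ℂ) * ((phase z.1 x * (φ z.1 : ℂ)) *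
        (starRingEnd ℂ) (phase z.2 x * (φ z.2 : ℂ))) := fun z => by
    simp only [phase_sub, map_mul, Complex.conj_ofReal, Complex.ofReal_mul]
    ring
  simp only [h1]
  rw [integral_const_mul, integral_prod_mul (fun p => phase p x * (φ p : ℂ))
    (fun p => (starRingEnd ℂ) (phase p x * (φ p : ℂ))), integral_conj, Complex.mul_conj,
    Complex.normSq_eq_norm_sq]
  push_cast
  rfl

/-- The easy half of Bochner's theorem: after exchanging integrals the form equals ∫ V(x)|∫
e^{-ip·x} φ(p) dp|² dx. This is where V ≥ 0 gives convexity of the interaction. -/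
theorem dbl_Vhat_nonneg (hint : Integrable V) (hnn : ∀ x, 0 ≤ V x) {φ : E3 → ℝ}
    (hφ : Integrable φ) : 0 ≤ dbl (Vhat V) φ φ := by
  have hG := integrable_phase_mul hint hφ
  have h1 : ∀ z : E3 × E3, Vhat V (z.1 - z.2) * (φ z.1 * φ z.2) =
      (∫ x, phase (z.1 - z.2) x * (((φ z.1 * φ z.2 : ℝ) : ℂ) * (V x : ℂ))).re := fun z => by
    have h2 : ∫ x, phase (z.1 - z.2) x * (((φ z.1 * φ z.2 : ℝ) : ℂ) * (V x : ℂ)) =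
        fourierC V (z.1 - z.2) * ((φ z.1 * φ z.2 : ℝ) : ℂ) := by
      unfold fourierC
      rw [← integral_mul_const]
      refine integral_congr_ae (Eventually.of_forall fun x => ?_)
      simp only [phase]
      ring
    rw [h2, Complex.re_mul_ofReal]
    rfl
  have h2 := hG.integral_prod_left
  have hre : dbl (Vhat V) φ φ = (∫ z, ∫ x, phase (z.1 - z.2) x *
      (((φ z.1 * φ z.2 : ℝ) : ℂ) * (V x : ℂ)) ∂volume ∂vol2).re := by
    unfold dbl
    simp only [h1]
    exact integral_re h2
  rw [hre, integral_integral_swap (f := fun (z : E3 × E3) x => phase (z.1 - z.2) x *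
    (((φ z.1 * φ z.2 : ℝ) : ℂ) * (V x : ℂ))) hG]
  simp only [integral_phase_sub_mul]
  rw [integral_complex_ofReal, Complex.ofReal_re]
  exact integral_nonneg fun x => mul_nonneg (hnn x) (by positivity)

end FourierPotential

/-! ### Translation estimates for functions with bounded, square integrable gradient -/

section Gradient

variable {W : E3 → ℝ}

theorem abs_sub_le_of_norm_gradient_le (hW : Differentiable ℝ W) {C : ℝ}
    (hC : ∀ p, ‖gradient W p‖ ≤ C) (p q : E3) : |W p - W q| ≤ C * ‖p - q‖ := by
  refine convex_univ.norm_image_sub_le_of_norm_fderiv_le (𝕜 := ℝ) (f := W) (fun x _ => hW x)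
    (fun x _ => ?_) (Set.mem_univ q) (Set.mem_univ p)
  have := hC x
  rwa [gradient, LinearIsometryEquiv.norm_map] at this

/-- Fundamental theorem of calculus on the segment, then Jensen. The latter appears as nonnegativity
of the variance of the directional derivative about its mean `D`. -/
theorem sq_sub_le_integral_gradient (hW : ContDiff ℝ 1 W) (x h : E3) :
    (W (x + h) - W x) ^ 2 ≤ ‖h‖ ^ 2 * ∫ t in (0 : ℝ)..1, ‖gradient W (x + t • h)‖ ^ 2 := by
  have hd : Differentiable ℝ W := hW.differentiable one_ne_zero
  have hgc : Continuous (gradient W) :=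
    (InnerProductSpace.toDual ℝ E3).symm.continuous.comp (hW.continuous_fderiv one_ne_zero)
  have hline : Continuous fun t : ℝ => x + t • h := by fun_prop
  have hder : ∀ t : ℝ, HasDerivAt (fun t : ℝ => W (x + t • h))
      (inner ℝ (gradient W (x + t • h)) h) t := fun t => by
    have h1 : HasDerivAt (fun t : ℝ => x + t • h) h t := by
      simpa using ((hasDerivAt_id t).smul_const h).const_add x
    have h2 := (hd (x + t • h)).hasGradientAt.hasFDerivAt.comp_hasDerivAt t h1
    simpa [Function.comp_def] using h2
  have hcd : Continuous fun t : ℝ => inner ℝ (gradient W (x + t • h)) h :=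
    (hgc.comp hline).inner continuous_const
  have hftc : W (x + h) - W x = ∫ t in (0 : ℝ)..1, inner ℝ (gradient W (x + t • h)) h := by
    rw [intervalIntegral.integral_eq_sub_of_hasDerivAt (fun t _ => hder t)
      (hcd.intervalIntegrable _ _)]
    simp
  set D := W (x + h) - W x with hDdef
  have hsq : 0 ≤ ∫ t in (0 : ℝ)..1, (inner ℝ (gradient W (x + t • h)) h - D) ^ 2 :=
    intervalIntegral.integral_nonneg zero_le_one fun t _ => sq_nonneg _
  have hexp : ∫ t in (0 : ℝ)..1, (inner ℝ (gradient W (x + t • h)) h - D) ^ 2 =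
      (∫ t in (0 : ℝ)..1, inner ℝ (gradient W (x + t • h)) h ^ 2) - D ^ 2 := by
    have e : ∀ t : ℝ, (inner ℝ (gradient W (x + t • h)) h - D) ^ 2 =
        inner ℝ (gradient W (x + t • h)) h ^ 2 -
          (2 * D * inner ℝ (gradient W (x + t • h)) h - D ^ 2) := fun t => by ring
    simp only [e]
    rw [intervalIntegral.integral_sub
        (f := fun t : ℝ => inner ℝ (gradient W (x + t • h)) h ^ 2)
        ((hcd.pow 2).intervalIntegrable _ _)
        ((by fun_prop : Continuous fun t : ℝ =>
          2 * D * inner ℝ (gradient W (x + t • h)) h - D ^ 2).intervalIntegrable _ _),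
      intervalIntegral.integral_sub (f := fun t : ℝ => 2 * D * inner ℝ (gradient W (x + t • h)) h)
        ((hcd.const_mul _).intervalIntegrable _ _)
        (continuous_const.intervalIntegrable _ _),
      intervalIntegral.integral_const_mul, ← hftc]
    simp
    ring
  have hcs : ∫ t in (0 : ℝ)..1, inner ℝ (gradient W (x + t • h)) h ^ 2 ≤
      ∫ t in (0 : ℝ)..1, ‖h‖ ^ 2 * ‖gradient W (x + t • h)‖ ^ 2 := by
    refine intervalIntegral.integral_mono_on zero_le_one ((hcd.pow 2).intervalIntegrable _ _)
      ((((hgc.comp hline).norm.pow 2).const_mul _).intervalIntegrable _ _) fun t _ => ?_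
    rw [← mul_pow, mul_comm, ← sq_abs (inner ℝ _ _)]
    gcongr
    exact abs_real_inner_le_norm _ _
  rw [intervalIntegral.integral_const_mul] at hcs
  linarith

/-- Integrate the segment estimate over x and exchange the integrals; translation invariance makes
the inner integral independent of t. -/
theorem integral_sq_translate_sub_le (hW : ContDiff ℝ 1 W)
    (hg : MemLp (gradient W) 2 volume) (h : E3) :
    Integrable (fun x => (W (x + h) - W x) ^ 2) ∧
      ∫ x, (W (x + h) - W x) ^ 2 ≤ (∫ x, ‖gradient W x‖ ^ 2) * ‖h‖ ^ 2 := by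
  have hgc : Continuous (gradient W) :=
    (InnerProductSpace.toDual ℝ E3).symm.continuous.comp (hW.continuous_fderiv one_ne_zero)
  have hWc := hW.continuous
  have hi : Integrable fun x => ‖gradient W x‖ ^ 2 := hg.integrable_norm_pow two_ne_zero
  set m : Measure ℝ := volume.restrict (Set.Ioc 0 1) with hm
  have hcont : Continuous fun z : ℝ × E3 => ‖gradient W (z.2 + z.1 • h)‖ ^ 2 :=
    (hgc.comp (by fun_prop : Continuous fun z : ℝ × E3 => z.2 + z.1 • h)).norm.pow 2
  have hprod : Integrable (fun z : ℝ × E3 => ‖gradient W (z.2 + z.1 • h)‖ ^ 2) (m.prod volume) := by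
    refine (integrable_prod_iff hcont.aestronglyMeasurable).2
      ⟨Eventually.of_forall fun t => hi.comp_add_right (t • h), ?_⟩
    have e : (fun t : ℝ => ∫ x : E3, ‖‖gradient W (x + t • h)‖ ^ 2‖) =
        fun _ => ∫ x, ‖gradient W x‖ ^ 2 := by
      ext t
      simp only [norm_pow, norm_norm]
      exact integral_add_right_eq_self (fun x => ‖gradient W x‖ ^ 2) (t • h)
    rw [e]
    exact integrable_const _
  have hswap : ∫ x, ∫ t, ‖gradient W (x + t • h)‖ ^ 2 ∂m = ∫ x, ‖gradient W x‖ ^ 2 := by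
    rw [← integral_integral_swap (f := fun t x => ‖gradient W (x + t • h)‖ ^ 2) hprod]
    have e : ∀ t : ℝ, ∫ x : E3, ‖gradient W (x + t • h)‖ ^ 2 = ∫ x, ‖gradient W x‖ ^ 2 :=
      fun t => integral_add_right_eq_self (fun x => ‖gradient W x‖ ^ 2) (t • h)
    simp only [e]
    simp [hm]
  have hle : ∀ x, (W (x + h) - W x) ^ 2 ≤
      ‖h‖ ^ 2 * ∫ t, ‖gradient W (x + t • h)‖ ^ 2 ∂m := fun x => by
    have := sq_sub_le_integral_gradient hW x h
    rwa [intervalIntegral.integral_of_le zero_le_one] at this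
  have hbd := hprod.integral_prod_right.const_mul (‖h‖ ^ 2)
  have hint : Integrable fun x => (W (x + h) - W x) ^ 2 := by
    refine hbd.mono' (by fun_prop : Continuous fun x => (W (x + h) - W x) ^ 2).aestronglyMeasurable
      (Eventually.of_forall fun x => ?_)
    rw [Real.norm_of_nonneg (sq_nonneg _)]
    exact hle x
  refine ⟨hint, (integral_mono hint hbd hle).trans_eq ?_⟩
  rw [integral_const_mul, hswap, mul_comm]

end Gradient

end Bogoliubov

end

/-! ### Verification of the hypotheses on V̂ and conclusion. -/

theorem theorem2p1 (T μ : ℝ) (hT : 0 < T)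
    (V : Bogoliubov.E3 → ℝ)
    (hV_int : MeasureTheory.Integrable V)
    (hV_rad : Bogoliubov.IsRadial V)
    (hV_nonneg : ∀ x, 0 ≤ V x)
    (hVhat_nonneg : ∀ p, 0 ≤ Bogoliubov.Vhat V p)
    (hV_ne : ¬ (V =ᵐ[MeasureTheory.volume] 0))
    (hVhat_C1 : ContDiff ℝ 1 (Bogoliubov.Vhat V))
    (hVhat_L1 : MeasureTheory.Integrable (Bogoliubov.Vhat V))
    (hVhat_bdd : ∃ C : ℝ, ∀ p, |Bogoliubov.Vhat V p| ≤ C)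
    (hgrad_L2 : MeasureTheory.MemLp (gradient (Bogoliubov.Vhat V)) 2 MeasureTheory.volume)
    (hgrad_bdd : ∃ C : ℝ, ∀ p, ‖gradient (Bogoliubov.Vhat V) p‖ ≤ C) :
    ∃ x ∈ Bogoliubov.domainD,
      IsMinOn (Bogoliubov.freeEnergy V T μ) Bogoliubov.domainD x := by
  obtain ⟨B, hB⟩ := hVhat_bdd
  obtain ⟨L, hL⟩ := hgrad_bdd
  have hU : Bogoliubov.IsPotential (Bogoliubov.Vhat V) :=
    { nonneg := hVhat_nonneg
      continuous := hVhat_C1.continuous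
      integrable := hVhat_L1
      bdd := ⟨B, fun p => (le_abs_self _).trans (hB p)⟩
      radial := Bogoliubov.isRadial_Vhat hV_rad
      pos_zero := Bogoliubov.Vhat_zero_pos hV_int hV_nonneg hV_ne
      lip := ⟨L, (norm_nonneg _).trans (hL 0), Bogoliubov.abs_sub_le_of_norm_gradient_le
        (hVhat_C1.differentiable one_ne_zero) hL⟩
      lipL2 := ⟨_, integral_nonneg fun p => by positivity,
        Bogoliubov.integral_sq_translate_sub_le hVhat_C1 hgrad_L2⟩
      posdef := fun φ hφ => Bogoliubov.dbl_Vhat_nonneg hV_int hV_nonneg hφ }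
  obtain ⟨γ, α, r, h, hr, hmin⟩ := hU.exists_minimizer hT μ
  refine ⟨(γ, α, r), Bogoliubov.mem_domainD_iff.2 ⟨h, hr⟩, isMinOn_iff.2 fun y hy => ?_⟩
  obtain ⟨hy1, hy2⟩ := Bogoliubov.mem_domainD_iff.1 hy
  rw [Bogoliubov.freeEnergy_eq_energy hU T μ hy1,
    Bogoliubov.freeEnergy_eq_energy (x := (γ, α, r)) hU T μ h]
  exact hmin _ _ _ hy1 hy2
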